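/- **Problem.** Let $T\ge 1$, $x_0\in\mathbb R^n$, and let $(\xi_t)_{t=1}^T$, $\xi_t=(\Psi_t,b_t,(A_{t,\tau})_{0\le\tau\le t})$, satisfy (H1) $\xi_1$ is deterministic, the process $(\xi_t)$ is interstage independent, and for $t=2,\dots,T$ the vector $\xi_t$ takes finitely many values $\xi_{t,1},\dots,\xi_{t,M_t}$, with probabilities $\Phi_{t,j}>0$, $\sum_j\Phi_{t,j}=1$. Put $X_t(x_{0:t-1},\xi_t)=\{x_t\in\mathbb R^n: x_t\ge 0,\ \sum_{\tau=0}^tA_{t,\tau}x_\tau=b_t\}$. For $t=2,\dots,T$ let $\mathcal P_t$ be a nonempty closed convex subset of $\{p\in\mathbb R^{M_t}:p\ge 0,\ \sum_jp_j\Phi_{t,j}=1\}$, and let $\rho_t(Z)=\sup_{p\in\mathcal P_t}\sum_jp_j\Phi_{t,j}Z_j$ be the corresponding coherent risk measure. Let $\mathcal Q_{T+1}\equiv 0$ and, for $t\le T$, $$\mathfrak Q_t(x_{1:t-1},\xi_t)=\inf\{\Psi_t^\top x_{1:t}+\mathcal Q_{t+1}(x_{1:t}) : x_t\in X_t(x_{0:t-1},\xi_t)\},\qquad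 \mathcal Q_t(x_{1:t-1})=\rho_t(\mathfrak Q_t(x_{1:t-1},\xi_t))\ \ (t\ge 2).$$ The first stage problem is to minimize $\Psi_1^\top x_1+\mathcal Q_2(x_1)$ over $x_1\in X_1(x_0,\xi_1)$; $\mathcal Q_1(x_0)$ is its optimal value. The realizations form a scenario tree with root $n_0$ (stage $0$, decision $x_0$), one node $n_1$ of stage $1$, and $M_t$ children, $t\ge2$, for every node of stage $t-1$. For a node $m$ of stage $t$, $\xi_m=(\Psi_m,b_m,(A_{\tau,m})_\tau)$ is the realization of $\xi_t$ at $m$, and $x_{[m]}$ is the vector of the decisions at the nodes of stages $1,\dots,t$ on the path from $n_1$ to $m$. **Algorithm 2.** Optimality cuts $\theta_t^\ell+\langle\beta_t^\ell,x_{1:t-1}-x^\ell_{[n^\ell_{t-1}]}\rangle$, $0\le\ell\le k$, define $\mathcal Q_t^k$ as their maximum. Initially $\mathcal Q_t^0\equiv-\infty$ for $t\le T$, $\mathcal Q^0_{T+1}\equiv 0$, and there is no feasibility cut. Iteration $k\ge 1$ samples a path $n_0,n_1,n_2^k,\dots,n_T^k$ in the tree and runs a forward pass from $t=1$. At stage $t$,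 with $n=n^k_{t-1}$, it solves for the children $m$ of $n$ the phase I problem $$\min\{e^\top(y_1+y_2): A_{t,m}x_t+y_1-y_2=b_m-\textstyle\sum_{\tau<t}A_{\tau,m}x^k_\tau,\ (x^k_{[n]},x_t)\text{ satisfies the feasibility cuts for }x_{1:t},\ x_t,y_1,y_2\ge0\},$$ where $e$ is the vector of ones and $x^k_\tau$ is the current decision of stage $\tau$ (with $x^k_{\tau}=x_0$ for $\tau=0$). If a phase I value $v$ is positive, then: if $t=1$, the algorithm stops and reports infeasibility; if $t\ge 2$, it adds the feasibility cut $v+s^\top(x_{1:t-1}-x^k_{[n]})\le 0$, where $s$ is the subgradient with respect to $x_{1:t-1}$ given by optimal Lagrange multipliers of the phase I problem, and goes back to stage $t-1$. If no phase I value is positive, it computes, for $m=n^k_t$, an optimal solution $x^k_m$ of $$\inf\{\Psi_m^\top(x^k_{[n]},x_t)+\mathcal Q_{t+1}^{k-1}(x^k_{[n]},x_t):x_t\in X_t(x_0,x^k_{[n]},\xi_m),\ (x^k_{[n]},x_t)\text{ satisfies the feasibility cuts for }x_{1:t}\}\qquad(*)$$ and goes to stage $t+1$. After stage $T$, for $t=2,\dots,T$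 and $n=n^k_{t-1}$, it solves $(*)$ for the other children $m$ of $n$ too; with $v_m$ the optimal values of $(*)$, $\pi_{k,m}$ the subgradients with respect to $x_{1:t-1}$ given by optimal Lagrange multipliers (arbitrary if $v_m=-\infty$), and $p_k\in\mathcal P_t$ attaining $\rho_t$ at $(v_m)_m$, it sets $\theta_t^k=\rho_t((v_m)_m)$ and $\beta_t^k=\sum_mp_{k,m}\Phi_m\pi_{k,m}$ ($\Phi_m$ being the probability of $\xi_m$); also $\theta^k_{T+1}=0$, $\beta^k_{T+1}=0$. Ties among optimal solutions, multipliers, weights $p_k$, and children with positive phase I value are broken by arbitrary rules that do not anticipate future samples. Let $\mathfrak Q_1^{k-1}(x_0,\xi_1)$ be the optimal value of $(*)$ for $t=1$ at iteration $k$, and let $x_1^k=x^k_{n_1}$. **Theorem.** Assume (H1) and (H2') for every $t=1,\dots,T$, every realization $(\tilde\xi_1,\dots,\tilde\xi_t)$ of $(\xi_1,\dots,\xi_t)$ and all decisions with $x_\tau\in X_\tau(x_{0:\tau-1},\tilde\xi_\tau)$ for $\tau=1,\dots,t-1$, the set $X_t(x_{0:t-1},\tilde\xi_t)$ is bounded and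 nonempty; (H3) for $k\ge 1$ and $t=2,\dots,T$, the realization $\xi_t^k$ sampled at stage $t$ of iteration $k$ equals $\xi_{t,j}$ with probability $\Phi_{t,j}$ and is independent of the realizations sampled at iterations $1,\dots,k-1$ and at stages $2,\dots,t-1$ of iteration $k$. Then either Algorithm 2 terminates reporting that the problem is infeasible, or the following holds almost surely: (i) for $t=2,\dots,T$ and every node $n$ of stage $t-1$, the set $\tilde{\mathcal S}_n$ of the iterations whose sampled path passes through the parent of $n$ is infinite, and $$\lim_{k\to\infty,\ k\in\tilde{\mathcal S}_n}\big(\mathcal Q_t(x^k_{[n]})-\mathcal Q_t^k(x^k_{[n]})\big)=0;$$ (ii) $\lim_{k\to\infty}\mathfrak Q_1^k(x_0,\xi_1)=\mathcal Q_1(x_0)\in\mathbb R$, and every accumulation point of $(x_1^k)_{k\ge1}$ is an optimal solution of the first stage problem. -/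

import Mathlib

open Filter Topology MeasureTheory ProbabilityTheory
open scoped Matrix

namespace MSLP

/-- Sequences of decisions `(x_0, x_1, x_2, …)` in `ℝⁿ`; a function of the history `x_{0:t-1}`
only reads the entries of index `< t`. -/
abbrev Hist (n : ℕ) := ℕ → Fin n → ℝ

/-- The history `x_{0:t-1}`: entries of index `≥ t` are erased. -/
def trunc {n : ℕ} (t : ℕ) (h : Hist n) : Hist n := fun τ => if τ < t then h τ else 0

/-- A realization of `ξ_t = (Ψ_t, b_t, (A_{t,τ})_{τ = 0..t})`. The cost vector `Ψ_t` multiplies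
`x_{1:t}` and is given by its blocks `Ψ_t(τ) ∈ ℝⁿ`, `τ = 1..t`. -/
structure Realization (n r : ℕ) where
  Ψ : ℕ → Fin n → ℝ
  b : Fin r → ℝ
  A : ℕ → Matrix (Fin r) (Fin n) ℝ

/-- Data of a risk-averse multistage stochastic linear program with an interstage independent
process `(ξ_t)`: at stage `t = 2..T`, independently of the past, `ξ_t` takes the value `ξ t j`
with probability `Φ t j > 0`, `j < M t`; `ξ_1` is deterministic. The coherent risk measure of
stage `t` is given by its dual representation, with dual set `dualSet t`. -/
structure Problem where
  /-- number of stages -/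
  T : ℕ
  one_le_T : 1 ≤ T
  /-- dimension of the decisions -/
  n : ℕ
  /-- the given initial decision -/
  x₀ : Fin n → ℝ
  /-- number of equality constraints of stage `t` -/
  rows : ℕ → ℕ
  /-- number of realizations of `ξ_t` -/
  M : ℕ → ℕ
  /-- The stages `0` (root of the scenario tree) and `1` have one node, and there is no randomness
  after stage `T`. -/
  M_eq_one : ∀ t, t < 2 ∨ T < t → M t = 1
  ξ : (t : ℕ) → Fin (M t) → Realization n (rows t)
  Φ : (t : ℕ) → Fin (M t) → ℝ
  Φ_pos : ∀ t, 2 ≤ t → t ≤ T → ∀ j, 0 < Φ t j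
  Φ_sum : ∀ t, 2 ≤ t → t ≤ T → ∑ j, Φ t j = 1
  dualSet : (t : ℕ) → Set (Fin (M t) → ℝ)
  dualSet_subset : ∀ t, 2 ≤ t → t ≤ T →
    dualSet t ⊆ {p | (∀ j, 0 ≤ p j) ∧ ∑ j, p j * Φ t j = 1}
  dualSet_nonempty : ∀ t, 2 ≤ t → t ≤ T → (dualSet t).Nonempty
  dualSet_convex : ∀ t, 2 ≤ t → t ≤ T → Convex ℝ (dualSet t)
  dualSet_closed : ∀ t, 2 ≤ t → t ≤ T → IsClosed (dualSet t)

/-- An optimality cut `h ↦ θ + ⟨β, x_{1:t-1} - base_{1:t-1}⟩` (with `θ = -∞` allowed). -/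
structure OptCut (n : ℕ) where
  θ : EReal
  β : ℕ → Fin n → ℝ
  base : Hist n

noncomputable def OptCut.eval {n : ℕ} (c : OptCut n) (t : ℕ) (h : Hist n) : EReal :=
  c.θ + ((∑ τ ∈ Finset.Ico 1 t, c.β τ ⬝ᵥ (h τ - c.base τ) : ℝ) : EReal)

/-- The polyhedral function of stage `t` defined by a list of cuts: the maximum of the cuts. -/
noncomputable def lowerApprox {n : ℕ} (t : ℕ) (L : List (OptCut n)) (h : Hist n) : EReal :=
  ⨆ c ∈ L, c.eval t h

/-- A feasibility cut `⟨x_{1:t-1}, β⟩ ≤ θ`. -/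
structure FeasCut (n : ℕ) where
  θ : ℝ
  β : ℕ → Fin n → ℝ

/-- `⟨x_{1:t-1}, β⟩ - θ`. -/
def FeasCut.excess {n : ℕ} (c : FeasCut n) (t : ℕ) (h : Hist n) : ℝ :=
  (∑ τ ∈ Finset.Ico 1 t, h τ ⬝ᵥ c.β τ) - c.θ

/-- Multipliers of the stage subproblem: for the `r` equality constraints, the `a` optimality
cuts and the `b` feasibility cuts. -/
structure Multipliers (r a b : ℕ) where
  eq : Fin r → ℝ
  opt : Fin a → ℝ
  feas : Fin b → ℝ

/-- Multipliers of the phase I problem. -/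
structure PhaseMultipliers (r b : ℕ) where
  eq : Fin r → ℝ
  feas : Fin b → ℝ

namespace Problem

variable (P : Problem)

/-! ### The scenario tree -/

/-- A scenario: one realization index per stage. -/
abbrev Scenario := (t : ℕ) → Fin (P.M t)

/-- A node of stage `t` of the scenario tree: the indices of the realizations of stages `0..t`. -/
abbrev Node (t : ℕ) := (s : Fin (t + 1)) → Fin (P.M s)

variable {P}

/-- The node of stage `t` of a scenario. -/
def Scenario.node (σ : P.Scenario) (t : ℕ) : P.Node t := fun s => σ s

/-- The child, with index `j` at stage `t`, of the node of stage `t - 1` of a scenario. -/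
def Scenario.child (σ : P.Scenario) (t : ℕ) (j : Fin (P.M t)) : P.Node t :=
  Scenario.node (Function.update σ t j) t

/-- The ancestor of stage `τ` of a node of stage `t`. -/
def Node.ancestor {t : ℕ} (m : P.Node t) (τ : ℕ) (hτ : τ ≤ t) : P.Node τ :=
  fun s => m (Fin.castLE (Nat.succ_le_succ hτ) s)

/-- The index of the realization of `ξ_t` at a node of stage `t`. -/
def Node.idx {t : ℕ} (m : P.Node t) : Fin (P.M t) := m (Fin.last t)

/-- The scenario passes through the parent of the node `m` of stage `t`. -/
def Scenario.PassesParent (σ : P.Scenario) {t : ℕ} (m : P.Node t) : Prop :=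
  ∀ s : Fin (t + 1), (s : ℕ) < t → σ s = m s

variable (P)

/-- The index of the only realization of `ξ_1`. -/
def idx₁ : Fin (P.M 1) := ⟨0, by rw [P.M_eq_one 1 (Or.inl (by norm_num))]; norm_num⟩

/-- The only node of stage `1`. -/
def node₁ : P.Node 1 := fun s => ⟨0, by rw [P.M_eq_one s (Or.inl s.isLt)]; norm_num⟩

/-- The history that consists of `x_0` only. -/
def start : Hist P.n := Function.update 0 0 P.x₀

/-! ### The dynamic programming equations -/

/-- `∑_{τ < t} A_{t,τ} x_τ + A_{t,t} x - b_t` for the realization `j` of `ξ_t`. -/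
def residual (t : ℕ) (j : Fin (P.M t)) (h : Hist P.n) (x : Fin P.n → ℝ) : Fin (P.rows t) → ℝ :=
  ∑ τ ∈ Finset.range t, (P.ξ t j).A τ *ᵥ h τ + (P.ξ t j).A t *ᵥ x - (P.ξ t j).b

/-- The feasible set `X_t(x_{0:t-1}, ξ_{t,j})`. -/
def feasible (t : ℕ) (j : Fin (P.M t)) (h : Hist P.n) : Set (Fin P.n → ℝ) :=
  {x | (∀ i, 0 ≤ x i) ∧ P.residual t j h x = 0}

/-- The cost `⟨Ψ_{t,j}, x_{1:t}⟩` with `x_t = x`. -/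
def cost (t : ℕ) (j : Fin (P.M t)) (h : Hist P.n) (x : Fin P.n → ℝ) : ℝ :=
  ∑ τ ∈ Finset.Ico 1 t, (P.ξ t j).Ψ τ ⬝ᵥ h τ + (P.ξ t j).Ψ t ⬝ᵥ x

/-- `∑_j p_j Φ_{t,j} Z_j`. -/
noncomputable def expect (t : ℕ) (p : Fin (P.M t) → ℝ) (Z : Fin (P.M t) → EReal) : EReal :=
  ∑ j, ((p j * P.Φ t j : ℝ) : EReal) * Z j

/-- The risk measure `ρ_t`. -/
noncomputable def risk (t : ℕ) (Z : Fin (P.M t) → EReal) : EReal :=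
  ⨆ p ∈ P.dualSet t, P.expect t p Z

/-- Optimal value of the stage `t` problem for the realization `j`, with the cost-to-go `V`. -/
noncomputable def stageValue (t : ℕ) (j : Fin (P.M t)) (V : Hist P.n → EReal) (h : Hist P.n) :
    EReal :=
  ⨅ x ∈ P.feasible t j h, (P.cost t j h x : EReal) + V (Function.update h t x)

/-- The recourse functions: `𝒬_{T+1} = 0` and `𝒬_t = ρ_t(𝔔_t(·, ξ_t))` for `t ≤ T`, where
`𝔔_t(·, ξ_{t,j})` is `stageValue t j 𝒬_{t+1}`. (Used for `t ≥ 2`.) -/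
noncomputable def recourse (t : ℕ) : Hist P.n → EReal :=
  if _ht : t ≤ P.T then
    fun h => P.risk t fun j => P.stageValue t j (recourse (t + 1)) h
  else fun _ => 0
termination_by P.T + 1 - t

/-- The optimal value `𝒬_1(x_0) = 𝔔_1(x_0, ξ_1)`. -/
noncomputable def optimalValue : EReal :=
  P.stageValue 1 P.idx₁ (P.recourse 2) P.start

/-- The first stage objective `F_1(x_1) = ⟨Ψ_1, x_1⟩ + 𝒬_2(x_1)`. -/
noncomputable def firstObjective (x : Fin P.n → ℝ) : EReal :=
  (P.cost 1 P.idx₁ P.start x : EReal) + P.recourse 2 (Function.update P.start 1 x)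

/-- `x` is an optimal solution of the first stage problem. -/
def IsFirstStageSolution (x : Fin P.n → ℝ) : Prop :=
  x ∈ P.feasible 1 P.idx₁ P.start ∧
    ∀ y ∈ P.feasible 1 P.idx₁ P.start, P.firstObjective x ≤ P.firstObjective y

/-- Assumption on the feasible sets: for every stage `t`, every scenario, and every sequence of
decisions that is feasible on that scenario up to stage `t - 1`, the feasible set of stage `t` is
bounded and nonempty. -/
def FeasibleSetsBoundedNonempty : Prop :=
  ∀ t, 1 ≤ t → t ≤ P.T → ∀ (σ : P.Scenario) (h : Hist P.n), h 0 = P.x₀ →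
    (∀ τ, 1 ≤ τ → τ < t → h τ ∈ P.feasible τ (σ τ) h) →
    Bornology.IsBounded (P.feasible t (σ t) h) ∧ (P.feasible t (σ t) h).Nonempty

/-! ### The subproblems of the algorithm

`L` is the list of optimality cuts and `K` the list of feasibility cuts, both for `x_{1:t}`. -/

/-- Feasible set of the stage `t` subproblem. -/
def subFeasible (t : ℕ) (j : Fin (P.M t)) (h : Hist P.n) (K : List (FeasCut P.n)) :
    Set (Fin P.n → ℝ) :=
  {x | x ∈ P.feasible t j h ∧ ∀ c ∈ K, c.excess (t + 1) (Function.update h t x) ≤ 0}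

/-- Objective of the stage `t` subproblem (the auxiliary variable `z`, bounded below by the cuts,
being minimized out). It is `-∞` as long as all cuts are `-∞`; then every feasible point is a
solution. -/
noncomputable def subObjective (t : ℕ) (j : Fin (P.M t)) (h : Hist P.n) (L : List (OptCut P.n))
    (x : Fin P.n → ℝ) : EReal :=
  (P.cost t j h x : EReal) + lowerApprox (t + 1) L (Function.update h t x)

/-- Optimal value of the stage `t` subproblem. -/
noncomputable def subValue (t : ℕ) (j : Fin (P.M t)) (h : Hist P.n) (L : List (OptCut P.n))
    (K : List (FeasCut P.n)) : EReal :=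
  ⨅ x ∈ P.subFeasible t j h K, P.subObjective t j h L x

/-- `x` is an optimal solution of the stage `t` subproblem. -/
def IsSubSolution (t : ℕ) (j : Fin (P.M t)) (h : Hist P.n) (L : List (OptCut P.n))
    (K : List (FeasCut P.n)) (x : Fin P.n → ℝ) : Prop :=
  x ∈ P.subFeasible t j h K ∧
    ∀ y ∈ P.subFeasible t j h K, P.subObjective t j h L x ≤ P.subObjective t j h L y

/-- Lagrangian of the stage `t` subproblem in the variables `(x, z)`, `x ≥ 0`:
minimize `⟨Ψ, (x_{1:t-1}, x)⟩ + z` subject to the equality constraints, `z ≥` the optimality cuts,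
and the feasibility cuts. A cut equal to `-∞` contributes `0` if its multiplier is `0`, and `-∞`
otherwise. -/
noncomputable def lagrangian (t : ℕ) (j : Fin (P.M t)) (h : Hist P.n) (L : List (OptCut P.n))
    (K : List (FeasCut P.n)) (π : Multipliers (P.rows t) L.length K.length)
    (x : Fin P.n → ℝ) (z : ℝ) : EReal :=
  ((P.cost t j h x + z + π.eq ⬝ᵥ P.residual t j h x
      + ∑ i, π.feas i * (K.get i).excess (t + 1) (Function.update h t x) : ℝ) : EReal)
    + ∑ i, (π.opt i : EReal) * ((L.get i).eval (t + 1) (Function.update h t x) - (z : EReal))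

/-- `π` is a vector of optimal Lagrange multipliers: the multipliers of the inequalities are
nonnegative, and the Lagrangian is bounded below by the optimal value. -/
def IsMultiplier (t : ℕ) (j : Fin (P.M t)) (h : Hist P.n) (L : List (OptCut P.n))
    (K : List (FeasCut P.n)) (π : Multipliers (P.rows t) L.length K.length) : Prop :=
  (∀ i, 0 ≤ π.opt i) ∧ (∀ i, 0 ≤ π.feas i) ∧
    ∀ (x : Fin P.n → ℝ) (z : ℝ), (∀ i, 0 ≤ x i) →
      P.subValue t j h L K ≤ P.lagrangian t j h L K π x z

/-- The vector `π_{k,m} ∈ ℝ^{n(t-1)}`, by blocks `τ = 1..t-1`: the gradient of the Lagrangian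
with respect to `x_{1:t-1}`. -/
def slope (t : ℕ) (j : Fin (P.M t)) (L : List (OptCut P.n)) (K : List (FeasCut P.n))
    (π : Multipliers (P.rows t) L.length K.length) (τ : ℕ) : Fin P.n → ℝ :=
  (P.ξ t j).Ψ τ + ((P.ξ t j).A τ)ᵀ *ᵥ π.eq + ∑ i, π.opt i • (L.get i).β τ
    + ∑ i, π.feas i • (K.get i).β τ

/-- Optimal value of the phase I problem: minimize the sum of the entries of `y₁` and `y₂`
subject to `residual + y₁ - y₂ = 0`, the feasibility cuts, and `x, y₁, y₂ ≥ 0`. -/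
noncomputable def phaseValue (t : ℕ) (j : Fin (P.M t)) (h : Hist P.n) (K : List (FeasCut P.n)) :
    EReal :=
  ⨅ (x : Fin P.n → ℝ) (y₁ : Fin (P.rows t) → ℝ) (y₂ : Fin (P.rows t) → ℝ)
    (_ : (∀ i, 0 ≤ x i) ∧ (∀ i, 0 ≤ y₁ i) ∧ (∀ i, 0 ≤ y₂ i) ∧
      P.residual t j h x + y₁ - y₂ = 0 ∧
      ∀ c ∈ K, c.excess (t + 1) (Function.update h t x) ≤ 0),
    ((∑ i, (y₁ i + y₂ i) : ℝ) : EReal)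

/-- `π` is a vector of optimal Lagrange multipliers of the phase I problem. -/
def IsPhaseMultiplier (t : ℕ) (j : Fin (P.M t)) (h : Hist P.n) (K : List (FeasCut P.n))
    (π : PhaseMultipliers (P.rows t) K.length) : Prop :=
  (∀ i, 0 ≤ π.feas i) ∧
    ∀ (x : Fin P.n → ℝ) (y₁ y₂ : Fin (P.rows t) → ℝ),
      (∀ i, 0 ≤ x i) → (∀ i, 0 ≤ y₁ i) → (∀ i, 0 ≤ y₂ i) →
      P.phaseValue t j h K ≤
        ((∑ i, (y₁ i + y₂ i) + π.eq ⬝ᵥ (P.residual t j h x + y₁ - y₂)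
          + ∑ i, π.feas i * (K.get i).excess (t + 1) (Function.update h t x) : ℝ) : EReal)

/-- The feasibility cut for `x_{1:t-1}` built at `h`: `phaseValue + ⟨s, x_{1:t-1} - h⟩ ≤ 0`, where
`s` is the subgradient given by the multipliers. -/
noncomputable def feasCut (t : ℕ) (j : Fin (P.M t)) (h : Hist P.n) (K : List (FeasCut P.n))
    (π : PhaseMultipliers (P.rows t) K.length) : FeasCut P.n :=
  let s : ℕ → Fin P.n → ℝ :=
    fun τ => ((P.ξ t j).A τ)ᵀ *ᵥ π.eq + ∑ i, π.feas i • (K.get i).β τ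
  { β := s
    θ := -(P.phaseValue t j h K).toReal + ∑ τ ∈ Finset.Ico 1 t, s τ ⬝ᵥ h τ }

/-! ### The algorithm -/

/-- The rules by which the algorithm selects, among all admissible ones, an optimal solution,
optimal multipliers, maximizing weights, and a child node with a positive phase I value. They are
arbitrary, and may depend on the problem to be solved, on the node, and on the scenarios `past`
sampled so far, but not on scenarios that are sampled later, nor on the continuation of the current
scenario beyond the parent of the node at which a decision is computed. -/
structure Solver where
  primal : (past : List P.Scenario) → {t : ℕ} → (m : P.Node t) → (h : Hist P.n) →
    (L : List (OptCut P.n)) → (K : List (FeasCut P.n)) → Fin P.n → ℝ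
  primal_spec : ∀ past {t} (m : P.Node t) h L K,
    (∃ x, P.IsSubSolution t m.idx h L K x) →
      P.IsSubSolution t m.idx h L K (primal past m h L K)
  dual : (past : List P.Scenario) → {t : ℕ} → (m : P.Node t) → (h : Hist P.n) →
    (L : List (OptCut P.n)) → (K : List (FeasCut P.n)) →
    Multipliers (P.rows t) L.length K.length
  dual_spec : ∀ past {t} (m : P.Node t) h L K,
    (∃ π, P.IsMultiplier t m.idx h L K π) →
      P.IsMultiplier t m.idx h L K (dual past m h L K)
  weights : (past : List P.Scenario) → (t : ℕ) → (Z : Fin (P.M t) → EReal) → Fin (P.M t) → ℝ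
  weights_spec : ∀ past t Z, (∃ p ∈ P.dualSet t, P.expect t p Z = P.risk t Z) →
    weights past t Z ∈ P.dualSet t ∧ P.expect t (weights past t Z) Z = P.risk t Z
  branch : (past : List P.Scenario) → (t : ℕ) → (h : Hist P.n) → (K : List (FeasCut P.n)) →
    (bad : Set (Fin (P.M t))) → Fin (P.M t)
  branch_spec : ∀ past t h K (bad : Set (Fin (P.M t))), bad.Nonempty →
    branch past t h K bad ∈ bad
  phaseDual : (past : List P.Scenario) → {t : ℕ} → (m : P.Node t) → (h : Hist P.n) →
    (K : List (FeasCut P.n)) → PhaseMultipliers (P.rows t) K.length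
  phaseDual_spec : ∀ past {t} (m : P.Node t) h K,
    (∃ π, P.IsPhaseMultiplier t m.idx h K π) →
      P.IsPhaseMultiplier t m.idx h K (phaseDual past m h K)

/-- The cuts available: `opt t` and `feas t` are the optimality cuts of `𝒬_t` and the feasibility
cuts, both for `x_{1:t-1}`, in the order in which they were computed. -/
structure State where
  opt : ℕ → List (OptCut P.n)
  feas : ℕ → List (FeasCut P.n)

/-- Initialization: `𝒬_t^0 = -∞` for `t ≤ T`, `𝒬_{T+1}^0 = 0`, no feasibility cut. -/
noncomputable def init : P.State where
  opt t := if t ≤ P.T then [⟨⊥, 0, 0⟩] else [⟨0, 0, 0⟩]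
  feas _ := []

/-- Outcome of a forward pass: infeasibility is reported, or the pass reaches the end of the
horizon with the feasibility cuts `K` and the decisions `h t` at the nodes of the scenario. -/
inductive Outcome where
  | infeasible : Outcome
  | completed (K : ℕ → List (FeasCut P.n)) (h : Hist P.n) : Outcome

/-- The children of the node of stage `t - 1` with a positive phase I value. -/
def badChildren (t : ℕ) (h : Hist P.n) (K : List (FeasCut P.n)) : Set (Fin (P.M t)) :=
  {j | 0 < P.phaseValue t j h K}

variable {P}

/-- `Forward Sv past σ opt K t h r`: the forward pass on the scenario `σ`, with the optimality cuts
`opt` and the current feasibility cuts `K`, standing before stage `t` with the decisions `h` taken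
at the stages `< t`, has the outcome `r`. -/
inductive Forward (Sv : P.Solver) (past : List P.Scenario) (σ : P.Scenario)
    (opt : ℕ → List (OptCut P.n)) :
    (ℕ → List (FeasCut P.n)) → ℕ → Hist P.n → P.Outcome → Prop
  /-- All stages have been treated. -/
  | done {K t h} : P.T < t → Forward Sv past σ opt K t h (.completed K h)
  /-- The phase I value is positive at the first stage: the problem is reported infeasible. -/
  | report {K h} : (P.badChildren 1 h (K 2)).Nonempty → Forward Sv past σ opt K 1 h .infeasible
  /-- A phase I value is positive at stage `t + 1 ≥ 2`: add a feasibility cut, go back to `t`. -/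
  | back {K t h r} (j : Fin (P.M (t + 1)))
      (π : PhaseMultipliers (P.rows (t + 1)) (K (t + 2)).length) :
      1 ≤ t → t + 1 ≤ P.T →
      (P.badChildren (t + 1) h (K (t + 2))).Nonempty →
      j = Sv.branch past (t + 1) h (K (t + 2)) (P.badChildren (t + 1) h (K (t + 2))) →
      π = Sv.phaseDual past (σ.child (t + 1) j) h (K (t + 2)) →
      P.IsPhaseMultiplier (t + 1) j h (K (t + 2)) π →
      Forward Sv past σ opt
        (Function.update K (t + 1) (K (t + 1) ++ [P.feasCut (t + 1) j h (K (t + 2)) π]))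
        t (trunc t h) r →
      Forward Sv past σ opt K (t + 1) h r
  /-- All phase I values are zero: solve the subproblem at the node of the scenario. -/
  | advance {K t h r} (x : Fin P.n → ℝ) :
      1 ≤ t → t ≤ P.T →
      P.badChildren t h (K (t + 1)) = ∅ →
      x = Sv.primal past (σ.node t) h (opt (t + 1)) (K (t + 1)) →
      P.IsSubSolution t (σ t) h (opt (t + 1)) (K (t + 1)) x →
      Forward Sv past σ opt K (t + 1) (Function.update h t x) r →
      Forward Sv past σ opt K t h r

/-- The optimality cut `(θ_t^k, β_t^k)` of stage `t`, computed at the history `h = x_{[n]}^k`,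
`n = n_{t-1}^k`, from the optimality cuts `L` and feasibility cuts `K` of stage `t + 1`. -/
noncomputable def newCut (Sv : P.Solver) (past : List P.Scenario) (σ : P.Scenario) (t : ℕ)
    (h : Hist P.n) (L : List (OptCut P.n)) (K : List (FeasCut P.n)) : OptCut P.n :=
  let Z : Fin (P.M t) → EReal := fun j => P.subValue t j h L K
  let p : Fin (P.M t) → ℝ := Sv.weights past t Z
  { θ := P.risk t Z
    β := fun τ => ∑ j, (p j * P.Φ t j) • P.slope t j L K (Sv.dual past (σ.child t j) h L K) τ
    base := h }

/-- A complete iteration, on the scenario `σ` sampled after the scenarios `past`, leading from the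
cuts `S` to the cuts `S'` and computing the decision `x t m` at the node `m` of stage `t`, for all
nodes `m` whose parent lies on `σ`. (The values of `x` at other nodes are irrelevant.) -/
structure IsIteration (Sv : P.Solver) (past : List P.Scenario) (σ : P.Scenario)
    (S : P.State) (x : (t : ℕ) → P.Node t → Fin P.n → ℝ) (S' : P.State) : Prop where
  root : ∀ m, x 0 m = P.x₀
  /-- the forward pass, and the decisions at the nodes of the scenario -/
  forward : ∃ h, Forward Sv past σ S.opt S.feas 1 P.start (.completed S'.feas h) ∧
    ∀ t, 1 ≤ t → t ≤ P.T → x t (σ.node t) = h t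
  /-- the decisions at the other children of the nodes of the scenario -/
  children : ∀ t, 2 ≤ t → t ≤ P.T → ∀ j, j ≠ σ t →
    let h : Hist P.n := trunc t fun τ => x τ (σ.node τ)
    x t (σ.child t j) = Sv.primal past (σ.child t j) h (S.opt (t + 1)) (S'.feas (t + 1)) ∧
      P.IsSubSolution t j h (S.opt (t + 1)) (S'.feas (t + 1)) (x t (σ.child t j))
  /-- the multipliers and weights used in the new optimality cuts are optimal -/
  multipliers : ∀ t, 2 ≤ t → t ≤ P.T →
    let h : Hist P.n := trunc t fun τ => x τ (σ.node τ)
    let Z : Fin (P.M t) → EReal := fun j => P.subValue t j h (S.opt (t + 1)) (S'.feas (t + 1))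
    let p : Fin (P.M t) → ℝ := Sv.weights (past ++ [σ]) t Z
    (p ∈ P.dualSet t ∧ P.expect t p Z = P.risk t Z) ∧
      ∀ j, P.IsMultiplier t j h (S.opt (t + 1)) (S'.feas (t + 1))
        (Sv.dual (past ++ [σ]) (σ.child t j) h (S.opt (t + 1)) (S'.feas (t + 1)))
  /-- the new optimality cuts -/
  cuts : ∀ t, 2 ≤ t → t ≤ P.T → S'.opt t = S.opt t ++
    [newCut Sv (past ++ [σ]) σ t (trunc t fun τ => x τ (σ.node τ))
      (S.opt (t + 1)) (S'.feas (t + 1))]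
  /-- `θ_{T+1}^k = 0` and `β_{T+1}^k = 0` -/
  last : S'.opt (P.T + 1) = S.opt (P.T + 1) ++ [⟨0, 0, 0⟩]

/-- The scenarios of the iterations `1..k`. -/
def past (scen : ℕ → P.Scenario) (k : ℕ) : List P.Scenario :=
  (List.range k).map fun i => scen (i + 1)

/-- The first `N` iterations of the algorithm, on the scenarios `scen 1, …, scen N`, are completed:
`S k` are the cuts at the end of iteration `k` (with `S 0` the initial ones), and `x k t m` is the
decision computed at iteration `k` at the node `m` of stage `t`. -/
def IsRunUpTo (Sv : P.Solver) (scen : ℕ → P.Scenario) (S : ℕ → P.State)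
    (x : ℕ → (t : ℕ) → P.Node t → Fin P.n → ℝ) (N : ℕ) : Prop :=
  S 0 = P.init ∧
    ∀ k < N, IsIteration Sv (past scen k) (scen (k + 1)) (S k) (x (k + 1)) (S (k + 1))

/-- The algorithm performs infinitely many complete iterations. The cuts and the decisions at the
nodes whose parent is sampled are determined by `Sv` and `scen`. -/
def IsRun (Sv : P.Solver) (scen : ℕ → P.Scenario) (S : ℕ → P.State)
    (x : ℕ → (t : ℕ) → P.Node t → Fin P.n → ℝ) : Prop :=
  ∀ N, IsRunUpTo Sv scen S x N

/-- The algorithm terminates, after finitely many iterations, reporting that the problem is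
infeasible. -/
def ReportsInfeasible (Sv : P.Solver) (scen : ℕ → P.Scenario) : Prop :=
  ∃ N S x, IsRunUpTo Sv scen S x N ∧
    Forward Sv (past scen N) (scen (N + 1)) (S N).opt (S N).feas 1 P.start .infeasible

/-- The history `x_{[n]}` of the decisions at a node of stage `t` (together with `x_0`). -/
def history (x : (t : ℕ) → P.Node t → Fin P.n → ℝ) {t : ℕ} (m : P.Node t) : Hist P.n :=
  fun τ => if hτ : τ ≤ t then x τ (m.ancestor τ hτ) else 0

/-- Assumption on the sampling: at every iteration `k ≥ 1` and stage `t = 2..T`, the index of the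
sampled realization of `ξ_t` has the law `Φ t`, and is independent of the realizations sampled at
the previous iterations and at the previous stages of iteration `k`. -/
structure IsSampling {Ω : Type*} [MeasurableSpace Ω] (μ : Measure Ω)
    (scen : ℕ → Ω → P.Scenario) : Prop where
  measurable : ∀ k t, 1 ≤ k → 2 ≤ t → t ≤ P.T → Measurable fun ω => scen k ω t
  law : ∀ k t, 1 ≤ k → 2 ≤ t → t ≤ P.T → ∀ j,
    μ {ω | scen k ω t = j} = ENNReal.ofReal (P.Φ t j)
  indep : ∀ k t, 1 ≤ k → 2 ≤ t → t ≤ P.T →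
    Indep (MeasurableSpace.comap (fun ω => scen k ω t) ⊤)
      (⨆ (l : ℕ) (s : ℕ) (_ : 1 ≤ l ∧ 2 ≤ s ∧ s ≤ P.T ∧ (l < k ∨ l = k ∧ s < t)),
        MeasurableSpace.comap (fun ω => scen l ω s) ⊤) μ

end Problem

end MSLP

namespace MSLP

/-! ### Farkas' lemma -/

/-! By (H2'), decisions that are feasible up to some stage can always be continued. Hence phase I
values are never positive, no feasibility cut is created, infeasibility is never reported, and the
second alternative is the one proved. Boundedness of the feasible sets also makes the histories that
are feasible on a scenario a compact polytope (`isCompact_feasibleHist`). On it the recourse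
functions are finite, lower semicontinuous and bounded above (`recourse_regular`). Linear
programming duality, derived from Farkas' lemma, yields the multipliers (`exists_isMultiplier`), and
these make every cut a minorant of its recourse function (`newCut_le_recourse`).

Fix a node and let `y_k` be its history of decisions at iteration `k + 1`, which makes sense even if
the node is not visited. The gap is `𝒬(y_k) - 𝒬^k(y_k) ≥ 0`, with the model available when that
iteration starts. Two facts control it.

(a) The models are continuous, convex, increasing in `k` and bounded above. On a polytope their
limit is continuous, so by Dini's theorem the convergence is uniform and `𝒬^{k+1}(y_k) - 𝒬^k(y_k)`
tends to `0`, wherever the points `y_k` lie (`tendsto_increment_of_convex`).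

(b) If iteration `k + 1` visits the node, its new cut is based at `y_k`, and `𝒬(y_k) - 𝒬^{k+1}(y_k)`
is at most the sum of the gaps at the children (`sampled_error_le`).

At stage `T` the gaps vanish. In a backward induction the gaps at the children tend to `0`, so by
(a) and (b) the gap at a node is small at all late iterations that visit it. The other iterations
are handled by sampling: whether the gap exceeds `ε` at iteration `k + 1` is determined by
iterations `1..k`, whereas visiting the node has a fixed positive probability independent of them.
By Lévy's conditional Borel–Cantelli lemma (`ae_frequently_passes`), a gap that exceeds `ε`
infinitely often does so, almost surely, at infinitely many visiting iterations, a contradiction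
(`tendsto_gap`). There are countably many nodes and values `ε = 1 / (i + 1)`, so one null set
suffices.

At the first stage, the value of the subproblem is the true objective at its solution minus the gap,
and it is at most the optimal value. Letting the gap tend to `0` gives (ii), with lower
semicontinuity for the accumulation points. -/

theorem farkas_fin {V : Type*} [AddCommGroup V] [Module ℝ V] (m : ℕ) :
    ∀ (a : Fin m → V →ₗ[ℝ] ℝ) (b : V →ₗ[ℝ] ℝ), (∀ x, (∀ i, 0 ≤ a i x) → 0 ≤ b x) →
      ∃ c : Fin m → ℝ, (∀ i, 0 ≤ c i) ∧ b = ∑ i, c i • a i := by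
  induction m with
  | zero =>
    intro a b h
    refine ⟨0, fun i => le_rfl, ?_⟩
    ext x
    have h1 := h x (fun i => i.elim0)
    have h2 := h (-x) (fun i => i.elim0)
    simp only [map_neg] at h2
    simp only [Finset.univ_eq_empty, Finset.sum_empty, LinearMap.zero_apply]
    linarith
  | succ m ih =>
    intro a b h
    by_cases h0 : ∀ x, (∀ i : Fin m, 0 ≤ a i.succ x) → 0 ≤ b x
    · obtain ⟨c, hc, hb⟩ := ih (fun i => a i.succ) b h0
      refine ⟨Fin.cons 0 c, fun i => ?_, ?_⟩
      · refine Fin.cases ?_ (fun i => ?_) i <;> simp [hc]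
      · rw [Fin.sum_univ_succ]
        simpa using hb
    · push Not at h0
      obtain ⟨y, hy, hby⟩ := h0
      have hay : a 0 y < 0 := by
        by_contra hn
        push Not at hn
        have := h y (fun i => Fin.cases hn hy i)
        linarith
      set s := (a 0 y)⁻¹ with hs
      have hs0 : s < 0 := inv_lt_zero.2 hay
      have hsy : s * a 0 y = 1 := inv_mul_cancel₀ hay.ne
      -- The induction hypothesis is applied to the functionals composed with the projection along
      -- `y` onto the kernel of `a 0`, where the inequality for `a 0` is automatic. The resulting
      -- coefficient of `a 0` is nonnegative because `s < 0`, `b y < 0` and `a i.succ y ≥ 0`.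
      obtain ⟨c, hc, hb⟩ := ih (fun i => a i.succ - (s * a i.succ y) • a 0)
        (b - (s * b y) • a 0) (by
          intro x hx
          have := h (x - (s * a 0 x) • y) (by
            intro i
            refine Fin.cases ?_ (fun i => ?_) i
            · simp only [map_sub, map_smul, smul_eq_mul]
              have : s * a 0 x * a 0 y = a 0 x := by linear_combination a 0 x * hsy
              linarith
            · have := hx i
              simp only [LinearMap.sub_apply, LinearMap.smul_apply, smul_eq_mul, map_sub,
                map_smul] at this ⊢
              linarith)
          simp only [LinearMap.sub_apply, LinearMap.smul_apply, smul_eq_mul, map_sub,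
            map_smul] at this ⊢
          linarith)
      refine ⟨Fin.cons (s * b y - ∑ i, c i * (s * a i.succ y)) c, fun i => ?_, ?_⟩
      · refine Fin.cases ?_ (fun i => ?_) i
        · have h1 : 0 ≤ s * b y := by nlinarith
          have h2 : ∑ i, c i * (s * a i.succ y) ≤ 0 :=
            Finset.sum_nonpos fun i _ => by
              have := hy i
              have := hc i
              have : s * a i.succ y ≤ 0 := by nlinarith
              nlinarith
          simp only [Fin.cons_zero]
          linarith
        · simpa using hc i
      · rw [Fin.sum_univ_succ]
        ext x
        have hbx := congrArg (fun f => f x) hb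
        simp only [LinearMap.sub_apply, LinearMap.smul_apply, smul_eq_mul, LinearMap.sum_apply,
          LinearMap.add_apply, Fin.cons_zero, Fin.cons_succ, mul_sub, Finset.sum_sub_distrib]
          at hbx ⊢
        have : ∑ i, c i * (s * a i.succ y * a 0 x) = (∑ i, c i * (s * a i.succ y)) * a 0 x := by
          rw [Finset.sum_mul]
          exact Finset.sum_congr rfl fun i _ => by ring
        linarith

theorem farkas {V ι : Type*} [AddCommGroup V] [Module ℝ V] [Fintype ι]
    (a : ι → V →ₗ[ℝ] ℝ) (b : V →ₗ[ℝ] ℝ) (h : ∀ x, (∀ i, 0 ≤ a i x) → 0 ≤ b x) :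
    ∃ c : ι → ℝ, (∀ i, 0 ≤ c i) ∧ b = ∑ i, c i • a i := by
  let e := Fintype.equivFin ι
  obtain ⟨c, hc, hb⟩ := farkas_fin _ (fun i => a (e.symm i)) b
    (fun x hx => h x fun i => by simpa using hx (e i))
  refine ⟨fun i => c (e i), fun i => hc _, ?_⟩
  rw [hb]
  exact Fintype.sum_equiv e.symm _ _ (fun i => by simp)

/-- Farkas' lemma for affine inequalities. -/
theorem affine_farkas {V ι : Type*} [AddCommGroup V] [Module ℝ V] [Fintype ι]
    (a : ι → V →ₗ[ℝ] ℝ) (α : ι → ℝ) (b : V →ₗ[ℝ] ℝ) (β : ℝ)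
    (hne : ∃ y, ∀ i, 0 ≤ a i y + α i)
    (h : ∀ y, (∀ i, 0 ≤ a i y + α i) → 0 ≤ b y + β) :
    ∃ c : ι → ℝ, (∀ i, 0 ≤ c i) ∧ ∀ y, ∑ i, c i * (a i y + α i) ≤ b y + β := by
  obtain ⟨y₀, hy₀⟩ := hne
  let a' : Option ι → V × ℝ →ₗ[ℝ] ℝ := fun o => o.elim (LinearMap.snd ℝ V ℝ)
    fun i => a i ∘ₗ LinearMap.fst ℝ V ℝ + α i • LinearMap.snd ℝ V ℝ
  let b' : V × ℝ →ₗ[ℝ] ℝ := b ∘ₗ LinearMap.fst ℝ V ℝ + β • LinearMap.snd ℝ V ℝ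
  -- Homogenization with the extra constraint `s ≥ 0`. A point with `s > 0` rescales to a solution
  -- of the affine system. A point with `s = 0` is a recession direction, and a negative `b y` would
  -- be contradicted by moving far enough from the solution `y₀`.
  obtain ⟨c, hc, hb⟩ := farkas a' b' (by
    rintro ⟨y, s⟩ hx
    have hs : 0 ≤ s := hx none
    have hi : ∀ i, 0 ≤ a i y + α i * s := fun i => hx (some i)
    change 0 ≤ b y + β * s
    rcases hs.eq_or_lt with rfl | hs
    · have key : ∀ r : ℝ, 0 ≤ r → 0 ≤ (b y₀ + β) + r * b y := by
        intro r hr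
        have := h (y₀ + r • y) (fun i => by
          have h1 := hi i
          have h2 := hy₀ i
          simp only [map_add, map_smul, smul_eq_mul]
          nlinarith)
        simp only [map_add, map_smul, smul_eq_mul] at this
        linarith
      by_contra hn
      push Not at hn
      have hby : b y < 0 := by linarith
      have h1 := key 0 le_rfl
      -- The step length at which the affine function would take the value `-1`.
      have h2 := key ((b y₀ + β + 1) / (-b y)) (div_nonneg (by linarith) (by linarith))
      have h3 : (b y₀ + β + 1) / (-b y) * b y = -(b y₀ + β + 1) := by
        rw [div_neg, neg_mul, div_mul_cancel₀ _ hby.ne]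
      linarith
    · have := h (s⁻¹ • y) (fun i => by
        have h1 := mul_nonneg (inv_nonneg.2 hs.le) (hi i)
        simp only [map_smul, smul_eq_mul]
        have : s⁻¹ * (a i y + α i * s) = s⁻¹ * a i y + α i := by field_simp
        linarith)
      simp only [map_smul, smul_eq_mul] at this
      have h2 := mul_nonneg hs.le this
      have : s * (s⁻¹ * b y + β) = b y + β * s := by field_simp
      linarith)
  refine ⟨fun i => c (some i), fun i => hc _, fun y => ?_⟩
  have := congrArg (fun f => f (y, (1 : ℝ))) hb
  simp only [Fintype.sum_option, LinearMap.add_apply, LinearMap.sum_apply,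
    LinearMap.smul_apply] at this
  have h1 : b' (y, 1) = b y + β := by simp [b']
  have h2 : a' none (y, 1) = 1 := by simp [a']
  have h3 : ∀ i, a' (some i) (y, 1) = a i y + α i := fun i => by simp [a']
  simp only [h1, h2, h3, smul_eq_mul] at this
  have := hc none
  linarith

/-! ### Increasing sequences of convex functions -/

/-- A set that is, near each of its points, a cone with apex at this point. -/
def LocallyConical {E : Type*} [AddCommGroup E] [Module ℝ E] [TopologicalSpace E]
    (D : Set E) : Prop :=
  ∀ x ∈ D, ∀ s : ℝ, 0 < s → s < 1 → ∀ᶠ y in 𝓝[D] x, ∃ z ∈ D, y = (1 - s) • x + s • z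

/-- Points of `D` near `x` have the form `(1 - s) • x + s • z` with `z ∈ D`, and convexity bounds
`f` there by `(1 - s) * f x + s * C`, which is close to `f x` for small `s`. Convexity alone would
not suffice at boundary points of `D`. -/
theorem LocallyConical.upperSemicontinuousOn {E : Type*} [AddCommGroup E] [Module ℝ E]
    [TopologicalSpace E] {D : Set E} (hD : LocallyConical D) {f : E → ℝ} (hf : ConvexOn ℝ D f)
    {C : ℝ} (hC : ∀ x ∈ D, f x ≤ C) : UpperSemicontinuousOn f D := by
  intro x hx y hy
  obtain ⟨s, hs0, hs1, hs⟩ : ∃ s : ℝ, 0 < s ∧ s < 1 ∧ (1 - s) * f x + s * C < y := by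
    have : Tendsto (fun s : ℝ => (1 - s) * f x + s * C) (𝓝[>] 0) (𝓝 ((1 - 0) * f x + 0 * C)) :=
      (Continuous.tendsto (by fun_prop) 0).mono_left nhdsWithin_le_nhds
    have h1 : ∀ᶠ s : ℝ in 𝓝[>] 0, (1 - s) * f x + s * C < y :=
      this.eventually_lt_const (by simpa using hy)
    have h2 : ∀ᶠ s : ℝ in 𝓝[>] 0, s ∈ Set.Ioo (0 : ℝ) 1 := Ioo_mem_nhdsGT one_pos
    obtain ⟨s, hs, hs'⟩ := (h1.and h2).exists
    exact ⟨s, hs'.1, hs'.2, hs⟩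
  filter_upwards [hD x hx s hs0 hs1] with w hw
  obtain ⟨z, hz, rfl⟩ := hw
  have h1 := hf.2 hx hz (by linarith : 0 ≤ 1 - s) hs0.le (by ring)
  simp only [smul_eq_mul] at h1
  have h2 := mul_le_mul_of_nonneg_left (hC z hz) hs0.le
  linarith

/-- The increments of a bounded increasing sequence of continuous convex functions on a compact
locally conical set tend to zero uniformly. -/
theorem tendsto_increment_of_convex {E : Type*} [AddCommGroup E] [Module ℝ E]
    [TopologicalSpace E] {D : Set E} (hD : LocallyConical D) (hcomp : IsCompact D)
    {f : ℕ → E → ℝ} (hconv : ∀ k, ConvexOn ℝ D (f k)) (hcont : ∀ k, Continuous (f k))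
    (hmono : ∀ x ∈ D, Monotone fun k => f k x) {C : ℝ} (hC : ∀ k, ∀ x ∈ D, f k x ≤ C)
    {y : ℕ → E} (hy : ∀ k, y k ∈ D) :
    Tendsto (fun k => f (k + 1) (y k) - f k (y k)) atTop (𝓝 0) := by
  let g : E → ℝ := fun x => ⨆ k, f k x
  have hbdd : ∀ x ∈ D, BddAbove (Set.range fun k => f k x) := fun x hx =>
    ⟨C, by rintro _ ⟨k, rfl⟩; exact hC k x hx⟩
  have hlim : ∀ x ∈ D, Tendsto (fun k => f k x) atTop (𝓝 (g x)) := fun x hx =>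
    tendsto_atTop_ciSup (hmono x hx) (hbdd x hx)
  have hle : ∀ x ∈ D, ∀ k, f k x ≤ g x := fun x hx k => le_ciSup (hbdd x hx) k
  have hgC : ∀ x ∈ D, g x ≤ C := fun x hx => ciSup_le fun k => hC k x hx
  have hgconv : ConvexOn ℝ D g := by
    refine ⟨(hconv 0).1, fun x hx z hz a b ha hb hab => ciSup_le fun k => ?_⟩
    refine ((hconv k).2 hx hz ha hb hab).trans ?_
    simp only [smul_eq_mul]
    exact add_le_add (mul_le_mul_of_nonneg_left (hle x hx k) ha)
      (mul_le_mul_of_nonneg_left (hle z hz k) hb)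
  have hlsc : LowerSemicontinuousOn g D := by
    intro x hx r hr
    obtain ⟨k, hk⟩ := ((hlim x hx).eventually_const_lt hr).exists
    have : ∀ᶠ w in 𝓝[D] x, r < f k w :=
      ((hcont k).tendsto x |>.mono_left nhdsWithin_le_nhds).eventually_const_lt hk
    filter_upwards [this, self_mem_nhdsWithin] with w hw hwD
    exact hw.trans_le (hle w hwD k)
  have hgcont : ContinuousOn g D :=
    continuousOn_iff_lower_upperSemicontinuousOn.2
      ⟨hlsc, hD.upperSemicontinuousOn hgconv hgC⟩
  -- Dini's theorem. As `f k ≤ f (k + 1) ≤ g` on `D`, the increment at `y k` is at most the uniform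
  -- distance between `f k` and `g`.
  have huni := Monotone.tendstoUniformlyOn_of_forall_tendsto hcomp
    (fun k => (hcont k).continuousOn) hmono hgcont hlim
  rw [Metric.tendstoUniformlyOn_iff] at huni
  rw [Metric.tendsto_atTop]
  intro ε hε
  obtain ⟨N, hN⟩ := (huni ε hε).exists_forall_of_atTop
  refine ⟨N, fun k hk => ?_⟩
  have h1 := hN k hk (y k) (hy k)
  have h2 := hle (y k) (hy k) (k + 1)
  have h3 := hmono (y k) (hy k) (Nat.le_succ k)
  simp only [Nat.succ_eq_add_one] at h3
  rw [Real.dist_eq, abs_of_nonneg (by linarith [hle (y k) (hy k) k])] at h1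
  rw [Real.dist_eq, sub_zero, abs_of_nonneg (by linarith)]
  linarith

theorem coe_finset_sum {ι : Type*} (s : Finset ι) (f : ι → ℝ) :
    ((∑ i ∈ s, f i : ℝ) : EReal) = ∑ i ∈ s, (f i : EReal) := by
  classical
  induction s using Finset.induction_on with
  | empty => simp
  | insert a s ha ih => rw [Finset.sum_insert ha, Finset.sum_insert ha, EReal.coe_add, ih]

namespace Problem

variable {P : Problem}

/-! ### Feasible histories -/

theorem residual_congr {t : ℕ} {j : Fin (P.M t)} {h h' : Hist P.n} (hh : ∀ τ < t, h τ = h' τ)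
    (x : Fin P.n → ℝ) : P.residual t j h x = P.residual t j h' x := by
  unfold residual
  congr 2
  exact Finset.sum_congr rfl fun τ hτ => by rw [hh τ (Finset.mem_range.1 hτ)]

theorem feasible_congr {t : ℕ} {j : Fin (P.M t)} {h h' : Hist P.n} (hh : ∀ τ < t, h τ = h' τ) :
    P.feasible t j h = P.feasible t j h' := by
  ext x
  simp only [feasible, Set.mem_ofPred_eq, residual_congr hh]

theorem cost_congr {t : ℕ} {j : Fin (P.M t)} {h h' : Hist P.n} (hh : ∀ τ < t, h τ = h' τ)
    (x : Fin P.n → ℝ) : P.cost t j h x = P.cost t j h' x := by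
  unfold cost
  congr 1
  exact Finset.sum_congr rfl fun τ hτ => by rw [hh τ (Finset.mem_Ico.1 hτ).2]

theorem continuous_residual {X : Type*} [TopologicalSpace X] (t : ℕ) (j : Fin (P.M t))
    {f : X → Hist P.n} {g : X → Fin P.n → ℝ} (hf : Continuous f) (hg : Continuous g) :
    Continuous fun w => P.residual t j (f w) (g w) := by
  unfold residual
  refine Continuous.sub (Continuous.add (continuous_finsetSum _ fun τ _ => ?_) ?_)
    continuous_const
  · exact Continuous.matrix_mulVec continuous_const ((continuous_apply τ).comp hf)
  · exact Continuous.matrix_mulVec continuous_const hg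

theorem continuous_cost {X : Type*} [TopologicalSpace X] (t : ℕ) (j : Fin (P.M t))
    {f : X → Hist P.n} {g : X → Fin P.n → ℝ} (hf : Continuous f) (hg : Continuous g) :
    Continuous fun w => P.cost t j (f w) (g w) := by
  unfold cost
  refine Continuous.add (continuous_finsetSum _ fun τ _ => ?_) ?_
  · exact Continuous.dotProduct continuous_const ((continuous_apply τ).comp hf)
  · exact Continuous.dotProduct continuous_const hg

theorem isClosed_feasible (t : ℕ) (j : Fin (P.M t)) (h : Hist P.n) :
    IsClosed (P.feasible t j h) := by
  have h1 : Continuous fun x : Fin P.n → ℝ => P.residual t j h x :=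
    continuous_residual t j continuous_const continuous_id
  have h2 : IsClosed {x : Fin P.n → ℝ | ∀ i, 0 ≤ x i} := by
    rw [Set.ofPred_forall]
    exact isClosed_iInter fun i => isClosed_le continuous_const (continuous_apply i)
  have h3 : IsClosed {x : Fin P.n → ℝ | P.residual t j h x = 0} :=
    isClosed_eq h1 continuous_const
  exact h2.inter h3

/-- The histories `x_{0:t}` that are feasible on a scenario. -/
def feasibleHist (σ : P.Scenario) (t : ℕ) : Set (Hist P.n) :=
  {h | h 0 = P.x₀ ∧ (∀ τ, 1 ≤ τ → τ ≤ t → h τ ∈ P.feasible τ (σ τ) h) ∧ ∀ τ, t < τ → h τ = 0}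

theorem start_mem (σ : P.Scenario) : P.start ∈ feasibleHist σ 0 := by
  refine ⟨by simp [start], fun τ h1 h2 => by omega, fun τ hτ => ?_⟩
  rw [start, Function.update_of_ne hτ.ne']
  rfl

theorem feasibleHist_congr {σ σ' : P.Scenario} {t : ℕ} (h : ∀ s ≤ t, σ s = σ' s) :
    feasibleHist σ t = feasibleHist σ' t := by
  ext x
  unfold feasibleHist
  constructor
  · rintro ⟨h0, h1, h2⟩
    exact ⟨h0, fun τ a b => h τ b ▸ h1 τ a b, h2⟩
  · rintro ⟨h0, h1, h2⟩
    exact ⟨h0, fun τ a b => (h τ b).symm ▸ h1 τ a b, h2⟩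

theorem update_mem {σ : P.Scenario} {t : ℕ} {h : Hist P.n} (hh : h ∈ feasibleHist σ t)
    {x : Fin P.n → ℝ} (hx : x ∈ P.feasible (t + 1) (σ (t + 1)) h) :
    Function.update h (t + 1) x ∈ feasibleHist σ (t + 1) := by
  obtain ⟨h0, h1, h2⟩ := hh
  refine ⟨by rw [Function.update_of_ne (by omega), h0], fun τ a b => ?_, fun τ a => ?_⟩
  · have hc : P.feasible τ (σ τ) (Function.update h (t + 1) x) = P.feasible τ (σ τ) h :=
      feasible_congr fun s hs => Function.update_of_ne (by omega) _ _
    rw [hc]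
    rcases b.eq_or_lt with rfl | hb
    · rwa [Function.update_self]
    · rw [Function.update_of_ne (by omega)]
      exact h1 τ a (by omega)
  · rw [Function.update_of_ne (by omega)]
    exact h2 τ (by omega)

theorem update_mem' {σ : P.Scenario} {t : ℕ} {h : Hist P.n} (hh : h ∈ feasibleHist σ t)
    {j : Fin (P.M (t + 1))} {x : Fin P.n → ℝ} (hx : x ∈ P.feasible (t + 1) j h) :
    Function.update h (t + 1) x ∈ feasibleHist (Function.update σ (t + 1) j) (t + 1) := by
  refine update_mem ?_ (by rwa [Function.update_self])
  rwa [← feasibleHist_congr (σ := σ)]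
  intro s hs
  rw [Function.update_of_ne (by omega)]

theorem trunc_mem {σ : P.Scenario} {t : ℕ} {h : Hist P.n} (hh : h ∈ feasibleHist σ (t + 1)) :
    trunc (t + 1) h ∈ feasibleHist σ t := by
  obtain ⟨h0, h1, -⟩ := hh
  refine ⟨by simp [trunc, h0], fun τ a b => ?_, fun τ a => by simp [trunc]; omega⟩
  have hc : P.feasible τ (σ τ) (trunc (t + 1) h) = P.feasible τ (σ τ) h :=
    feasible_congr fun s hs => by simp [trunc]; omega
  rw [hc]
  have : trunc (t + 1) h τ = h τ := by simp [trunc]; omega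
  rw [this]
  exact h1 τ a (by omega)

theorem update_trunc {σ : P.Scenario} {t : ℕ} {h : Hist P.n} (hh : h ∈ feasibleHist σ (t + 1)) :
    Function.update (trunc (t + 1) h) (t + 1) (h (t + 1)) = h := by
  funext τ
  rcases lt_trichotomy τ (t + 1) with hτ | rfl | hτ
  · rw [Function.update_of_ne hτ.ne]; simp [trunc, hτ]
  · rw [Function.update_self]
  · rw [Function.update_of_ne hτ.ne', hh.2.2 τ hτ]; simp [trunc]; omega

theorem last_mem {σ : P.Scenario} {t : ℕ} {h : Hist P.n} (hh : h ∈ feasibleHist σ (t + 1)) :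
    h (t + 1) ∈ P.feasible (t + 1) (σ (t + 1)) (trunc (t + 1) h) := by
  rw [feasible_congr (h' := h) fun s hs => by simp [trunc, hs]]
  exact hh.2.1 (t + 1) (by omega) le_rfl

theorem FeasibleSetsBoundedNonempty.feasible (hP : P.FeasibleSetsBoundedNonempty)
    {σ : P.Scenario} {t : ℕ} (ht : t + 1 ≤ P.T) {h : Hist P.n} (hh : h ∈ feasibleHist σ t)
    (j : Fin (P.M (t + 1))) :
    IsCompact (P.feasible (t + 1) j h) ∧ (P.feasible (t + 1) j h).Nonempty := by
  have := hP (t + 1) (by omega) ht (Function.update σ (t + 1) j) h hh.1 (fun τ a b => by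
    rw [Function.update_of_ne (by omega)]
    exact hh.2.1 τ a (by omega))
  rw [Function.update_self] at this
  exact ⟨Metric.isCompact_of_isClosed_isBounded (isClosed_feasible _ _ _) this.1, this.2⟩

theorem isClosed_feasibleHist (σ : P.Scenario) (t : ℕ) : IsClosed (feasibleHist σ t) := by
  have h1 : IsClosed {h : Hist P.n | h 0 = P.x₀} :=
    isClosed_eq (continuous_apply 0) continuous_const
  have h2 : IsClosed {h : Hist P.n | ∀ τ, 1 ≤ τ → τ ≤ t → h τ ∈ P.feasible τ (σ τ) h} := by
    simp only [Set.ofPred_forall]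
    refine isClosed_iInter fun τ => isClosed_iInter fun _ => isClosed_iInter fun _ => ?_
    have hres : Continuous fun h : Hist P.n => P.residual τ (σ τ) h (h τ) :=
      continuous_residual τ (σ τ) continuous_id (continuous_apply τ)
    have h4 : IsClosed {h : Hist P.n | ∀ i, 0 ≤ h τ i} := by
      rw [Set.ofPred_forall]
      exact isClosed_iInter fun i => isClosed_le continuous_const (continuous_apply_apply τ i)
    have h5 : IsClosed {h : Hist P.n | P.residual τ (σ τ) h (h τ) = 0} :=
      isClosed_eq hres continuous_const
    exact h4.inter h5
  have h3 : IsClosed {h : Hist P.n | ∀ τ, t < τ → h τ = 0} := by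
    simp only [Set.ofPred_forall]
    exact isClosed_iInter fun τ => isClosed_iInter fun _ =>
      isClosed_eq (continuous_apply τ) continuous_const
  exact h1.inter (h2.inter h3)

/-- A nonzero `d ≥ 0` with `A d = 0` would be a recession direction of a bounded nonempty set. So
`‖A x‖` is positive on the compact set of nonnegative unit vectors, and `c` is its minimum there.
This constant depends only on the matrix, so one history `h₀` yields a bound that is valid for all
histories. -/
theorem exists_bound_of_feasible_isBounded {t : ℕ} {j : Fin (P.M t)} {h₀ : Hist P.n}
    (hb : Bornology.IsBounded (P.feasible t j h₀)) (hne : (P.feasible t j h₀).Nonempty) :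
    ∃ c : ℝ, 0 < c ∧ ∀ x : Fin P.n → ℝ, 0 ≤ x → c * ‖x‖ ≤ ‖(P.ξ t j).A t *ᵥ x‖ := by
  obtain ⟨x₀, hx₀, hr₀⟩ := hne
  set A := (P.ξ t j).A t
  have hker : ∀ d : Fin P.n → ℝ, 0 ≤ d → A *ᵥ d = 0 → d = 0 := by
    intro d hd hAd
    obtain ⟨R, hR⟩ := hb.exists_norm_le
    have key : ∀ r : ℝ, 0 ≤ r → ‖x₀ + r • d‖ ≤ R := by
      intro r hr
      refine hR _ ⟨fun i => add_nonneg (hx₀ i) (mul_nonneg hr (hd i)), ?_⟩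
      rw [← hr₀]
      simp only [residual, Matrix.mulVec_add, Matrix.mulVec_smul]
      rw [show (P.ξ t j).A t *ᵥ d = 0 from hAd]
      simp
    by_contra hne
    have hpos : 0 < ‖d‖ := norm_pos_iff.2 hne
    have h0 := key 0 le_rfl
    have hR0 : 0 ≤ R := (norm_nonneg _).trans h0
    have h1 := key ((2 * R + 1) / ‖d‖) (by positivity)
    have h2 : ‖((2 * R + 1) / ‖d‖) • d‖ = 2 * R + 1 := by
      rw [norm_smul, Real.norm_of_nonneg (by positivity), div_mul_cancel₀ _ hpos.ne']
    have h3 : ‖((2 * R + 1) / ‖d‖) • d‖ ≤ ‖x₀ + ((2 * R + 1) / ‖d‖) • d‖ + ‖x₀‖ := by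
      have := norm_sub_le (x₀ + ((2 * R + 1) / ‖d‖) • d) x₀
      simpa using this
    simp only [zero_smul, add_zero] at h0
    linarith
  let S : Set (Fin P.n → ℝ) := Metric.sphere 0 1 ∩ {x | 0 ≤ x}
  have hS : IsCompact S := (isCompact_sphere 0 1).inter_right (isClosed_le continuous_const
    continuous_id)
  have hcont : Continuous fun x : Fin P.n → ℝ => ‖A *ᵥ x‖ :=
    (Continuous.matrix_mulVec continuous_const continuous_id).norm
  rcases S.eq_empty_or_nonempty with hSe | hSne
  · refine ⟨1, one_pos, fun x hx => ?_⟩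
    by_cases hx0 : x = 0
    · simp [hx0]
    · exfalso
      have : (‖x‖⁻¹ • x) ∈ S := by
        refine ⟨?_, ?_⟩
        · rw [mem_sphere_zero_iff_norm, norm_smul, norm_inv, norm_norm,
            inv_mul_cancel₀ (norm_ne_zero_iff.2 hx0)]
        · exact smul_nonneg (by positivity) hx
      simp [hSe] at this
  · obtain ⟨d, hd, hmin⟩ := hS.exists_isMinOn hSne hcont.continuousOn
    refine ⟨‖A *ᵥ d‖, ?_, fun x hx => ?_⟩
    · rw [norm_pos_iff]
      intro h0
      have := hker d hd.2 h0
      have h1 := hd.1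
      simp [this] at h1
    · by_cases hx0 : x = 0
      · simp [hx0]
      · have hn : 0 < ‖x‖ := norm_pos_iff.2 hx0
        have : (‖x‖⁻¹ • x) ∈ S := by
          refine ⟨?_, ?_⟩
          · rw [mem_sphere_zero_iff_norm, norm_smul, norm_inv, norm_norm,
              inv_mul_cancel₀ (norm_ne_zero_iff.2 hx0)]
          · exact smul_nonneg (by positivity) hx
        have h1 : ‖A *ᵥ d‖ ≤ ‖A *ᵥ (‖x‖⁻¹ • x)‖ := hmin this
        rw [Matrix.mulVec_smul, norm_smul, norm_inv, norm_norm, inv_mul_eq_div,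
          le_div_iff₀ hn] at h1
        exact h1

/-- Boundedness of each feasible set does not by itself bound their union over all histories. The
uniform constant of `exists_bound_of_feasible_isBounded` does: the product `A_{t+1,t+1} x` is
prescribed by the earlier decisions, which range over a compact set by induction. -/
theorem isCompact_feasibleHist (hP : P.FeasibleSetsBoundedNonempty) (σ : P.Scenario) :
    ∀ t, t ≤ P.T → IsCompact (feasibleHist σ t) := by
  intro t
  induction t with
  | zero =>
    intro _
    refine (isCompact_singleton (x := P.start)).of_isClosed_subset (isClosed_feasibleHist σ 0) ?_
    intro h hh
    have : h = P.start := by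
      funext τ
      rcases Nat.eq_zero_or_pos τ with rfl | hτ
      · rw [hh.1]; simp [start]
      · rw [hh.2.2 τ hτ, start, Function.update_of_ne hτ.ne']; rfl
    exact this
  | succ t ih =>
    intro ht
    have hD := ih (by omega)
    rcases (feasibleHist σ t).eq_empty_or_nonempty with he | ⟨h₀, hh₀⟩
    · have : feasibleHist σ (t + 1) = ∅ := by
        rw [Set.eq_empty_iff_forall_notMem]
        intro h hh
        have := trunc_mem hh
        simp [he] at this
      rw [this]
      exact isCompact_empty
    · obtain ⟨hb, hne⟩ := hP.feasible ht hh₀ (σ (t + 1))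
      obtain ⟨c, hc, hbound⟩ := exists_bound_of_feasible_isBounded hb.isBounded hne
      have hcont : Continuous fun h : Hist P.n => P.residual (t + 1) (σ (t + 1)) h 0 :=
        continuous_residual (t + 1) (σ (t + 1)) continuous_id continuous_const
      obtain ⟨B, hB⟩ := (hD.image hcont).isBounded.exists_norm_le
      have hball : IsCompact (Metric.closedBall (0 : Fin P.n → ℝ) (B / c)) :=
        isCompact_closedBall 0 _
      have himg : IsCompact ((fun q : Hist P.n × (Fin P.n → ℝ) =>
          Function.update q.1 (t + 1) q.2) ''
            (feasibleHist σ t ×ˢ Metric.closedBall (0 : Fin P.n → ℝ) (B / c))) :=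
        (hD.prod hball).image (Continuous.update continuous_fst (t + 1) continuous_snd)
      refine himg.of_isClosed_subset (isClosed_feasibleHist σ (t + 1)) fun h hh => ?_
      refine ⟨(trunc (t + 1) h, h (t + 1)), ⟨trunc_mem hh, ?_⟩, update_trunc hh⟩
      rw [mem_closedBall_zero_iff, le_div_iff₀ hc]
      obtain ⟨hx, hr⟩ := last_mem hh
      have h1 := hbound (h (t + 1)) hx
      have h2 := hB _ ⟨_, trunc_mem hh, rfl⟩
      have h3 : (P.ξ (t + 1) (σ (t + 1))).A (t + 1) *ᵥ h (t + 1)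
          = - P.residual (t + 1) (σ (t + 1)) (trunc (t + 1) h) 0 := by
        simp only [residual] at hr ⊢
        rw [Matrix.mulVec_zero]
        have := eq_neg_of_add_eq_zero_left
          (show (P.ξ (t + 1) (σ (t + 1))).A (t + 1) *ᵥ h (t + 1) +
            (∑ τ ∈ Finset.range (t + 1), (P.ξ (t + 1) (σ (t + 1))).A τ *ᵥ trunc (t + 1) h τ
              - (P.ξ (t + 1) (σ (t + 1))).b) = 0 by rw [← hr]; abel)
        rw [this]
        abel
      rw [h3, norm_neg] at h1
      simp only at h2
      linarith

theorem residual_combination (t : ℕ) (j : Fin (P.M t)) (h h' : Hist P.n) (a b : ℝ)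
    (hab : a + b = 1) (τ : ℕ) :
    P.residual t j (a • h + b • h') ((a • h + b • h') τ)
      = a • P.residual t j h (h τ) + b • P.residual t j h' (h' τ) := by
  simp only [residual, Pi.add_apply, Pi.smul_apply, Matrix.mulVec_add, Matrix.mulVec_smul,
    Finset.sum_add_distrib, ← Finset.smul_sum, smul_add, smul_sub]
  have : (P.ξ t j).b = a • (P.ξ t j).b + b • (P.ξ t j).b := by rw [← add_smul, hab, one_smul]
  nth_rewrite 1 [this]
  abel

theorem convex_feasibleHist (σ : P.Scenario) (t : ℕ) : Convex ℝ (feasibleHist σ t) := by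
  intro h hh h' hh' a b ha hb hab
  refine ⟨?_, fun τ h1 h2 => ⟨fun i => ?_, ?_⟩, fun τ hτ => ?_⟩
  · rw [Pi.add_apply, Pi.smul_apply, Pi.smul_apply, hh.1, hh'.1, ← add_smul, hab, one_smul]
  · exact add_nonneg (mul_nonneg ha ((hh.2.1 τ h1 h2).1 i)) (mul_nonneg hb ((hh'.2.1 τ h1 h2).1 i))
  · rw [residual_combination _ _ _ _ _ _ hab, (hh.2.1 τ h1 h2).2, (hh'.2.1 τ h1 h2).2]
    simp
  · rw [Pi.add_apply, Pi.smul_apply, Pi.smul_apply, hh.2.2 τ hτ, hh'.2.2 τ hτ]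
    simp

/-- The point `z = (y - (1 - s) h) / s` satisfies the equality constraints because they are affine.
Its sign constraints hold where `h` vanishes because `y ≥ 0`, and elsewhere because `y ≥ (1 - s) h`
near `h`. Only the finitely many coordinates of stages `1..t` matter. -/
theorem locallyConical_feasibleHist (σ : P.Scenario) (t : ℕ) :
    LocallyConical (feasibleHist σ t) := by
  intro h hh s hs0 hs1
  have hev : ∀ᶠ y : Hist P.n in 𝓝 h, ∀ τ ∈ Finset.Icc 1 t, ∀ i, 0 < h τ i →
      (1 - s) * h τ i ≤ y τ i := by
    rw [Finset.eventually_all]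
    intro τ _
    rw [eventually_all]
    intro i
    by_cases hi : 0 < h τ i
    · have hc : Tendsto (fun y : Hist P.n => y τ i) (𝓝 h) (𝓝 (h τ i)) :=
        Continuous.tendsto (by fun_prop) h
      filter_upwards [hc.eventually_const_lt (show (1 - s) * h τ i < h τ i by nlinarith)]
        with y hy _
      exact hy.le
    · exact Eventually.of_forall fun y hi' => absurd hi' hi
  filter_upwards [nhdsWithin_le_nhds hev, self_mem_nhdsWithin] with y hy hyD
  have hab : (-(1 - s) / s) + 1 / s = 1 := by field_simp; ring
  refine ⟨(-(1 - s) / s) • h + (1 / s) • y, ⟨?_, fun τ h1 h2 => ⟨fun i => ?_, ?_⟩, fun τ hτ => ?_⟩,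
    ?_⟩
  · rw [Pi.add_apply, Pi.smul_apply, Pi.smul_apply, hh.1, hyD.1, ← add_smul, hab, one_smul]
  · simp only [Pi.add_apply, Pi.smul_apply, smul_eq_mul]
    have hy0 := (hyD.2.1 τ h1 h2).1 i
    have : (1 - s) * h τ i ≤ y τ i := by
      rcases ((hh.2.1 τ h1 h2).1 i).eq_or_lt with h0 | h0
      · rw [← h0]; simpa using hy0
      · exact hy τ (Finset.mem_Icc.2 ⟨h1, h2⟩) i h0
    have e : -(1 - s) / s * h τ i + 1 / s * y τ i = (y τ i - (1 - s) * h τ i) / s := by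
      field_simp; ring
    rw [e]
    exact div_nonneg (by linarith) hs0.le
  · rw [residual_combination _ _ _ _ _ _ hab, (hh.2.1 τ h1 h2).2, (hyD.2.1 τ h1 h2).2]
    simp
  · rw [Pi.add_apply, Pi.smul_apply, Pi.smul_apply, hh.2.2 τ hτ, hyD.2.2 τ hτ]
    simp
  · rw [smul_add, smul_smul, smul_smul, ← add_assoc, ← add_smul]
    have e1 : 1 - s + s * (-(1 - s) / s) = 0 := by field_simp; ring
    have e2 : s * (1 / s) = 1 := by field_simp
    rw [e1, e2]
    simp

/-! ### Stage problems with a finite cost-to-go -/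

theorem exists_stage_solution (hP : P.FeasibleSetsBoundedNonempty) {σ : P.Scenario} {t : ℕ}
    (ht : t + 1 ≤ P.T) (j : Fin (P.M (t + 1))) {q : Hist P.n → ℝ}
    (hlsc : LowerSemicontinuousOn q (feasibleHist (Function.update σ (t + 1) j) (t + 1)))
    {h : Hist P.n} (hh : h ∈ feasibleHist σ t) :
    ∃ x ∈ P.feasible (t + 1) j h, ∀ y ∈ P.feasible (t + 1) j h,
      P.cost (t + 1) j h x + q (Function.update h (t + 1) x)
        ≤ P.cost (t + 1) j h y + q (Function.update h (t + 1) y) := by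
  obtain ⟨hc, hne⟩ := hP.feasible ht hh j
  have hu : Continuous fun x : Fin P.n → ℝ => Function.update h (t + 1) x :=
    (continuous_const (y := h)).update (t + 1) continuous_id
  have h1 : LowerSemicontinuousOn (fun x => q (Function.update h (t + 1) x))
      (P.feasible (t + 1) j h) :=
    hlsc.comp hu.continuousOn (fun x hx => update_mem' hh hx)
  have h2 : Continuous fun x => P.cost (t + 1) j h x :=
    continuous_cost (t + 1) j continuous_const continuous_id
  obtain ⟨x, hx, hmin⟩ := LowerSemicontinuousOn.exists_isMinOn hne hc
    ((h2.lowerSemicontinuous.lowerSemicontinuousOn _).add h1)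
  exact ⟨x, hx, fun y hy => hmin hy⟩

theorem stageValue_eq {t : ℕ} {j : Fin (P.M t)} {V : Hist P.n → EReal}
    {q : Hist P.n → ℝ} {h : Hist P.n}
    (hV : ∀ x ∈ P.feasible t j h, V (Function.update h t x) = q (Function.update h t x))
    {x : Fin P.n → ℝ} (hx : x ∈ P.feasible t j h)
    (hmin : ∀ y ∈ P.feasible t j h, P.cost t j h x + q (Function.update h t x)
        ≤ P.cost t j h y + q (Function.update h t y)) :
    P.stageValue t j V h = ((P.cost t j h x + q (Function.update h t x) : ℝ) : EReal) := by
  refine le_antisymm ?_ ?_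
  · refine (iInf₂_le x hx).trans ?_
    rw [hV x hx, EReal.coe_add]
  · refine le_iInf₂ fun y hy => ?_
    rw [hV y hy, ← EReal.coe_add]
    exact EReal.coe_le_coe_iff.2 (hmin y hy)

/-! ### The risk measure -/

theorem expect_coe (t : ℕ) (p z : Fin (P.M t) → ℝ) :
    P.expect t p (fun j => (z j : EReal)) = ((∑ j, p j * P.Φ t j * z j : ℝ) : EReal) := by
  rw [coe_finset_sum]
  simp [expect]

theorem isCompact_dualSet {t : ℕ} (h2 : 2 ≤ t) (hT : t ≤ P.T) : IsCompact (P.dualSet t) := by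
  refine (isCompact_univ_pi (s := fun j => Set.Icc 0 (P.Φ t j)⁻¹)
    fun j => isCompact_Icc).of_isClosed_subset (P.dualSet_closed t h2 hT) fun p hp j _ => ?_
  obtain ⟨h0, h1⟩ := P.dualSet_subset t h2 hT hp
  refine ⟨h0 j, ?_⟩
  rw [← one_div, le_div_iff₀ (P.Φ_pos t h2 hT j), ← h1]
  exact Finset.single_le_sum (f := fun j => p j * P.Φ t j)
    (fun i _ => mul_nonneg (h0 i) (P.Φ_pos t h2 hT i).le) (Finset.mem_univ j)

theorem exists_maximizing_weights {t : ℕ} (h2 : 2 ≤ t) (hT : t ≤ P.T) (z : Fin (P.M t) → ℝ) :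
    ∃ p ∈ P.dualSet t, (∀ p' ∈ P.dualSet t,
      ∑ j, p' j * P.Φ t j * z j ≤ ∑ j, p j * P.Φ t j * z j) ∧
      P.risk t (fun j => (z j : EReal)) = ((∑ j, p j * P.Φ t j * z j : ℝ) : EReal) := by
  have hc : Continuous fun p : Fin (P.M t) → ℝ => ∑ j, p j * P.Φ t j * z j := by fun_prop
  obtain ⟨p, hp, hmax⟩ := (isCompact_dualSet h2 hT).exists_isMaxOn (P.dualSet_nonempty t h2 hT)
    hc.continuousOn
  refine ⟨p, hp, fun p' hp' => hmax hp', le_antisymm ?_ ?_⟩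
  · refine iSup₂_le fun p' hp' => ?_
    rw [expect_coe]
    exact EReal.coe_le_coe_iff.2 (hmax hp')
  · rw [← expect_coe]
    exact le_iSup₂ (f := fun p _ => P.expect t p fun j => (z j : EReal)) p hp

theorem weight_nonneg {t : ℕ} (h2 : 2 ≤ t) (hT : t ≤ P.T) {p : Fin (P.M t) → ℝ}
    (hp : p ∈ P.dualSet t) (j : Fin (P.M t)) : 0 ≤ p j * P.Φ t j :=
  mul_nonneg ((P.dualSet_subset t h2 hT hp).1 j) (P.Φ_pos t h2 hT j).le

/-- In `EReal` a zero weight times `⊥` is `0`; the weights sum to `1`, so at least one of them is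
positive and the sum is `⊥`. -/
theorem expect_bot {t : ℕ} (h2 : 2 ≤ t) (hT : t ≤ P.T) {p : Fin (P.M t) → ℝ}
    (hp : p ∈ P.dualSet t) : P.expect t p (fun _ => ⊥) = ⊥ := by
  have h1 := (P.dualSet_subset t h2 hT hp).2
  obtain ⟨j, -, hj⟩ : ∃ j ∈ Finset.univ, 0 < p j * P.Φ t j := by
    by_contra hn
    push Not at hn
    have := Finset.sum_nonpos hn
    linarith
  rw [expect, ← Finset.add_sum_erase _ _ (Finset.mem_univ j), EReal.coe_mul_bot_of_pos hj,
    EReal.bot_add]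

theorem risk_bot {t : ℕ} (h2 : 2 ≤ t) (hT : t ≤ P.T) : P.risk t (fun _ => ⊥) = ⊥ := by
  refine le_antisymm (iSup₂_le fun p hp => ?_) bot_le
  rw [expect_bot h2 hT hp]

/-! ### Regularity of the recourse functions -/

/-- A sublevel set of the partial minimum `g` is the image, under truncation, of a sublevel set of
the joint objective `F`. The latter is compact, so its image is closed. -/
theorem lowerSemicontinuousOn_stage (hP : P.FeasibleSetsBoundedNonempty) {σ : P.Scenario} {t : ℕ}
    (ht : t + 1 ≤ P.T) (j : Fin (P.M (t + 1))) {q : Hist P.n → ℝ}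
    (hlsc : LowerSemicontinuousOn q (feasibleHist (Function.update σ (t + 1) j) (t + 1)))
    {g : Hist P.n → ℝ}
    (hg : ∀ h ∈ feasibleHist σ t, ∃ x ∈ P.feasible (t + 1) j h,
      g h = P.cost (t + 1) j h x + q (Function.update h (t + 1) x))
    (hg' : ∀ h ∈ feasibleHist σ t, ∀ x ∈ P.feasible (t + 1) j h,
      g h ≤ P.cost (t + 1) j h x + q (Function.update h (t + 1) x)) :
    LowerSemicontinuousOn g (feasibleHist σ t) := by
  intro h hh y hy
  set σ' : P.Scenario := Function.update σ (t + 1) j with hσ'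
  have hσ : σ' (t + 1) = j := Function.update_self _ _ _
  let F : Hist P.n → ℝ := fun h' => P.cost (t + 1) j h' (h' (t + 1)) + q h'
  have hF : LowerSemicontinuousOn F (feasibleHist σ' (t + 1)) := by
    have h2 : Continuous fun h' : Hist P.n => P.cost (t + 1) j h' (h' (t + 1)) :=
      continuous_cost (t + 1) j continuous_id (continuous_apply _)
    exact (h2.lowerSemicontinuous.lowerSemicontinuousOn _).add hlsc
  have hK := (hF.isCompact_inter_preimage_Iic (isCompact_feasibleHist hP σ' _ ht) y)
  have htr : Continuous (trunc (n := P.n) (t + 1)) := by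
    refine continuous_pi fun τ => ?_
    by_cases hτ : τ < t + 1
    · simpa [trunc, hτ] using continuous_apply τ
    · simpa [trunc, hτ] using continuous_const
  have hcl := (hK.image htr).isClosed
  have hFu : ∀ w ∈ feasibleHist σ t, ∀ x, F (Function.update w (t + 1) x)
      = P.cost (t + 1) j w x + q (Function.update w (t + 1) x) := by
    intro w _ x
    simp only [F, Function.update_self]
    rw [cost_congr (h' := w)]
    intro τ hτ
    rw [Function.update_of_ne hτ.ne]
  have hnot : h ∉ trunc (t + 1) '' (feasibleHist σ' (t + 1) ∩ F ⁻¹' Set.Iic y) := by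
    rintro ⟨w, ⟨hw, hwy⟩, rfl⟩
    have hx := last_mem hw
    rw [hσ] at hx
    have h1 := hg' _ hh _ hx
    rw [← hFu _ hh, update_trunc hw] at h1
    exact absurd (h1.trans hwy) (not_le.2 hy)
  filter_upwards [nhdsWithin_le_nhds (hcl.isOpen_compl.mem_nhds hnot), self_mem_nhdsWithin]
    with w hw hwD
  by_contra hn
  push Not at hn
  obtain ⟨x, hx, hgx⟩ := hg w hwD
  refine hw ⟨Function.update w (t + 1) x, ⟨update_mem' hwD hx, ?_⟩, ?_⟩
  · change F _ ≤ y
    rw [hFu w hwD, ← hgx]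
    exact hn
  · funext τ
    by_cases hτ : τ < t + 1
    · simp [trunc, hτ, hτ.ne]
    · rw [hwD.2.2 τ (by omega)]
      simp [trunc, hτ]

/-- On feasible histories the recourse functions are finite, lower semicontinuous and bounded
above. -/
theorem recourse_regular (hP : P.FeasibleSetsBoundedNonempty) {t : ℕ} (h1 : 1 ≤ t) (hT : t ≤ P.T) :
    ∃ q : Hist P.n → ℝ, ∀ σ : P.Scenario,
      (∀ h ∈ feasibleHist σ t, P.recourse (t + 1) h = q h) ∧
      LowerSemicontinuousOn q (feasibleHist σ t) ∧ ∃ C, ∀ h ∈ feasibleHist σ t, q h ≤ C := by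
  induction hd : P.T - t generalizing t with
  | zero =>
    refine ⟨0, fun σ => ⟨fun h _ => ?_, lowerSemicontinuousOn_const, 0, fun _ _ => le_rfl⟩⟩
    rw [recourse, dif_neg (by omega)]
    rfl
  | succ d ih =>
    have hT' : t + 1 ≤ P.T := by omega
    obtain ⟨q, hq⟩ := ih (t := t + 1) (by omega) hT' (by omega)
    -- The minimizer is chosen as a function of `h` and `j` only, so that the resulting function
    -- does not depend on the scenario along which `h` is feasible.
    have hsol : ∀ h : Hist P.n, ∀ j, ∃ x, (∃ σ : P.Scenario, h ∈ feasibleHist σ t) →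
        x ∈ P.feasible (t + 1) j h ∧ ∀ y ∈ P.feasible (t + 1) j h,
        P.cost (t + 1) j h x + q (Function.update h (t + 1) x)
          ≤ P.cost (t + 1) j h y + q (Function.update h (t + 1) y) := by
      intro h j
      by_cases hh : ∃ σ : P.Scenario, h ∈ feasibleHist σ t
      · obtain ⟨σ, hσ⟩ := hh
        obtain ⟨x, hx, hmin⟩ := exists_stage_solution hP hT' j (hq _).2.1 hσ
        exact ⟨x, fun _ => ⟨hx, hmin⟩⟩
      · exact ⟨0, fun h' => absurd h' hh⟩
    choose X hX using hsol
    let g : (j : Fin (P.M (t + 1))) → Hist P.n → ℝ := fun j h =>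
      P.cost (t + 1) j h (X h j) + q (Function.update h (t + 1) (X h j))
    have hsv : ∀ σ : P.Scenario, ∀ h ∈ feasibleHist σ t, ∀ j,
        P.stageValue (t + 1) j (P.recourse (t + 2)) h = g j h := fun σ h hh j =>
      stageValue_eq (fun x hx => (hq _).1 _ (update_mem' hh hx)) (hX h j ⟨σ, hh⟩).1
        (hX h j ⟨σ, hh⟩).2
    choose p hp hpmax hprisk using fun h =>
      exists_maximizing_weights (P := P) (t := t + 1) (by omega) hT' (fun j => g j h)
    let r : Hist P.n → ℝ := fun h => ∑ j, p h j * P.Φ (t + 1) j * g j h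
    refine ⟨r, fun σ => ⟨fun h hh => ?_, fun h hh y hy => ?_, ?_⟩⟩
    · rw [recourse, dif_pos hT', ← hprisk h]
      simp only [hsv σ h hh]
    -- The weights that are maximal at `h` are admissible at every nearby `w`, hence bound the risk
    -- there from below.
    · have hl : LowerSemicontinuousOn (fun w => ∑ j, p h j * P.Φ (t + 1) j * g j w)
          (feasibleHist σ t) := by
        refine lowerSemicontinuousOn_sum fun j _ => ?_
        have hgj : LowerSemicontinuousOn (g j) (feasibleHist σ t) :=
          lowerSemicontinuousOn_stage hP hT' j (hq _).2.1
            (fun w hw => ⟨X w j, (hX w j ⟨σ, hw⟩).1, rfl⟩)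
            (fun w hw x hx => (hX w j ⟨σ, hw⟩).2 x hx)
        exact Continuous.comp_lowerSemicontinuousOn
          (g := fun s : ℝ => p h j * P.Φ (t + 1) j * s) (by fun_prop) hgj
          (fun a b hab => mul_le_mul_of_nonneg_left hab (weight_nonneg (by omega) hT' (hp h) j))
      filter_upwards [hl h hh y hy] with w hw
      exact hw.trans_le (hpmax w _ (hp h))
    · have hub : ∀ j, ∃ C, ∀ h ∈ feasibleHist σ t, g j h ≤ C := by
        intro j
        set σ' : P.Scenario := Function.update σ (t + 1) j with hσ'
        obtain ⟨C, hC⟩ := (hq σ').2.2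
        have h2 : Continuous fun h' : Hist P.n => P.cost (t + 1) j h' (h' (t + 1)) :=
          continuous_cost (t + 1) j continuous_id (continuous_apply _)
        obtain ⟨B, hB⟩ := ((isCompact_feasibleHist hP σ' _ hT').image h2).bddAbove
        refine ⟨B + C, fun h hh => add_le_add ?_ (hC _ (update_mem' hh (hX h j ⟨σ, hh⟩).1))⟩
        refine hB ⟨_, update_mem' hh (hX h j ⟨σ, hh⟩).1, ?_⟩
        simp only [Function.update_self]
        refine cost_congr (fun τ hτ => ?_) _
        rw [Function.update_of_ne hτ.ne]
      choose C hC using hub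
      refine ⟨∑ j, |C j|, fun h hh => ?_⟩
      have hsum := (P.dualSet_subset (t + 1) (by omega) hT' (hp h)).2
      have hle : ∀ j, g j h ≤ ∑ i, |C i| := fun j => (hC j h hh).trans ((le_abs_self _).trans
        (Finset.single_le_sum (f := fun i => |C i|) (fun i _ => abs_nonneg _) (Finset.mem_univ j)))
      calc r h ≤ ∑ j, p h j * P.Φ (t + 1) j * ∑ i, |C i| :=
            Finset.sum_le_sum fun j _ => mul_le_mul_of_nonneg_left (hle j)
              (weight_nonneg (by omega) hT' (hp h) j)
        _ = ∑ i, |C i| := by rw [← Finset.sum_mul, hsum, one_mul]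

end Problem

/-! ### Cuts and the functions they define -/

/-- The value of a cut with a finite constant term. -/
noncomputable def OptCut.realEval {n : ℕ} (c : OptCut n) (t : ℕ) (h : Hist n) : ℝ :=
  c.θ.toReal + ∑ τ ∈ Finset.Ico 1 t, c.β τ ⬝ᵥ (h τ - c.base τ)

theorem OptCut.eval_of_bot {n : ℕ} {c : OptCut n} (hc : c.θ = ⊥) (t : ℕ) (h : Hist n) :
    c.eval t h = ⊥ := by
  rw [OptCut.eval, hc, EReal.bot_add]

theorem OptCut.eval_eq_coe {n : ℕ} {c : OptCut n} (hc : c.θ ≠ ⊥) (hc' : c.θ ≠ ⊤) (t : ℕ)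
    (h : Hist n) : c.eval t h = c.realEval t h := by
  rw [OptCut.eval, OptCut.realEval, EReal.coe_add, EReal.coe_toReal hc' hc]

theorem OptCut.continuous_realEval {n : ℕ} (c : OptCut n) (t : ℕ) :
    Continuous (c.realEval t) := by
  unfold OptCut.realEval
  refine continuous_const.add (continuous_finsetSum _ fun τ _ => ?_)
  exact Continuous.dotProduct continuous_const ((continuous_apply τ).sub continuous_const)

theorem OptCut.realEval_combination {n : ℕ} (c : OptCut n) (t : ℕ) (h h' : Hist n) (a b : ℝ)
    (hab : a + b = 1) :
    c.realEval t (a • h + b • h') = a * c.realEval t h + b * c.realEval t h' := by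
  have h1 : c.θ.toReal = a * c.θ.toReal + b * c.θ.toReal := by rw [← add_mul, hab, one_mul]
  unfold OptCut.realEval
  rw [mul_add, mul_add, Finset.mul_sum, Finset.mul_sum]
  have h2 : ∑ τ ∈ Finset.Ico 1 t, c.β τ ⬝ᵥ ((a • h + b • h') τ - c.base τ)
      = ∑ τ ∈ Finset.Ico 1 t, a * (c.β τ ⬝ᵥ (h τ - c.base τ))
        + ∑ τ ∈ Finset.Ico 1 t, b * (c.β τ ⬝ᵥ (h' τ - c.base τ)) := by
    rw [← Finset.sum_add_distrib]
    refine Finset.sum_congr rfl fun τ _ => ?_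
    simp only [Pi.add_apply, Pi.smul_apply, dotProduct_sub, dotProduct_add, dotProduct_smul,
      smul_eq_mul]
    linear_combination (c.β τ ⬝ᵥ c.base τ) * hab
  rw [h2]
  linarith

theorem OptCut.continuous_eval {n : ℕ} {c : OptCut n} (hc : c.θ ≠ ⊤) (t : ℕ) :
    Continuous (c.eval t) := by
  by_cases hb : c.θ = ⊥
  · rw [show c.eval t = fun _ => ⊥ from funext fun h => OptCut.eval_of_bot hb t h]
    exact continuous_const
  · rw [show c.eval t = fun h => (c.realEval t h : EReal) from
      funext fun h => OptCut.eval_eq_coe hb hc t h]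
    exact continuous_coe_real_ereal.comp (c.continuous_realEval t)

theorem lowerApprox_cons {n : ℕ} (t : ℕ) (c : OptCut n) (L : List (OptCut n)) (h : Hist n) :
    lowerApprox t (c :: L) h = c.eval t h ⊔ lowerApprox t L h := by
  simp [lowerApprox, iSup_or, iSup_sup_eq]

theorem continuous_lowerApprox {n : ℕ} (t : ℕ) {L : List (OptCut n)} (hL : ∀ c ∈ L, c.θ ≠ ⊤) :
    Continuous (lowerApprox t L) := by
  induction L with
  | nil =>
    rw [show lowerApprox t ([] : List (OptCut n)) = fun _ => ⊥ by funext h; simp [lowerApprox]]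
    exact continuous_const
  | cons c L ih =>
    rw [show lowerApprox t (c :: L) = fun h => c.eval t h ⊔ lowerApprox t L h from
      funext fun h => lowerApprox_cons t c L h]
    exact (OptCut.continuous_eval (hL c (by simp)) t).sup
      (ih fun c hc => hL c (List.mem_cons_of_mem _ hc))

theorem le_lowerApprox {n : ℕ} {t : ℕ} {L : List (OptCut n)} {c : OptCut n} (hc : c ∈ L)
    (h : Hist n) : c.eval t h ≤ lowerApprox t L h :=
  le_iSup₂ (f := fun c (_ : c ∈ L) => c.eval t h) c hc

theorem lowerApprox_mono {n : ℕ} {t : ℕ} {L L' : List (OptCut n)} (hL : ∀ c ∈ L, c ∈ L')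
    (h : Hist n) : lowerApprox t L h ≤ lowerApprox t L' h :=
  iSup₂_le fun c hc => le_lowerApprox (hL c hc) h

theorem lowerApprox_eq_bot {n : ℕ} {t : ℕ} {L : List (OptCut n)} (hL : ∀ c ∈ L, c.θ = ⊥)
    (h : Hist n) : lowerApprox t L h = ⊥ :=
  le_bot_iff.1 (iSup₂_le fun c hc => (OptCut.eval_of_bot (hL c hc) t h).le)

theorem lowerApprox_ne_top {n : ℕ} {t : ℕ} {L : List (OptCut n)} (hL : ∀ c ∈ L, c.θ ≠ ⊤)
    (h : Hist n) : lowerApprox t L h ≠ ⊤ := by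
  induction L with
  | nil => simp [lowerApprox]
  | cons c L ih =>
    rw [lowerApprox_cons]
    refine (max_lt (lt_top_iff_ne_top.2 ?_)
      (lt_top_iff_ne_top.2 (ih fun c hc => hL c (List.mem_cons_of_mem _ hc)))).ne
    by_cases hb : c.θ = ⊥
    · rw [OptCut.eval_of_bot hb]; exact bot_ne_top
    · rw [OptCut.eval_eq_coe hb (hL c (by simp))]; exact EReal.coe_ne_top _

/-- The cuts of a list with a finite cut define a continuous convex function. -/
theorem exists_real_lowerApprox {n : ℕ} (t : ℕ) {L : List (OptCut n)} (hL : ∀ c ∈ L, c.θ ≠ ⊤)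
    (hfin : ∃ c ∈ L, c.θ ≠ ⊥) :
    ∃ f : Hist n → ℝ, Continuous f ∧ ConvexOn ℝ Set.univ f ∧
      ∀ h, lowerApprox t L h = f h := by
  obtain ⟨c₀, hc₀, hb₀⟩ := hfin
  have hbot : ∀ h, lowerApprox t L h ≠ ⊥ := fun h hh => by
    have := le_lowerApprox (t := t) hc₀ h
    rw [hh, le_bot_iff, OptCut.eval_eq_coe hb₀ (hL c₀ hc₀)] at this
    exact EReal.coe_ne_bot _ this
  have hcoe : ∀ h, lowerApprox t L h = ((lowerApprox t L h).toReal : EReal) := fun h =>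
    (EReal.coe_toReal (lowerApprox_ne_top hL h) (hbot h)).symm
  refine ⟨fun h => (lowerApprox t L h).toReal, ?_, ⟨convex_univ, fun h _ h' _ a b ha hb hab => ?_⟩,
    hcoe⟩
  · refine EReal.isEmbedding_coe.continuous_iff.2 ?_
    exact (continuous_lowerApprox t hL).congr hcoe
  · rw [← EReal.coe_le_coe_iff, ← hcoe]
    refine iSup₂_le fun c hc => ?_
    by_cases hcb : c.θ = ⊥
    · rw [OptCut.eval_of_bot hcb]; exact bot_le
    · have key : ∀ w, c.realEval t w ≤ (lowerApprox t L w).toReal := fun w => by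
        rw [← EReal.coe_le_coe_iff, ← hcoe, ← OptCut.eval_eq_coe hcb (hL c hc)]
        exact le_lowerApprox hc w
      rw [OptCut.eval_eq_coe hcb (hL c hc), EReal.coe_le_coe_iff,
        OptCut.realEval_combination _ _ _ _ _ _ hab]
      exact add_le_add (mul_le_mul_of_nonneg_left (key h) ha)
        (mul_le_mul_of_nonneg_left (key h') hb)

namespace Problem

variable {P : Problem}

/-! ### Stage subproblems without feasibility cuts -/

theorem subFeasible_nil (t : ℕ) (j : Fin (P.M t)) (h : Hist P.n) :
    P.subFeasible t j h [] = P.feasible t j h := by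
  ext x
  simp [subFeasible]

theorem subValue_nil (t : ℕ) (j : Fin (P.M t)) (h : Hist P.n) (L : List (OptCut P.n)) :
    P.subValue t j h L [] = P.stageValue t j (lowerApprox (t + 1) L) h := by
  rw [subValue, subFeasible_nil]
  rfl

theorem subValue_eq_bot (hP : P.FeasibleSetsBoundedNonempty) {σ : P.Scenario} {t : ℕ}
    (ht : t + 1 ≤ P.T) {h : Hist P.n} (hh : h ∈ feasibleHist σ t) (j : Fin (P.M (t + 1)))
    {L : List (OptCut P.n)} (hL : ∀ c ∈ L, c.θ = ⊥) : P.subValue (t + 1) j h L [] = ⊥ := by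
  obtain ⟨x, hx⟩ := (hP.feasible ht hh j).2
  rw [subValue_nil, ← le_bot_iff]
  refine (iInf₂_le x hx).trans ?_
  rw [lowerApprox_eq_bot hL, EReal.add_bot]

/-- The subproblem with a real-valued model has a solution, at which its value is attained. -/
theorem exists_subSolution_real (hP : P.FeasibleSetsBoundedNonempty) {σ : P.Scenario} {t : ℕ}
    (ht : t + 1 ≤ P.T) {h : Hist P.n} (hh : h ∈ feasibleHist σ t) (j : Fin (P.M (t + 1)))
    {L : List (OptCut P.n)} {f : Hist P.n → ℝ} (hf : Continuous f)
    (hfL : ∀ h, lowerApprox (t + 2) L h = f h) :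
    ∃ x ∈ P.feasible (t + 1) j h, (∀ y ∈ P.feasible (t + 1) j h,
      P.cost (t + 1) j h x + f (Function.update h (t + 1) x)
        ≤ P.cost (t + 1) j h y + f (Function.update h (t + 1) y)) ∧
      P.subValue (t + 1) j h L []
        = ((P.cost (t + 1) j h x + f (Function.update h (t + 1) x) : ℝ) : EReal) := by
  obtain ⟨x, hx, hmin⟩ := exists_stage_solution hP ht j
    (hf.lowerSemicontinuous.lowerSemicontinuousOn _) hh
  refine ⟨x, hx, hmin, ?_⟩
  rw [subValue_nil]
  exact stageValue_eq (fun y _ => hfL _) hx hmin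

theorem exists_isSubSolution (hP : P.FeasibleSetsBoundedNonempty) {σ : P.Scenario} {t : ℕ}
    (ht : t + 1 ≤ P.T) {h : Hist P.n} (hh : h ∈ feasibleHist σ t) (j : Fin (P.M (t + 1)))
    {L : List (OptCut P.n)} (hL : ∀ c ∈ L, c.θ ≠ ⊤) :
    ∃ x, P.IsSubSolution (t + 1) j h L [] x := by
  by_cases hfin : ∃ c ∈ L, c.θ ≠ ⊥
  · obtain ⟨f, hf, -, hfL⟩ := exists_real_lowerApprox (t + 2) hL hfin
    obtain ⟨x, hx, hmin, -⟩ := exists_subSolution_real hP ht hh j hf hfL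
    refine ⟨x, by rwa [subFeasible_nil], fun y hy => ?_⟩
    rw [subFeasible_nil] at hy
    rw [subObjective, subObjective, hfL, hfL, ← EReal.coe_add, ← EReal.coe_add,
      EReal.coe_le_coe_iff]
    exact hmin y hy
  · push Not at hfin
    obtain ⟨x, hx⟩ := (hP.feasible ht hh j).2
    refine ⟨x, by rwa [subFeasible_nil], fun y _ => ?_⟩
    rw [subObjective, subObjective, lowerApprox_eq_bot hfin, EReal.add_bot]
    exact bot_le

theorem IsSubSolution.subValue_eq {t : ℕ} {j : Fin (P.M t)} {h : Hist P.n}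
    {L : List (OptCut P.n)} {K : List (FeasCut P.n)} {x : Fin P.n → ℝ}
    (hx : P.IsSubSolution t j h L K x) : P.subValue t j h L K = P.subObjective t j h L x :=
  le_antisymm (iInf₂_le x hx.1) (le_iInf₂ hx.2)

/-- A feasible decision with zero slacks `y₁`, `y₂` shows that the phase I value is at most `0`. -/
theorem badChildren_eq_empty (hP : P.FeasibleSetsBoundedNonempty) {σ : P.Scenario} {t : ℕ}
    (ht : t + 1 ≤ P.T) {h : Hist P.n} (hh : h ∈ feasibleHist σ t) :
    P.badChildren (t + 1) h [] = ∅ := by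
  rw [Set.eq_empty_iff_forall_notMem]
  intro j hj
  obtain ⟨x, hx, hr⟩ := (hP.feasible ht hh j).2
  refine absurd (show 0 < P.phaseValue (t + 1) j h [] from hj) (not_lt.2 ?_)
  refine (iInf_le _ x).trans ((iInf_le _ 0).trans ((iInf_le _ 0).trans
    ((iInf_le _ ⟨hx, fun i => le_rfl, fun i => le_rfl, by simp [hr], by simp⟩).trans ?_)))
  simp

/-! ### Lagrange multipliers -/

theorem residual_eq_add (t : ℕ) (j : Fin (P.M t)) (h : Hist P.n) (x : Fin P.n → ℝ) :
    P.residual t j h x = (P.ξ t j).A t *ᵥ x + P.residual t j h 0 := by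
  simp only [residual, Matrix.mulVec_zero]
  abel

theorem cost_eq_add (t : ℕ) (j : Fin (P.M t)) (h : Hist P.n) (x : Fin P.n → ℝ) :
    P.cost t j h x = (P.ξ t j).Ψ t ⬝ᵥ x + P.cost t j h 0 := by
  simp only [cost, dotProduct_zero]
  ring

theorem realEval_update {n : ℕ} (c : OptCut n) {t : ℕ} (ht : 1 ≤ t) (h : Hist n)
    (x : Fin n → ℝ) :
    c.realEval (t + 1) (Function.update h t x) = c.realEval t h + c.β t ⬝ᵥ (x - c.base t) := by
  unfold OptCut.realEval
  rw [Finset.sum_Ico_succ_top ht, Function.update_self, add_assoc]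
  congr 2
  refine Finset.sum_congr rfl fun τ hτ => ?_
  rw [Function.update_of_ne (Finset.mem_Ico.1 hτ).2.ne]

theorem lagrangian_eq_coe (t : ℕ) (j : Fin (P.M t)) (h : Hist P.n) {L : List (OptCut P.n)}
    (hL : ∀ c ∈ L, c.θ ≠ ⊤) (π : Multipliers (P.rows t) L.length ([] : List (FeasCut P.n)).length)
    (hπ : ∀ i, (L.get i).θ = ⊥ → π.opt i = 0) (x : Fin P.n → ℝ) (z : ℝ) :
    P.lagrangian t j h L [] π x z = ((P.cost t j h x + z + π.eq ⬝ᵥ P.residual t j h x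
      + ∑ i, π.opt i * ((L.get i).realEval (t + 1) (Function.update h t x) - z) : ℝ) : EReal) := by
  have h0 : ∑ i, π.feas i * (([] : List (FeasCut P.n)).get i).excess (t + 1)
      (Function.update h t x) = 0 := Finset.sum_eq_zero fun i _ => i.elim0
  rw [lagrangian, h0, add_zero, EReal.coe_add _ (∑ i, _), coe_finset_sum]
  congr 1
  refine Finset.sum_congr rfl fun i _ => ?_
  by_cases hi : (L.get i).θ = ⊥
  · rw [hπ i hi, EReal.coe_zero, zero_mul, zero_mul, EReal.coe_zero]
  · rw [OptCut.eval_eq_coe hi (hL _ (List.get_mem _ _)), ← EReal.coe_sub, ← EReal.coe_mul]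

/-- Strong duality: in the variables `(x, z)`, the objective minus `v` is nonnegative wherever the
constraints hold, so `affine_farkas` bounds it below by a nonnegative combination of them. Each
equality is split into two inequalities, and a cut equal to `-∞` is replaced by the trivial
constraint `0 ≥ 0`. -/
theorem exists_isMultiplier {t : ℕ} (ht : 1 ≤ t) (j : Fin (P.M t)) (h : Hist P.n)
    {L : List (OptCut P.n)} (hL : ∀ c ∈ L, c.θ ≠ ⊤) {f : Hist P.n → ℝ}
    (hfL : ∀ h, lowerApprox (t + 1) L h = f h) (hne : (P.feasible t j h).Nonempty) {v : ℝ}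
    (hv : P.subValue t j h L [] = v) : ∃ π, P.IsMultiplier t j h L [] π := by
  classical
  let X : (Fin P.n → ℝ) × ℝ →ₗ[ℝ] (Fin P.n → ℝ) := LinearMap.fst ℝ _ _
  let Z : (Fin P.n → ℝ) × ℝ →ₗ[ℝ] ℝ := LinearMap.snd ℝ _ _
  let dot : (Fin P.n → ℝ) → (Fin P.n → ℝ) →ₗ[ℝ] ℝ := fun w =>
    { toFun := fun x => w ⬝ᵥ x
      map_add' := fun x y => dotProduct_add w x y
      map_smul' := fun r x => dotProduct_smul r w x }
  let row : Fin (P.rows t) → (Fin P.n → ℝ) := fun i => (P.ξ t j).A t i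
  let a : Fin P.n ⊕ Fin (P.rows t) ⊕ Fin (P.rows t) ⊕ Fin L.length →
      (Fin P.n → ℝ) × ℝ →ₗ[ℝ] ℝ :=
    Sum.elim (fun i => LinearMap.proj i ∘ₗ X) (Sum.elim (fun i => dot (row i) ∘ₗ X)
      (Sum.elim (fun i => -(dot (row i) ∘ₗ X))
        (fun i => if (L.get i).θ = ⊥ then 0 else Z - dot ((L.get i).β t) ∘ₗ X)))
  let α : Fin P.n ⊕ Fin (P.rows t) ⊕ Fin (P.rows t) ⊕ Fin L.length → ℝ :=
    Sum.elim (fun _ => 0) (Sum.elim (fun i => P.residual t j h 0 i)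
      (Sum.elim (fun i => -P.residual t j h 0 i)
        (fun i => if (L.get i).θ = ⊥ then 0 else
          -((L.get i).realEval (t + 1) (Function.update h t 0)))))
  have hcut : ∀ i x z, ¬ (L.get i).θ = ⊥ →
      a (Sum.inr (Sum.inr (Sum.inr i))) (x, z) + α (Sum.inr (Sum.inr (Sum.inr i)))
        = z - (L.get i).realEval (t + 1) (Function.update h t x) := by
    intro i x z hi
    simp only [a, α, Sum.elim_inr, if_neg hi, LinearMap.sub_apply, LinearMap.comp_apply]
    rw [realEval_update _ ht, realEval_update _ ht]
    change z - (L.get i).β t ⬝ᵥ x + _ = _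
    simp only [dotProduct_sub, dotProduct_zero]
    ring
  have hcut' : ∀ i y, (L.get i).θ = ⊥ →
      a (Sum.inr (Sum.inr (Sum.inr i))) y + α (Sum.inr (Sum.inr (Sum.inr i))) = 0 := by
    intro i y hi
    simp only [a, α, Sum.elim_inr, if_pos hi, LinearMap.zero_apply, add_zero]
  have hres : ∀ i x z, a (Sum.inr (Sum.inl i)) (x, z) + α (Sum.inr (Sum.inl i))
      = P.residual t j h x i := by
    intro i x z
    rw [residual_eq_add]
    rfl
  have hres' : ∀ i x z, a (Sum.inr (Sum.inr (Sum.inl i))) (x, z) + α (Sum.inr (Sum.inr (Sum.inl i)))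
      = -P.residual t j h x i := by
    intro i x z
    rw [residual_eq_add, Pi.add_apply, neg_add]
    rfl
  have hx : ∀ i x z, a (Sum.inl i) (x, z) + α (Sum.inl i) = x i := by
    intro i x z
    simp [a, α, X]
  have hcutle : ∀ i x, ¬ (L.get i).θ = ⊥ →
      (L.get i).realEval (t + 1) (Function.update h t x) ≤ f (Function.update h t x) := by
    intro i x hi
    rw [← EReal.coe_le_coe_iff, ← hfL, ← OptCut.eval_eq_coe hi (hL _ (List.get_mem _ _))]
    exact le_lowerApprox (List.get_mem _ _) _
  have hfsub : ∀ x z, (∀ i, ¬ (L.get i).θ = ⊥ →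
      (L.get i).realEval (t + 1) (Function.update h t x) ≤ z) → f (Function.update h t x) ≤ z := by
    intro x z hz
    rw [← EReal.coe_le_coe_iff, ← hfL]
    refine iSup₂_le fun c hc => ?_
    obtain ⟨i, rfl⟩ := List.get_of_mem hc
    by_cases hi : (L.get i).θ = ⊥
    · rw [OptCut.eval_of_bot hi]; exact bot_le
    · rw [OptCut.eval_eq_coe hi (hL _ hc)]
      exact EReal.coe_le_coe_iff.2 (hz i hi)
  obtain ⟨c, hc, hb⟩ := affine_farkas a α (dot ((P.ξ t j).Ψ t) ∘ₗ X + Z) (P.cost t j h 0 - v) (by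
      obtain ⟨x, hx0, hxr⟩ := hne
      refine ⟨(x, f (Function.update h t x)), ?_⟩
      rintro (i | i | i | i)
      · rw [hx]; exact hx0 i
      · rw [hres, hxr]; exact le_rfl
      · rw [hres', hxr]; simp
      · by_cases hi : (L.get i).θ = ⊥
        · rw [hcut' i _ hi]
        · rw [hcut i _ _ hi]
          linarith [hcutle i x hi]) (by
      rintro ⟨x, z⟩ hy
      have hxf : x ∈ P.feasible t j h := by
        refine ⟨fun i => by rw [← hx i x z]; exact hy _, ?_⟩
        funext i
        have h1 := hy (Sum.inr (Sum.inl i))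
        have h2 := hy (Sum.inr (Sum.inr (Sum.inl i)))
        rw [hres] at h1
        rw [hres'] at h2
        exact le_antisymm (neg_nonneg.1 h2) h1
      have hz := hfsub x z (fun i hi => by
        have h1 := hy (Sum.inr (Sum.inr (Sum.inr i)))
        rw [hcut i _ _ hi] at h1
        linarith)
      have hval : (v : EReal) ≤ ((P.cost t j h x + f (Function.update h t x) : ℝ) : EReal) := by
        rw [← hv, subValue_nil, EReal.coe_add, ← hfL]
        exact iInf₂_le x hxf
      rw [EReal.coe_le_coe_iff, cost_eq_add] at hval
      change 0 ≤ (P.ξ t j).Ψ t ⬝ᵥ x + z + _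
      linarith)
  -- The Lagrangian adds the residual, while Farkas subtracts its two signed copies; hence the order
  -- of the difference in `eq`.
  let π : Multipliers (P.rows t) L.length ([] : List (FeasCut P.n)).length :=
    { eq := fun i => c (Sum.inr (Sum.inr (Sum.inl i))) - c (Sum.inr (Sum.inl i))
      opt := fun i => if (L.get i).θ = ⊥ then 0 else c (Sum.inr (Sum.inr (Sum.inr i)))
      feas := fun _ => 0 }
  refine ⟨π, fun i => ?_, fun i => le_rfl, fun x z hx0 => ?_⟩
  · simp only [π]
    split_ifs
    · exact le_rfl
    · exact hc _
  · rw [lagrangian_eq_coe t j h hL π (fun i hi => if_pos hi), hv, EReal.coe_le_coe_iff]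
    have key := hb (x, z)
    simp only [Fintype.sum_sum_type, hx, hres, hres'] at key
    change _ ≤ (P.ξ t j).Ψ t ⬝ᵥ x + z + _ at key
    have h1 : 0 ≤ ∑ i, c (Sum.inl i) * x i :=
      Finset.sum_nonneg fun i _ => mul_nonneg (hc _) (hx0 i)
    have h2 : π.eq ⬝ᵥ P.residual t j h x
        = -(∑ i, c (Sum.inr (Sum.inl i)) * P.residual t j h x i
          + ∑ i, c (Sum.inr (Sum.inr (Sum.inl i))) * -P.residual t j h x i) := by
      rw [← Finset.sum_add_distrib, ← Finset.sum_neg_distrib]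
      exact Finset.sum_congr rfl fun i _ => by simp only [π]; ring
    have h3 : ∑ i, π.opt i * ((L.get i).realEval (t + 1) (Function.update h t x) - z)
        = -∑ i, c (Sum.inr (Sum.inr (Sum.inr i))) * (a (Sum.inr (Sum.inr (Sum.inr i))) (x, z)
          + α (Sum.inr (Sum.inr (Sum.inr i)))) := by
      rw [← Finset.sum_neg_distrib]
      refine Finset.sum_congr rfl fun i _ => ?_
      by_cases hi : (L.get i).θ = ⊥
      · rw [hcut' i _ hi]
        simp only [π, if_pos hi]
        ring
      · rw [hcut i _ _ hi]
        simp only [π, if_neg hi]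
        ring
    rw [h2, h3, cost_eq_add]
    linarith

theorem isMultiplier_of_subValue_eq_bot {t : ℕ} {j : Fin (P.M t)} {h : Hist P.n}
    {L : List (OptCut P.n)} {K : List (FeasCut P.n)} (hv : P.subValue t j h L K = ⊥) :
    ∃ π, P.IsMultiplier t j h L K π :=
  ⟨⟨0, 0, 0⟩, fun _ => le_rfl, fun _ => le_rfl, fun _ _ _ => by rw [hv]; exact bot_le⟩

/-- Multipliers give subgradients: the linearization at `h` of the value of the subproblem bounds
from below the objective of every feasible point at every other history. -/
theorem IsMultiplier.slope_le {t : ℕ} (ht : 1 ≤ t) {j : Fin (P.M t)} {h : Hist P.n}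
    {L : List (OptCut P.n)} (hL : ∀ c ∈ L, c.θ ≠ ⊤)
    {π : Multipliers (P.rows t) L.length ([] : List (FeasCut P.n)).length}
    (hπ : P.IsMultiplier t j h L [] π) {v : ℝ} (hv : P.subValue t j h L [] = v)
    {h' : Hist P.n} (h0 : h' 0 = h 0) {x : Fin P.n → ℝ} (hx : x ∈ P.feasible t j h') {z : ℝ}
    (hz : ∀ c ∈ L, c.eval (t + 1) (Function.update h' t x) ≤ z) :
    v + ∑ τ ∈ Finset.Ico 1 t, P.slope t j L [] π τ ⬝ᵥ (h' τ - h τ) ≤ P.cost t j h' x + z := by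
  obtain ⟨hopt, -, hlag⟩ := hπ
  -- A positive multiplier on a cut equal to `-∞` would make the Lagrangian `⊥`, below the finite
  -- value `v`.
  have hbot : ∀ i, (L.get i).θ = ⊥ → π.opt i = 0 := by
    intro i hi
    by_contra hne
    have hpos : 0 < π.opt i := (hopt i).lt_of_ne' hne
    have h1 := hlag 0 0 (fun _ => le_rfl)
    rw [hv, lagrangian, ← Finset.add_sum_erase _ _ (Finset.mem_univ i),
      OptCut.eval_of_bot hi, EReal.bot_sub, EReal.coe_mul_bot_of_pos hpos, EReal.bot_add,
      EReal.add_bot, le_bot_iff] at h1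
    exact EReal.coe_ne_bot _ h1
  have h1 := hlag x z hx.1
  rw [hv, lagrangian_eq_coe t j h hL π hbot, EReal.coe_le_coe_iff] at h1
  -- The Lagrangian at `h` is compared with the one at `h'`, term by term; the differences are
  -- linear in `h' - h` and add up to `slope`. At `h'` the residual vanishes and the cut terms are
  -- nonpositive, because `x` is feasible there and `z` dominates the cuts.
  have hcost : P.cost t j h' x = P.cost t j h x
      + ∑ τ ∈ Finset.Ico 1 t, (P.ξ t j).Ψ τ ⬝ᵥ (h' τ - h τ) := by
    simp only [cost, dotProduct_sub, Finset.sum_sub_distrib]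
    ring
  have hres : π.eq ⬝ᵥ P.residual t j h x
      = -∑ τ ∈ Finset.Ico 1 t, (((P.ξ t j).A τ)ᵀ *ᵥ π.eq) ⬝ᵥ (h' τ - h τ) := by
    have e1 : P.residual t j h x
        = P.residual t j h' x - ∑ τ ∈ Finset.Ico 1 t, (P.ξ t j).A τ *ᵥ (h' τ - h τ) := by
      -- The block `τ = 0`, absent from the slope, contributes nothing because both histories start
      -- at the same `x_0`.
      have e2 : ∑ τ ∈ Finset.Ico 1 t, (P.ξ t j).A τ *ᵥ (h' τ - h τ)
          = ∑ τ ∈ Finset.range t, (P.ξ t j).A τ *ᵥ (h' τ - h τ) := by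
        rw [Finset.range_eq_Ico, Finset.sum_eq_sum_Ico_succ_bot (by omega : 0 < t), h0]
        simp
      rw [e2]
      simp only [residual, Matrix.mulVec_sub, Finset.sum_sub_distrib]
      abel
    rw [e1, hx.2, zero_sub, dotProduct_neg, dotProduct_sum]
    congr 1
    refine Finset.sum_congr rfl fun τ _ => ?_
    rw [Matrix.dotProduct_mulVec, Matrix.mulVec_transpose]
  have hcuts : ∑ i, π.opt i * ((L.get i).realEval (t + 1) (Function.update h t x) - z)
      ≤ -∑ τ ∈ Finset.Ico 1 t, (∑ i, π.opt i • (L.get i).β τ) ⬝ᵥ (h' τ - h τ) := by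
    have e3 : ∑ τ ∈ Finset.Ico 1 t, (∑ i, π.opt i • (L.get i).β τ) ⬝ᵥ (h' τ - h τ)
        = ∑ i, π.opt i * ((L.get i).realEval t h' - (L.get i).realEval t h) := by
      simp only [sum_dotProduct, smul_dotProduct, smul_eq_mul]
      rw [Finset.sum_comm]
      refine Finset.sum_congr rfl fun i _ => ?_
      rw [← Finset.mul_sum]
      congr 1
      simp only [OptCut.realEval, dotProduct_sub, Finset.sum_sub_distrib]
      ring
    rw [e3, ← Finset.sum_neg_distrib]
    refine Finset.sum_le_sum fun i _ => ?_
    by_cases hi : (L.get i).θ = ⊥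
    · simp [hbot i hi]
    · have h2 := hz _ (List.get_mem L i)
      rw [OptCut.eval_eq_coe hi (hL _ (List.get_mem _ _)), EReal.coe_le_coe_iff,
        realEval_update _ ht] at h2
      rw [realEval_update _ ht]
      have := mul_le_mul_of_nonneg_left h2 (hopt i)
      linarith
  have hslope : ∑ τ ∈ Finset.Ico 1 t, P.slope t j L [] π τ ⬝ᵥ (h' τ - h τ)
      = ∑ τ ∈ Finset.Ico 1 t, (P.ξ t j).Ψ τ ⬝ᵥ (h' τ - h τ)
        + ∑ τ ∈ Finset.Ico 1 t, (((P.ξ t j).A τ)ᵀ *ᵥ π.eq) ⬝ᵥ (h' τ - h τ)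
        + ∑ τ ∈ Finset.Ico 1 t, (∑ i, π.opt i • (L.get i).β τ) ⬝ᵥ (h' τ - h τ) := by
    rw [← Finset.sum_add_distrib, ← Finset.sum_add_distrib]
    refine Finset.sum_congr rfl fun τ _ => ?_
    rw [← add_dotProduct, ← add_dotProduct]
    congr 1
    simp [slope]
  rw [hslope, hcost]
  linarith

/-! ### New optimality cuts -/

theorem child_idx (σ : P.Scenario) (t : ℕ) (j : Fin (P.M t)) : (σ.child t j).idx = j := by
  change Function.update σ t j t = j
  exact Function.update_self _ _ _

theorem exists_real_subValue (hP : P.FeasibleSetsBoundedNonempty) {σ : P.Scenario} {t : ℕ}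
    (hT : t + 1 ≤ P.T) {h : Hist P.n} (hh : h ∈ feasibleHist σ t) {L : List (OptCut P.n)}
    (hL : ∀ c ∈ L, c.θ ≠ ⊤) (hfin : ∃ c ∈ L, c.θ ≠ ⊥) :
    ∃ z : Fin (P.M (t + 1)) → ℝ, ∀ j, P.subValue (t + 1) j h L [] = z j := by
  obtain ⟨f, hf, -, hfL⟩ := exists_real_lowerApprox (t + 2) hL hfin
  choose x _ _ hx using fun j => exists_subSolution_real hP hT hh j hf hfL
  exact ⟨_, hx⟩

/-- Whether a subproblem has a finite value depends only on the list of cuts, not on the child. So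
either all values are real and compactness of the dual set applies, or all are `⊥` and every weight
vector is maximal. -/
theorem exists_weights (hP : P.FeasibleSetsBoundedNonempty) {σ : P.Scenario} {t : ℕ}
    (ht : 1 ≤ t) (hT : t + 1 ≤ P.T) {h : Hist P.n} (hh : h ∈ feasibleHist σ t)
    {L : List (OptCut P.n)} (hL : ∀ c ∈ L, c.θ ≠ ⊤) :
    ∃ p ∈ P.dualSet (t + 1), P.expect (t + 1) p (fun j => P.subValue (t + 1) j h L [])
      = P.risk (t + 1) (fun j => P.subValue (t + 1) j h L []) := by
  by_cases hfin : ∃ c ∈ L, c.θ ≠ ⊥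
  · obtain ⟨z, hz⟩ := exists_real_subValue hP hT hh hL hfin
    obtain ⟨p, hp, -, hr⟩ := exists_maximizing_weights (by omega) hT z
    refine ⟨p, hp, ?_⟩
    simp only [hz]
    rw [hr, expect_coe]
  · push Not at hfin
    obtain ⟨p, hp⟩ := P.dualSet_nonempty (t + 1) (by omega) hT
    refine ⟨p, hp, ?_⟩
    simp only [subValue_eq_bot hP hT hh _ hfin]
    rw [expect_bot (by omega) hT hp, risk_bot (by omega) hT]

theorem dual_isMultiplier (hP : P.FeasibleSetsBoundedNonempty) (Sv : P.Solver)
    (past : List P.Scenario) {σ : P.Scenario} {t : ℕ} (hT : t + 1 ≤ P.T) {h : Hist P.n}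
    (hh : h ∈ feasibleHist σ t) {L : List (OptCut P.n)} (hL : ∀ c ∈ L, c.θ ≠ ⊤)
    (j : Fin (P.M (t + 1))) :
    P.IsMultiplier (t + 1) j h L [] (Sv.dual past (σ.child (t + 1) j) h L []) := by
  have hspec := Sv.dual_spec past (σ.child (t + 1) j) h L []
  rw [child_idx] at hspec
  apply hspec
  by_cases hfin : ∃ c ∈ L, c.θ ≠ ⊥
  · obtain ⟨f, -, -, hfL⟩ := exists_real_lowerApprox (t + 2) hL hfin
    obtain ⟨z, hz⟩ := exists_real_subValue hP hT hh hL hfin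
    exact exists_isMultiplier (by omega) j h hL hfL (hP.feasible hT hh j).2 (hz j)
  · push Not at hfin
    exact isMultiplier_of_subValue_eq_bot (subValue_eq_bot hP hT hh j hfin)

theorem newCut_eval_base (Sv : P.Solver) (past : List P.Scenario) (σ : P.Scenario) (t : ℕ)
    (h : Hist P.n) (L : List (OptCut P.n)) (K : List (FeasCut P.n)) :
    (newCut Sv past σ t h L K).eval t h = P.risk t fun j => P.subValue t j h L K := by
  simp [newCut, OptCut.eval]

theorem newCut_θ_of_bot (hP : P.FeasibleSetsBoundedNonempty) (Sv : P.Solver)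
    (past : List P.Scenario) {σ : P.Scenario} {t : ℕ} (ht : 1 ≤ t) (hT : t + 1 ≤ P.T)
    {h : Hist P.n} (hh : h ∈ feasibleHist σ t) {L : List (OptCut P.n)} (hL : ∀ c ∈ L, c.θ = ⊥) :
    (newCut Sv past σ (t + 1) h L []).θ = ⊥ := by
  simp only [newCut, subValue_eq_bot hP hT hh _ hL]
  exact risk_bot (by omega) hT

theorem newCut_θ_of_finite (hP : P.FeasibleSetsBoundedNonempty) (Sv : P.Solver)
    (past : List P.Scenario) {σ : P.Scenario} {t : ℕ} (ht : 1 ≤ t) (hT : t + 1 ≤ P.T)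
    {h : Hist P.n} (hh : h ∈ feasibleHist σ t) {L : List (OptCut P.n)} (hL : ∀ c ∈ L, c.θ ≠ ⊤)
    (hfin : ∃ c ∈ L, c.θ ≠ ⊥) :
    (newCut Sv past σ (t + 1) h L []).θ ≠ ⊥ ∧ (newCut Sv past σ (t + 1) h L []).θ ≠ ⊤ := by
  obtain ⟨z, hz⟩ := exists_real_subValue hP hT hh hL hfin
  obtain ⟨p, -, -, hr⟩ := exists_maximizing_weights (P := P) (by omega) hT z
  simp only [newCut, hz]
  rw [hr]
  exact ⟨EReal.coe_ne_bot _, EReal.coe_ne_top _⟩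

theorem newCut_θ_ne_top (hP : P.FeasibleSetsBoundedNonempty) (Sv : P.Solver)
    (past : List P.Scenario) {σ : P.Scenario} {t : ℕ} (ht : 1 ≤ t) (hT : t + 1 ≤ P.T)
    {h : Hist P.n} (hh : h ∈ feasibleHist σ t) {L : List (OptCut P.n)} (hL : ∀ c ∈ L, c.θ ≠ ⊤) :
    (newCut Sv past σ (t + 1) h L []).θ ≠ ⊤ := by
  by_cases hfin : ∃ c ∈ L, c.θ ≠ ⊥
  · exact (newCut_θ_of_finite hP Sv past ht hT hh hL hfin).2
  · push Not at hfin
    rw [newCut_θ_of_bot hP Sv past ht hT hh hfin]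
    exact bot_ne_top

/-- A cut computed from valid cuts of the next stage is valid. -/
theorem newCut_le_recourse (hP : P.FeasibleSetsBoundedNonempty) (Sv : P.Solver)
    (past : List P.Scenario) {σ : P.Scenario} {t : ℕ} (ht : 1 ≤ t) (hT : t + 1 ≤ P.T)
    {h : Hist P.n} (hh : h ∈ feasibleHist σ t) {L : List (OptCut P.n)} (hL : ∀ c ∈ L, c.θ ≠ ⊤)
    (hvalid : ∀ c ∈ L, ∀ (σ' : P.Scenario), ∀ w ∈ feasibleHist σ' (t + 1),
      c.eval (t + 2) w ≤ P.recourse (t + 2) w)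
    {σ' : P.Scenario} {h' : Hist P.n} (hh' : h' ∈ feasibleHist σ' t) :
    (newCut Sv past σ (t + 1) h L []).eval (t + 1) h' ≤ P.recourse (t + 1) h' := by
  by_cases hfin : ∃ c ∈ L, c.θ ≠ ⊥
  swap
  · push Not at hfin
    rw [OptCut.eval_of_bot (newCut_θ_of_bot hP Sv past ht hT hh hfin)]
    exact bot_le
  obtain ⟨z, hz⟩ := exists_real_subValue hP hT hh hL hfin
  obtain ⟨q, hq⟩ := recourse_regular hP (t := t + 1) (by omega) hT
  choose x hx hmin using fun j => exists_stage_solution hP hT j (hq _).2.1 hh'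
  let g : Fin (P.M (t + 1)) → ℝ := fun j =>
    P.cost (t + 1) j h' (x j) + q (Function.update h' (t + 1) (x j))
  have hg : ∀ j, P.stageValue (t + 1) j (P.recourse (t + 2)) h' = g j := fun j =>
    stageValue_eq (fun y hy => (hq _).1 _ (update_mem' hh' hy)) (hx j) (hmin j)
  obtain ⟨hp, hpr⟩ := Sv.weights_spec past (t + 1) _ (exists_weights hP ht hT hh hL)
  set p := Sv.weights past (t + 1) fun j => P.subValue (t + 1) j h L [] with hpdef
  obtain ⟨p', hp', hgmax, hgr⟩ := exists_maximizing_weights (by omega) hT g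
  have hslope : ∀ j, z j + ∑ τ ∈ Finset.Ico 1 (t + 1),
      P.slope (t + 1) j L [] (Sv.dual past (σ.child (t + 1) j) h L []) τ ⬝ᵥ (h' τ - h τ)
        ≤ g j := fun j =>
    (dual_isMultiplier hP Sv past hT hh hL j).slope_le (by omega) hL (hz j)
      (hh'.1.trans hh.1.symm) (hx j) fun c hc => by
        rw [← (hq _).1 _ (update_mem' hh' (hx j))]
        exact hvalid c hc _ _ (update_mem' hh' (hx j))
  have hθ : (newCut Sv past σ (t + 1) h L []).θ
      = ((∑ j, p j * P.Φ (t + 1) j * z j : ℝ) : EReal) := by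
    change P.risk (t + 1) (fun j => P.subValue (t + 1) j h L []) = _
    rw [← hpr, ← expect_coe]
    simp only [hz]
  rw [OptCut.eval, hθ, ← EReal.coe_add, recourse, dif_pos hT]
  simp only [hg]
  rw [hgr, EReal.coe_le_coe_iff]
  -- The weights `p` computed at `h` belong to the dual set, so at `h'` they give at most the risk
  -- of the true values `g`.
  refine le_trans ?_ (hgmax p hp)
  have hβ : ∑ τ ∈ Finset.Ico 1 (t + 1), (newCut Sv past σ (t + 1) h L []).β τ ⬝ᵥ
      (h' τ - (newCut Sv past σ (t + 1) h L []).base τ)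
      = ∑ j, p j * P.Φ (t + 1) j * ∑ τ ∈ Finset.Ico 1 (t + 1),
        P.slope (t + 1) j L [] (Sv.dual past (σ.child (t + 1) j) h L []) τ ⬝ᵥ (h' τ - h τ) := by
    simp only [newCut, sum_dotProduct, smul_dotProduct, smul_eq_mul, Finset.mul_sum]
    rw [Finset.sum_comm]
  rw [hβ, ← Finset.sum_add_distrib]
  refine Finset.sum_le_sum fun j _ => ?_
  rw [← mul_add]
  exact mul_le_mul_of_nonneg_left (hslope j) (weight_nonneg (by omega) hT hp j)

/-! ### The run of the algorithm -/

/-- The decision at a node that the algorithm computes at an iteration that passes through its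
parent. -/
noncomputable def decision (Sv : P.Solver) (past : List P.Scenario) (S : P.State) :
    (t : ℕ) → P.Node t → Fin P.n → ℝ
  | t, m => if t = 0 then P.x₀ else
      Sv.primal past m
        (fun τ => if hτ : τ < t then decision Sv past S τ (m.ancestor τ hτ.le) else 0)
        (S.opt (t + 1)) []
termination_by t => t

/-- The decisions along a scenario up to stage `t`. -/
noncomputable def decisionHist (Sv : P.Solver) (past : List P.Scenario) (S : P.State)
    (σ : P.Scenario) (t : ℕ) : Hist P.n :=
  trunc (t + 1) fun τ => decision Sv past S τ (σ.node τ)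

/-- The cuts at the end of an iteration. -/
noncomputable def nextState (Sv : P.Solver) (past : List P.Scenario) (σ : P.Scenario)
    (S : P.State) : P.State where
  -- The zero cut is prescribed at stage `T + 1`; at the other stages outside `2..T` it is a filler,
  -- on which `IsIteration` imposes nothing.
  opt t := S.opt t ++ [if 2 ≤ t ∧ t ≤ P.T then
    newCut Sv (past ++ [σ]) σ t (trunc t fun τ => decision Sv past S τ (σ.node τ))
      (S.opt (t + 1)) [] else ⟨0, 0, 0⟩]
  feas _ := []

/-- The cuts at the end of iteration `k`. -/
noncomputable def runState (Sv : P.Solver) (scen : ℕ → P.Scenario) : ℕ → P.State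
  | 0 => P.init
  | k + 1 => nextState Sv (past scen k) (scen (k + 1)) (runState Sv scen k)

/-- There are no feasibility cuts, and the optimality cuts are valid. -/
structure State.Valid (S : P.State) : Prop where
  feas : S.feas = fun _ => []
  ne_top : ∀ t, ∀ c ∈ S.opt t, c.θ ≠ ⊤
  last : ∀ c ∈ S.opt (P.T + 1), c = ⟨0, 0, 0⟩
  last_ne_nil : S.opt (P.T + 1) ≠ []
  le_recourse : ∀ t, 1 ≤ t → t ≤ P.T → ∀ c ∈ S.opt (t + 1), ∀ (σ : P.Scenario),
    ∀ h ∈ feasibleHist σ t, c.eval (t + 1) h ≤ P.recourse (t + 1) h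

theorem decision_zero (Sv : P.Solver) (past : List P.Scenario) (S : P.State) (m : P.Node 0) :
    decision Sv past S 0 m = P.x₀ := by
  rw [decision, if_pos rfl]

theorem decision_succ (Sv : P.Solver) (past : List P.Scenario) (S : P.State) (σ : P.Scenario)
    (t : ℕ) : decision Sv past S (t + 1) (σ.node (t + 1))
      = Sv.primal past (σ.node (t + 1)) (decisionHist Sv past S σ t) (S.opt (t + 2)) [] := by
  rw [decision, if_neg (by omega)]
  congr 1

theorem decisionHist_zero (Sv : P.Solver) (past : List P.Scenario) (S : P.State)
    (σ : P.Scenario) : decisionHist Sv past S σ 0 = P.start := by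
  funext τ
  rcases Nat.eq_zero_or_pos τ with rfl | hτ
  · simp [decisionHist, trunc, decision_zero, start]
  · rw [decisionHist, trunc, if_neg (by omega), start, Function.update_of_ne hτ.ne']
    rfl

theorem decisionHist_succ (Sv : P.Solver) (past : List P.Scenario) (S : P.State)
    (σ : P.Scenario) (t : ℕ) : decisionHist Sv past S σ (t + 1)
      = Function.update (decisionHist Sv past S σ t) (t + 1)
        (decision Sv past S (t + 1) (σ.node (t + 1))) := by
  funext τ
  rcases lt_trichotomy τ (t + 1) with hτ | rfl | hτ
  · rw [Function.update_of_ne hτ.ne, decisionHist, decisionHist, trunc, trunc, if_pos hτ,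
      if_pos (by omega)]
  · rw [Function.update_self, decisionHist, trunc, if_pos (by omega)]
  · rw [Function.update_of_ne hτ.ne', decisionHist, decisionHist, trunc, trunc,
      if_neg (by omega), if_neg (by omega)]

theorem decisionHist_congr (Sv : P.Solver) (past : List P.Scenario) (S : P.State)
    {σ σ' : P.Scenario} {t : ℕ} (h : ∀ s ≤ t, σ s = σ' s) :
    decisionHist Sv past S σ t = decisionHist Sv past S σ' t := by
  funext τ
  by_cases hτ : τ < t + 1
  · rw [decisionHist, decisionHist, trunc, trunc, if_pos hτ, if_pos hτ]
    have : σ.node τ = σ'.node τ := funext fun s => h s (by omega)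
    rw [this]
  · rw [decisionHist, decisionHist, trunc, trunc, if_neg hτ, if_neg hτ]

theorem decisionHist_update (Sv : P.Solver) (past : List P.Scenario) (S : P.State)
    (σ : P.Scenario) (t : ℕ) (j : Fin (P.M (t + 1))) :
    decisionHist Sv past S (Function.update σ (t + 1) j) t = decisionHist Sv past S σ t :=
  decisionHist_congr Sv past S fun s hs => Function.update_of_ne (by omega) _ _

theorem history_decision (Sv : P.Solver) (past : List P.Scenario) (S : P.State)
    (σ : P.Scenario) (t : ℕ) :
    history (decision Sv past S) (σ.node t) = decisionHist Sv past S σ t := by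
  funext τ
  by_cases hτ : τ ≤ t
  · rw [history, dif_pos hτ, decisionHist, trunc, if_pos (by omega)]
    rfl
  · rw [history, dif_neg hτ, decisionHist, trunc, if_neg (by omega)]

theorem decision_isSubSolution (hP : P.FeasibleSetsBoundedNonempty) (Sv : P.Solver)
    (past : List P.Scenario) {S : P.State} (hS : S.Valid) {σ : P.Scenario} {t : ℕ}
    (hT : t + 1 ≤ P.T) (hh : decisionHist Sv past S σ t ∈ feasibleHist σ t) :
    P.IsSubSolution (t + 1) (σ (t + 1)) (decisionHist Sv past S σ t) (S.opt (t + 2)) []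
      (decision Sv past S (t + 1) (σ.node (t + 1))) := by
  rw [decision_succ]
  exact Sv.primal_spec past (σ.node (t + 1)) _ _ _
    (exists_isSubSolution hP hT hh _ (hS.ne_top _))

theorem decisionHist_mem (hP : P.FeasibleSetsBoundedNonempty) (Sv : P.Solver)
    (past : List P.Scenario) {S : P.State} (hS : S.Valid) (σ : P.Scenario) :
    ∀ t ≤ P.T, decisionHist Sv past S σ t ∈ feasibleHist σ t := by
  intro t
  induction t with
  | zero =>
    intro _
    rw [decisionHist_zero]
    exact start_mem σ
  | succ t ih =>
    intro hT
    have hh := ih (by omega)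
    have hsol := (decision_isSubSolution hP Sv past hS hT hh).1
    rw [subFeasible_nil] at hsol
    rw [decisionHist_succ]
    exact update_mem hh hsol

/-- Phase I values are never positive along feasible histories, so the pass consists of `advance`
steps followed by `done`. -/
theorem forward_decision (hP : P.FeasibleSetsBoundedNonempty) (Sv : P.Solver)
    (past : List P.Scenario) {S : P.State} (hS : S.Valid) (σ : P.Scenario) {t : ℕ}
    (ht : t ≤ P.T) : Forward Sv past σ S.opt (fun _ => []) (t + 1) (decisionHist Sv past S σ t)
      (.completed (fun _ => []) (decisionHist Sv past S σ P.T)) := by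
  induction hd : P.T - t generalizing t with
  | zero =>
    obtain rfl : t = P.T := by omega
    exact .done (by omega)
  | succ d ih =>
    have hT : t + 1 ≤ P.T := by omega
    have hh := decisionHist_mem hP Sv past hS σ t ht
    refine .advance (decision Sv past S (t + 1) (σ.node (t + 1))) (by omega) hT
      (badChildren_eq_empty hP hT hh) (decision_succ Sv past S σ t)
      (decision_isSubSolution hP Sv past hS hT hh) ?_
    rw [← decisionHist_succ]
    exact ih hT (by omega)

theorem isIteration_nextState (hP : P.FeasibleSetsBoundedNonempty) (Sv : P.Solver)
    (past : List P.Scenario) {S : P.State} (hS : S.Valid) (σ : P.Scenario) :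
    IsIteration Sv past σ S (decision Sv past S) (nextState Sv past σ S) where
  root := decision_zero Sv past S
  forward := by
    refine ⟨decisionHist Sv past S σ P.T, ?_, fun t _ hT => ?_⟩
    · rw [hS.feas, ← decisionHist_zero Sv past S σ]
      exact forward_decision hP Sv past hS σ (Nat.zero_le _)
    · rw [decisionHist, trunc, if_pos (by omega)]
  children := by
    intro t h2 hT j _
    obtain ⟨t, rfl⟩ : ∃ s, t = s + 1 := ⟨t - 1, by omega⟩
    have hh := decisionHist_mem hP Sv past hS (Function.update σ (t + 1) j) t (by omega)
    have h1 := decision_succ Sv past S (Function.update σ (t + 1) j) t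
    have h3 := decision_isSubSolution hP Sv past hS hT hh
    rw [decisionHist_update] at h1 h3
    rw [Function.update_self] at h3
    exact ⟨h1, h3⟩
  multipliers := by
    intro t h2 hT
    obtain ⟨t, rfl⟩ : ∃ s, t = s + 1 := ⟨t - 1, by omega⟩
    have hh := decisionHist_mem hP Sv past hS σ t (by omega)
    exact ⟨Sv.weights_spec _ _ _ (exists_weights hP (by omega) hT hh (hS.ne_top _)),
      fun j => dual_isMultiplier hP Sv _ hT hh (hS.ne_top _) j⟩
  cuts := by
    intro t h2 hT
    simp only [nextState, if_pos (And.intro h2 hT)]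
  last := by
    simp only [nextState]
    rw [if_neg (by omega)]

theorem zero_cut_eval {n : ℕ} (t : ℕ) (h : Hist n) :
    (⟨0, 0, 0⟩ : OptCut n).eval t h = 0 := by
  simp [OptCut.eval]

theorem recourse_last : P.recourse (P.T + 1) = fun _ => 0 := by
  rw [recourse, dif_neg (by omega)]

theorem valid_init : (P.init).Valid where
  feas := rfl
  ne_top t c hc := by
    simp only [init] at hc
    split_ifs at hc <;> simp only [List.mem_singleton] at hc <;> simp [hc]
  last c hc := by
    simp only [init] at hc
    rw [if_neg (by omega)] at hc
    simpa using hc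
  last_ne_nil := by simp [init]
  le_recourse t h1 hT c hc σ h _ := by
    simp only [init] at hc
    split_ifs at hc with ht
    · rw [List.mem_singleton] at hc
      rw [OptCut.eval_of_bot (by rw [hc])]
      exact bot_le
    · rw [List.mem_singleton] at hc
      obtain rfl : t = P.T := by omega
      rw [hc, zero_cut_eval, recourse_last]

theorem State.Valid.nextState (hP : P.FeasibleSetsBoundedNonempty) (Sv : P.Solver)
    (past : List P.Scenario) {S : P.State} (hS : S.Valid) (σ : P.Scenario) :
    (nextState Sv past σ S).Valid where
  feas := rfl
  ne_top t c hc := by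
    simp only [Problem.nextState, List.mem_append, List.mem_singleton] at hc
    rcases hc with hc | rfl
    · exact hS.ne_top t c hc
    · split_ifs with ht
      · obtain ⟨t, rfl⟩ : ∃ s, t = s + 1 := ⟨t - 1, by omega⟩
        exact newCut_θ_ne_top hP Sv _ (by omega) ht.2
          (decisionHist_mem hP Sv past hS σ t (by omega)) (hS.ne_top _)
      · simp
  last c hc := by
    simp only [Problem.nextState, List.mem_append, List.mem_singleton] at hc
    rw [if_neg (by omega)] at hc
    exact hc.elim (hS.last c) id
  last_ne_nil := by simp [Problem.nextState]
  le_recourse t h1 hT c hc σ' h hh := by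
    simp only [Problem.nextState, List.mem_append, List.mem_singleton] at hc
    rcases hc with hc | rfl
    · exact hS.le_recourse t h1 hT c hc σ' h hh
    · split_ifs with ht
      · exact newCut_le_recourse hP Sv _ h1 ht.2
          (decisionHist_mem hP Sv past hS σ t (by omega)) (hS.ne_top _)
          (fun c hc σ' w hw => hS.le_recourse (t + 1) (by omega) ht.2 c hc σ' w hw) hh
      · obtain rfl : t = P.T := by omega
        rw [zero_cut_eval, recourse_last]

theorem valid_runState (hP : P.FeasibleSetsBoundedNonempty) (Sv : P.Solver)
    (scen : ℕ → P.Scenario) (k : ℕ) : (runState Sv scen k).Valid := by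
  induction k with
  | zero => exact valid_init
  | succ k ih => exact ih.nextState hP Sv _ _

theorem mem_opt_succ {Sv : P.Solver} {scen : ℕ → P.Scenario} {k t : ℕ} {c : OptCut P.n}
    (hc : c ∈ (runState Sv scen k).opt t) : c ∈ (runState Sv scen (k + 1)).opt t :=
  List.mem_append_left _ hc

/-- The cuts of stage `t` are finite from iteration `T + 1 - t` on. -/
theorem exists_finite_cut (hP : P.FeasibleSetsBoundedNonempty) (Sv : P.Solver)
    (scen : ℕ → P.Scenario) {k t : ℕ} (h2 : 2 ≤ t) (hT : t ≤ P.T + 1) (hk : P.T + 1 ≤ t + k) :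
    ∃ c ∈ (runState Sv scen k).opt t, c.θ ≠ ⊥ := by
  induction k generalizing t with
  | zero =>
    obtain rfl : t = P.T + 1 := by omega
    exact ⟨⟨0, 0, 0⟩, by simp [runState, init], by simp⟩
  | succ k ih =>
    by_cases hk' : P.T + 1 ≤ t + k
    · obtain ⟨c, hc, hb⟩ := ih h2 hT hk'
      exact ⟨c, mem_opt_succ hc, hb⟩
    · have hS := valid_runState hP Sv scen k
      obtain ⟨t, rfl⟩ : ∃ s, t = s + 1 := ⟨t - 1, by omega⟩
      refine ⟨_, List.mem_append_right _ (List.mem_singleton_self _), ?_⟩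
      rw [if_pos ⟨h2, by omega⟩]
      -- The new cut of a stage uses the cuts of the next stage available at the start of the
      -- iteration, so finiteness travels back one stage per iteration. After `T` iterations all
      -- models of the stages `2..T + 1` are real-valued, which explains the later hypotheses `P.T ≤
      -- k`.
      exact (newCut_θ_of_finite hP Sv _ (by omega) (by omega)
        (decisionHist_mem hP Sv (past scen k) hS (scen (k + 1)) t (by omega)) (hS.ne_top _)
        (ih (t := t + 2) (by omega) (by omega) (by omega))).1

theorem isRun_runState (hP : P.FeasibleSetsBoundedNonempty) (Sv : P.Solver)
    (scen : ℕ → P.Scenario) :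
    IsRun Sv scen (runState Sv scen)
      (fun k => decision Sv (past scen (k - 1)) (runState Sv scen (k - 1))) := fun _ =>
  ⟨rfl, fun k _ => isIteration_nextState hP Sv (past scen k) (valid_runState hP Sv scen k) _⟩

/-! ### Convergence on a fixed sequence of scenarios -/

/-- The decisions of iteration `k + 1` along a scenario up to stage `t`. -/
noncomputable def trial (Sv : P.Solver) (scen : ℕ → P.Scenario) (k : ℕ) (σ : P.Scenario) (t : ℕ) :
    Hist P.n :=
  decisionHist Sv (past scen k) (runState Sv scen k) σ t

/-- The distance, at the decisions of iteration `k + 1`, between the recourse function and its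
approximation at the beginning of that iteration. -/
noncomputable def gap (Sv : P.Solver) (scen : ℕ → P.Scenario) (k : ℕ) (σ : P.Scenario) (t : ℕ) :
    ℝ :=
  (P.recourse (t + 1) (trial Sv scen k σ t)).toReal
    - (lowerApprox (t + 1) ((runState Sv scen k).opt (t + 1)) (trial Sv scen k σ t)).toReal

theorem trial_mem (hP : P.FeasibleSetsBoundedNonempty) (Sv : P.Solver) (scen : ℕ → P.Scenario)
    (k : ℕ) (σ : P.Scenario) {t : ℕ} (hT : t ≤ P.T) :
    trial Sv scen k σ t ∈ feasibleHist σ t :=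
  decisionHist_mem hP Sv _ (valid_runState hP Sv scen k) σ t hT

theorem exists_model (hP : P.FeasibleSetsBoundedNonempty) (Sv : P.Solver) (scen : ℕ → P.Scenario)
    {k t : ℕ} (h1 : 1 ≤ t) (hT : t ≤ P.T) (hk : P.T ≤ k) :
    ∃ f : Hist P.n → ℝ, Continuous f ∧ ConvexOn ℝ Set.univ f ∧
      ∀ h, lowerApprox (t + 1) ((runState Sv scen k).opt (t + 1)) h = f h :=
  exists_real_lowerApprox (t + 1) ((valid_runState hP Sv scen k).ne_top _)
    (exists_finite_cut hP Sv scen (by omega) (by omega) (by omega))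

theorem coe_toReal_model (hP : P.FeasibleSetsBoundedNonempty) (Sv : P.Solver)
    (scen : ℕ → P.Scenario) {k t : ℕ} (h1 : 1 ≤ t) (hT : t ≤ P.T) (hk : P.T ≤ k) (h : Hist P.n) :
    ((lowerApprox (t + 1) ((runState Sv scen k).opt (t + 1)) h).toReal : EReal)
      = lowerApprox (t + 1) ((runState Sv scen k).opt (t + 1)) h := by
  obtain ⟨f, -, -, hf⟩ := exists_model hP Sv scen h1 hT hk
  rw [hf, EReal.toReal_coe]

theorem coe_toReal_recourse (hP : P.FeasibleSetsBoundedNonempty) {t : ℕ} (h1 : 1 ≤ t)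
    (hT : t ≤ P.T) {σ : P.Scenario} {h : Hist P.n} (hh : h ∈ feasibleHist σ t) :
    ((P.recourse (t + 1) h).toReal : EReal) = P.recourse (t + 1) h := by
  obtain ⟨q, hq⟩ := recourse_regular hP h1 hT
  rw [(hq σ).1 h hh, EReal.toReal_coe]

theorem model_le_recourse (hP : P.FeasibleSetsBoundedNonempty) (Sv : P.Solver)
    (scen : ℕ → P.Scenario) (k : ℕ) {t : ℕ} (h1 : 1 ≤ t) (hT : t ≤ P.T) {σ : P.Scenario}
    {h : Hist P.n} (hh : h ∈ feasibleHist σ t) :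
    lowerApprox (t + 1) ((runState Sv scen k).opt (t + 1)) h ≤ P.recourse (t + 1) h :=
  iSup₂_le fun c hc => (valid_runState hP Sv scen k).le_recourse t h1 hT c hc σ h hh

theorem toReal_model_le (hP : P.FeasibleSetsBoundedNonempty) (Sv : P.Solver)
    (scen : ℕ → P.Scenario) {k t : ℕ} (h1 : 1 ≤ t) (hT : t ≤ P.T) (hk : P.T ≤ k) {σ : P.Scenario}
    {h : Hist P.n} (hh : h ∈ feasibleHist σ t) :
    (lowerApprox (t + 1) ((runState Sv scen k).opt (t + 1)) h).toReal
      ≤ (P.recourse (t + 1) h).toReal := by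
  rw [← EReal.coe_le_coe_iff, coe_toReal_model hP Sv scen h1 hT hk, coe_toReal_recourse hP h1 hT hh]
  exact model_le_recourse hP Sv scen k h1 hT hh

theorem toReal_model_mono (hP : P.FeasibleSetsBoundedNonempty) (Sv : P.Solver)
    (scen : ℕ → P.Scenario) {k t : ℕ} (h1 : 1 ≤ t) (hT : t ≤ P.T) (hk : P.T ≤ k) (h : Hist P.n) :
    (lowerApprox (t + 1) ((runState Sv scen k).opt (t + 1)) h).toReal
      ≤ (lowerApprox (t + 1) ((runState Sv scen (k + 1)).opt (t + 1)) h).toReal := by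
  rw [← EReal.coe_le_coe_iff, coe_toReal_model hP Sv scen h1 hT hk,
    coe_toReal_model hP Sv scen h1 hT (by omega)]
  exact lowerApprox_mono (fun c hc => mem_opt_succ hc) h

theorem gap_nonneg (hP : P.FeasibleSetsBoundedNonempty) (Sv : P.Solver)
    (scen : ℕ → P.Scenario) {k t : ℕ} (h1 : 1 ≤ t) (hT : t ≤ P.T) (hk : P.T ≤ k)
    (σ : P.Scenario) : 0 ≤ gap Sv scen k σ t :=
  sub_nonneg.2 (toReal_model_le hP Sv scen h1 hT hk (trial_mem hP Sv scen k σ hT))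

theorem gap_last (hP : P.FeasibleSetsBoundedNonempty) (Sv : P.Solver)
    (scen : ℕ → P.Scenario) (k : ℕ) (σ : P.Scenario) : gap Sv scen k σ P.T = 0 := by
  have hS := valid_runState hP Sv scen k
  have : lowerApprox (P.T + 1) ((runState Sv scen k).opt (P.T + 1)) (trial Sv scen k σ P.T) = 0 := by
    refine le_antisymm (iSup₂_le fun c hc => ?_) ?_
    · rw [hS.last c hc, zero_cut_eval]
    · obtain ⟨c, hc⟩ := List.exists_mem_of_ne_nil _ hS.last_ne_nil
      refine le_trans ?_ (le_lowerApprox hc _)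
      rw [hS.last c hc, zero_cut_eval]
  rw [gap, this, recourse_last]
  simp

/-- The value of the subproblem solved at a child node. -/
theorem subValue_trial (hP : P.FeasibleSetsBoundedNonempty) (Sv : P.Solver)
    (scen : ℕ → P.Scenario) {k t : ℕ} (hT : t + 1 ≤ P.T) (hk : P.T ≤ k) (σ : P.Scenario) :
    decision Sv (past scen k) (runState Sv scen k) (t + 1) (σ.node (t + 1))
        ∈ P.feasible (t + 1) (σ (t + 1)) (trial Sv scen k σ t) ∧
      P.subValue (t + 1) (σ (t + 1)) (trial Sv scen k σ t) ((runState Sv scen k).opt (t + 2)) []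
        = ((P.cost (t + 1) (σ (t + 1)) (trial Sv scen k σ t)
            (decision Sv (past scen k) (runState Sv scen k) (t + 1) (σ.node (t + 1)))
          + ((P.recourse (t + 2) (trial Sv scen k σ (t + 1))).toReal
            - gap Sv scen k σ (t + 1)) : ℝ) : EReal) := by
  have hsol := decision_isSubSolution hP Sv (past scen k) (valid_runState hP Sv scen k) hT
    (trial_mem hP Sv scen k σ (by omega))
  have hfeas := hsol.1
  rw [subFeasible_nil] at hfeas
  refine ⟨hfeas, ?_⟩
  rw [trial, hsol.subValue_eq, subObjective, ← decisionHist_succ, ← trial, ← trial, gap,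
    sub_sub_cancel, EReal.coe_add, coe_toReal_model hP Sv scen (by omega) hT hk]

theorem trial_update (Sv : P.Solver) (scen : ℕ → P.Scenario) (k : ℕ) (σ : P.Scenario) (t : ℕ)
    (j : Fin (P.M (t + 1))) :
    trial Sv scen k (Function.update σ (t + 1) j) t = trial Sv scen k σ t :=
  decisionHist_update _ _ _ _ _ _

theorem trial_succ (Sv : P.Solver) (scen : ℕ → P.Scenario) (k : ℕ) (σ : P.Scenario) (t : ℕ) :
    trial Sv scen k σ (t + 1) = Function.update (trial Sv scen k σ t) (t + 1)
      (decision Sv (past scen k) (runState Sv scen k) (t + 1) (σ.node (t + 1))) :=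
  decisionHist_succ _ _ _ _ _

/-- At a node that is sampled, the error after the iteration is bounded by the errors at the
children. -/
theorem sampled_error_le (hP : P.FeasibleSetsBoundedNonempty) (Sv : P.Solver)
    (scen : ℕ → P.Scenario) {k t : ℕ} (h1 : 1 ≤ t) (hT : t + 1 ≤ P.T) (hk : P.T ≤ k)
    {σ : P.Scenario} (hσ : ∀ s ≤ t, scen (k + 1) s = σ s) :
    (P.recourse (t + 1) (trial Sv scen k σ t)).toReal
      - (lowerApprox (t + 1) ((runState Sv scen (k + 1)).opt (t + 1)) (trial Sv scen k σ t)).toReal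
      ≤ ∑ j, gap Sv scen k (Function.update σ (t + 1) j) (t + 1) := by
  set y := trial Sv scen k σ t with hy
  have hyD : y ∈ feasibleHist σ t := trial_mem hP Sv scen k σ (by omega)
  let σj : Fin (P.M (t + 1)) → P.Scenario := fun j => Function.update σ (t + 1) j
  let x : Fin (P.M (t + 1)) → Fin P.n → ℝ := fun j =>
    decision Sv (past scen k) (runState Sv scen k) (t + 1) ((σj j).node (t + 1))
  let z : Fin (P.M (t + 1)) → ℝ := fun j => P.cost (t + 1) j y (x j)
    + ((P.recourse (t + 2) (trial Sv scen k (σj j) (t + 1))).toReal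
      - gap Sv scen k (σj j) (t + 1))
  have hz : ∀ j, x j ∈ P.feasible (t + 1) j y ∧
      P.subValue (t + 1) j y ((runState Sv scen k).opt (t + 2)) [] = z j := by
    intro j
    have := subValue_trial hP Sv scen hT hk (σj j)
    rw [trial_update, ← hy, show σj j (t + 1) = j from Function.update_self _ _ _] at this
    exact this
  set E := ∑ j, gap Sv scen k (Function.update σ (t + 1) j) (t + 1) with hE
  have hgE : ∀ j, gap Sv scen k (σj j) (t + 1) ≤ E := fun j =>
    Finset.single_le_sum (f := fun j => gap Sv scen k (Function.update σ (t + 1) j) (t + 1))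
      (fun i _ => gap_nonneg hP Sv scen (by omega) hT hk _) (Finset.mem_univ j)
  obtain ⟨q, hq⟩ := recourse_regular hP (t := t + 1) (by omega) hT
  choose w hw hwmin using fun j => exists_stage_solution hP hT j (hq _).2.1 hyD
  let g : Fin (P.M (t + 1)) → ℝ := fun j =>
    P.cost (t + 1) j y (w j) + q (Function.update y (t + 1) (w j))
  have hg : ∀ j, P.stageValue (t + 1) j (P.recourse (t + 2)) y = g j := fun j =>
    stageValue_eq (fun v hv => (hq _).1 _ (update_mem' hyD hv)) (hw j) (hwmin j)
  -- The decision `x j` is feasible in the true problem of child `j`, where it costs the value `z j`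
  -- of the subproblem plus the gap at that child.
  have hgz : ∀ j, g j ≤ z j + E := by
    intro j
    have h2 := hwmin j (x j) (hz j).1
    have h3 : (P.recourse (t + 2) (trial Sv scen k (σj j) (t + 1))).toReal
        = q (Function.update y (t + 1) (x j)) := by
      rw [trial_succ, trial_update, ← hy, (hq _).1 _ (update_mem' hyD (hz j).1), EReal.toReal_coe]
    have h4 := hgE j
    simp only [g, z, h3]
    linarith
  obtain ⟨p, hp, -, hpr⟩ := exists_maximizing_weights (P := P) (t := t + 1) (by omega) hT g
  obtain ⟨p', hp', hpmax, hpr'⟩ := exists_maximizing_weights (P := P) (t := t + 1) (by omega) hT z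
  have hrec : P.recourse (t + 1) y = ((∑ j, p j * P.Φ (t + 1) j * g j : ℝ) : EReal) := by
    rw [← hpr, recourse, dif_pos hT]
    simp only [hg]
  -- Since the sampled path passes through the node, the new cut is based at `y`, and its value
  -- there is the risk of the values of the subproblems.
  have hcut : (P.risk (t + 1) fun j => (z j : EReal))
      ≤ lowerApprox (t + 1) ((runState Sv scen (k + 1)).opt (t + 1)) y := by
    have hbase : decisionHist Sv (past scen k) (runState Sv scen k) (scen (k + 1)) t = y :=
      decisionHist_congr _ _ _ hσ
    have hmem : newCut Sv (past scen k ++ [scen (k + 1)]) (scen (k + 1)) (t + 1)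
        (decisionHist Sv (past scen k) (runState Sv scen k) (scen (k + 1)) t)
        ((runState Sv scen k).opt (t + 2)) [] ∈ (runState Sv scen (k + 1)).opt (t + 1) := by
      refine List.mem_append_right _ (List.mem_singleton.2 ?_)
      rw [if_pos ⟨by omega, hT⟩]
      rfl
    have := le_lowerApprox (t := t + 1) hmem y
    rw [hbase, newCut_eval_base] at this
    simpa only [hz] using this
  rw [hpr', ← coe_toReal_model hP Sv scen h1 (by omega) (by omega), EReal.coe_le_coe_iff] at hcut
  rw [hrec, EReal.toReal_coe]
  -- The weights are nonnegative and sum to `1`: this is monotonicity and translation equivariance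
  -- of the risk measure.
  have h5 : ∑ j, p j * P.Φ (t + 1) j * g j ≤ ∑ j, p j * P.Φ (t + 1) j * z j + E := by
    have hsum := (P.dualSet_subset (t + 1) (by omega) hT hp).2
    calc _ ≤ ∑ j, p j * P.Φ (t + 1) j * (z j + E) := Finset.sum_le_sum fun j _ =>
          mul_le_mul_of_nonneg_left (hgz j) (weight_nonneg (by omega) hT hp j)
      _ = _ := by simp only [mul_add, Finset.sum_add_distrib, ← Finset.sum_mul, hsum, one_mul]
  have h6 := hpmax p hp
  linarith

/-- The models, real-valued from index `P.T` on, are bounded above through the recourse function, so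
`tendsto_increment_of_convex` applies to them on the polytope of feasible histories. No sampling is
involved. -/
theorem tendsto_model_increment (hP : P.FeasibleSetsBoundedNonempty) (Sv : P.Solver)
    (scen : ℕ → P.Scenario) {t : ℕ} (h1 : 1 ≤ t) (hT : t ≤ P.T) (σ : P.Scenario) :
    Tendsto (fun k =>
      (lowerApprox (t + 1) ((runState Sv scen (k + 1)).opt (t + 1)) (trial Sv scen k σ t)).toReal
      - (lowerApprox (t + 1) ((runState Sv scen k).opt (t + 1)) (trial Sv scen k σ t)).toReal)
      atTop (𝓝 0) := by
  rw [← tendsto_add_atTop_iff_nat P.T]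
  choose f hfc hfconv hf using fun k => exists_model hP Sv scen (k := k + P.T) h1 hT (by omega)
  have hfr : ∀ k h, (lowerApprox (t + 1) ((runState Sv scen (k + P.T)).opt (t + 1)) h).toReal
      = f k h := fun k h => by rw [hf, EReal.toReal_coe]
  obtain ⟨q, hq⟩ := recourse_regular hP h1 hT
  obtain ⟨C, hC⟩ := (hq σ).2.2
  have := tendsto_increment_of_convex (locallyConical_feasibleHist σ t)
    (isCompact_feasibleHist hP σ t hT) (f := f)
    (fun k => (hfconv k).subset (Set.subset_univ _) (convex_feasibleHist σ t)) hfc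
    (fun h _ => monotone_nat_of_le_succ fun k => by
      rw [← hfr, ← hfr, Nat.add_right_comm]
      exact toReal_model_mono hP Sv scen h1 hT (by omega) h)
    (fun k h hh => by
      refine le_trans ?_ (hC h hh)
      rw [← hfr, ← EReal.toReal_coe (q h), ← (hq σ).1 h hh]
      exact toReal_model_le hP Sv scen h1 hT (by omega) hh)
    (fun k => trial_mem hP Sv scen (k + P.T) σ hT)
  refine this.congr fun k => ?_
  rw [← hfr, ← hfr, Nat.add_right_comm]

/-- If every node at which the error is large infinitely often is sampled infinitely often among
these iterations, then the errors tend to zero. -/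
theorem tendsto_gap (hP : P.FeasibleSetsBoundedNonempty) (Sv : P.Solver)
    (scen : ℕ → P.Scenario)
    (hBC : ∀ t ≤ P.T, ∀ (σ : P.Scenario) (i : ℕ),
      (∃ᶠ k in atTop, 1 / ((i : ℝ) + 1) ≤ gap Sv scen k σ t) →
      ∃ᶠ k in atTop, 1 / ((i : ℝ) + 1) ≤ gap Sv scen k σ t ∧ ∀ s ≤ t, scen (k + 1) s = σ s)
    {t : ℕ} (h1 : 1 ≤ t) (hT : t ≤ P.T) (σ : P.Scenario) :
    Tendsto (fun k => gap Sv scen k σ t) atTop (𝓝 0) := by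
  induction hd : P.T - t generalizing t σ with
  | zero =>
    obtain rfl : t = P.T := by omega
    simp only [gap_last hP]
    exact tendsto_const_nhds
  | succ d ih =>
    have hT' : t + 1 ≤ P.T := by omega
    have hsum : Tendsto (fun k => ∑ j, gap Sv scen k (Function.update σ (t + 1) j) (t + 1)) atTop
        (𝓝 0) := by
      have := tendsto_finsetSum (Finset.univ : Finset (Fin (P.M (t + 1)))) fun j _ =>
        ih (by omega) hT' (Function.update σ (t + 1) j) (by omega)
      simpa using this
    -- The gap is the error after the iteration plus the increment of the model. At visiting
    -- iterations the error is bounded by the gaps of the children, so the gap is at most this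
    -- vanishing sequence.
    have hbound := hsum.add (tendsto_model_increment hP Sv scen h1 hT σ)
    rw [add_zero] at hbound
    rw [Metric.tendsto_atTop']
    intro ε hε
    obtain ⟨i, hi⟩ := exists_nat_one_div_lt hε
    have hev : ∀ᶠ k in atTop, gap Sv scen k σ t < 1 / ((i : ℝ) + 1) := by
      by_contra hn
      rw [not_eventually] at hn
      simp only [not_lt] at hn
      have hlt := hbound.eventually_lt_const (show (0 : ℝ) < 1 / ((i : ℝ) + 1) by positivity)
      obtain ⟨k, ⟨hk1, hk2⟩, hk3, hk4⟩ :=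
        ((hBC t hT σ i hn).and_eventually (hlt.and (eventually_ge_atTop P.T))).exists
      have := sampled_error_le hP Sv scen h1 hT' hk4 hk2
      rw [gap] at hk1
      linarith
    obtain ⟨N, hN⟩ := (hev.and (eventually_ge_atTop P.T)).exists_forall_of_atTop
    refine ⟨N, fun k hk => ?_⟩
    obtain ⟨h2, h3⟩ := hN k hk.le
    rw [Real.dist_eq, sub_zero, abs_of_nonneg (gap_nonneg hP Sv scen h1 hT h3 σ)]
    exact h2.trans hi

theorem M_pos (P : Problem) (t : ℕ) : 0 < P.M t := by
  by_cases ht : t < 2 ∨ P.T < t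
  · rw [P.M_eq_one t ht]; exact one_pos
  · push Not at ht
    rcases Nat.eq_zero_or_pos (P.M t) with h0 | h0
    · have := P.Φ_sum t ht.1 ht.2
      have he : IsEmpty (Fin (P.M t)) := by rw [h0]; infer_instance
      simp at this
    · exact h0

theorem exists_node_eq {t : ℕ} (m : P.Node t) : ∃ σ : P.Scenario, σ.node t = m := by
  refine ⟨fun s => if hs : s < t + 1 then m ⟨s, hs⟩ else ⟨0, P.M_pos s⟩, ?_⟩
  funext s
  exact dif_pos s.isLt

theorem tendsto_error (hP : P.FeasibleSetsBoundedNonempty) (Sv : P.Solver)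
    (scen : ℕ → P.Scenario) {t : ℕ} (h1 : 1 ≤ t) (hT : t ≤ P.T) (σ : P.Scenario)
    (hgap : Tendsto (fun k => gap Sv scen k σ t) atTop (𝓝 0)) :
    Tendsto (fun k => P.recourse (t + 1) (trial Sv scen k σ t)
      - lowerApprox (t + 1) ((runState Sv scen (k + 1)).opt (t + 1)) (trial Sv scen k σ t))
      atTop (𝓝 0) := by
  have hreal : Tendsto (fun k => (P.recourse (t + 1) (trial Sv scen k σ t)).toReal
      - (lowerApprox (t + 1) ((runState Sv scen (k + 1)).opt (t + 1))
        (trial Sv scen k σ t)).toReal) atTop (𝓝 0) := by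
    refine tendsto_of_tendsto_of_tendsto_of_le_of_le' tendsto_const_nhds hgap ?_ ?_
    · filter_upwards [eventually_ge_atTop P.T] with k hk
      exact sub_nonneg.2 (toReal_model_le hP Sv scen h1 hT (by omega)
        (trial_mem hP Sv scen k σ hT))
    · filter_upwards [eventually_ge_atTop P.T] with k hk
      exact sub_le_sub_left (toReal_model_mono hP Sv scen h1 hT hk _) _
  have h2 := (continuous_coe_real_ereal.tendsto 0).comp hreal
  rw [EReal.coe_zero] at h2
  refine h2.congr' ?_
  filter_upwards [eventually_ge_atTop P.T] with k hk
  rw [Function.comp_apply, EReal.coe_sub, coe_toReal_recourse hP h1 hT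
    (trial_mem hP Sv scen k σ hT), coe_toReal_model hP Sv scen h1 hT (by omega)]

/-! ### The first stage -/

theorem eq_idx₁ (j : Fin (P.M 1)) : j = P.idx₁ := by
  have := P.M_eq_one 1 (Or.inl (by norm_num))
  apply Fin.ext
  have h1 := j.isLt
  have h2 := P.idx₁.isLt
  omega

/-- With `u k` the first decision of iteration `k + 1` and `F xs` the optimal value, `F (u k) - gap
≤ F xs ≤ F (u k)`: the model is a minorant, and `u k` is feasible. The difference on the left is the
value of the subproblem. -/
theorem first_stage_convergence (hP : P.FeasibleSetsBoundedNonempty) (Sv : P.Solver)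
    (scen : ℕ → P.Scenario)
    (hgap : ∀ σ, Tendsto (fun k => gap Sv scen k σ 1) atTop (𝓝 0)) :
    (P.optimalValue ≠ ⊥ ∧ P.optimalValue ≠ ⊤ ∧
      Tendsto (fun k => P.subValue 1 P.idx₁ P.start ((runState Sv scen k).opt 2) []) atTop
        (𝓝 P.optimalValue)) ∧
    ∀ a : Fin P.n → ℝ, MapClusterPt a atTop
      (fun k => decision Sv (past scen k) (runState Sv scen k) 1 P.node₁) →
        P.IsFirstStageSolution a := by
  have hT := P.one_le_T
  let σ : P.Scenario := fun s => ⟨0, P.M_pos s⟩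
  have hst : P.start ∈ feasibleHist σ 0 := start_mem σ
  have hupd : Function.update σ (0 + 1) P.idx₁ = σ := by
    rw [← eq_idx₁ (σ 1)]
    exact Function.update_eq_self _ _
  obtain ⟨q, hq⟩ := recourse_regular hP le_rfl hT
  have hlsc : LowerSemicontinuousOn q (feasibleHist σ 1) := (hq σ).2.1
  let X := P.feasible 1 P.idx₁ P.start
  have hmem : ∀ x ∈ X, Function.update P.start 1 x ∈ feasibleHist σ 1 := fun x hx => by
    have := update_mem' hst (t := 0) hx
    rwa [hupd] at this
  obtain ⟨xs, hxs, hmin⟩ := exists_stage_solution hP (σ := σ) (t := 0) hT P.idx₁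
    (by rw [hupd]; exact hlsc) hst
  let F : (Fin P.n → ℝ) → ℝ := fun x => P.cost 1 P.idx₁ P.start x + q (Function.update P.start 1 x)
  have hopt : P.optimalValue = (F xs : EReal) :=
    stageValue_eq (fun x hx => (hq σ).1 _ (hmem x hx)) hxs hmin
  let u : ℕ → Fin P.n → ℝ := fun k => decision Sv (past scen k) (runState Sv scen k) 1 P.node₁
  have htrial : ∀ k, trial Sv scen k σ 0 = P.start := fun k => decisionHist_zero _ _ _ _
  have hu : ∀ k, P.T ≤ k → u k ∈ X ∧
      P.subValue 1 P.idx₁ P.start ((runState Sv scen k).opt 2) []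
        = ((F (u k) - gap Sv scen k σ 1 : ℝ) : EReal) := by
    intro k hk
    obtain ⟨h2, h3⟩ := subValue_trial hP Sv scen (t := 0) hT hk σ
    rw [trial_succ] at h3
    simp only [zero_add, htrial, eq_idx₁ (σ 1)] at h2 h3
    refine ⟨h2, h3.trans ?_⟩
    rw [(hq σ).1 _ (hmem _ h2), EReal.toReal_coe, add_sub_assoc]
    rfl
  have hle : ∀ k, P.T ≤ k → F (u k) - gap Sv scen k σ 1 ≤ F xs := by
    intro k hk
    rw [← EReal.coe_le_coe_iff, ← (hu k hk).2, subValue_nil]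
    refine (iInf₂_le xs hxs).trans ?_
    rw [EReal.coe_add]
    refine add_le_add le_rfl ?_
    rw [← (hq σ).1 _ (hmem xs hxs)]
    exact model_le_recourse hP Sv scen k le_rfl hT (hmem xs hxs)
  have hFu : Tendsto (fun k => F (u k)) atTop (𝓝 (F xs)) := by
    refine tendsto_of_tendsto_of_tendsto_of_le_of_le' tendsto_const_nhds
      (by simpa using (hgap σ).const_add (F xs)) ?_ ?_
    · filter_upwards [eventually_ge_atTop P.T] with k hk
      exact hmin _ (hu k hk).1
    · filter_upwards [eventually_ge_atTop P.T] with k hk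
      linarith [hle k hk]
  refine ⟨⟨?_, ?_, ?_⟩, fun a ha => ?_⟩
  · rw [hopt]; exact EReal.coe_ne_bot _
  · rw [hopt]; exact EReal.coe_ne_top _
  · rw [hopt]
    have h2 : Tendsto (fun k => F (u k) - gap Sv scen k σ 1) atTop (𝓝 (F xs)) := by
      simpa using hFu.sub (hgap σ)
    refine ((continuous_coe_real_ereal.tendsto _).comp h2).congr' ?_
    filter_upwards [eventually_ge_atTop P.T] with k hk
    rw [(hu k hk).2, Function.comp_apply]
  · have haX : a ∈ X := by
      by_contra hn
      have hev : ∀ᶠ x in 𝓝 a, x ∉ X :=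
        (isClosed_feasible 1 P.idx₁ P.start).isOpen_compl.mem_nhds hn
      obtain ⟨k, hk1, hk2⟩ := ((ha.frequently hev).and_eventually
        (eventually_ge_atTop P.T)).exists
      exact hk1 (hu k hk2).1
    have hcu : Continuous fun x : Fin P.n → ℝ => Function.update P.start 1 x :=
      (continuous_const (y := P.start)).update 1 continuous_id
    have hcost : Continuous fun x => P.cost 1 P.idx₁ P.start x :=
      continuous_cost 1 P.idx₁ continuous_const continuous_id
    have hFlsc : LowerSemicontinuousOn F X :=
      (hcost.lowerSemicontinuous.lowerSemicontinuousOn _).add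
        (hlsc.comp hcu.continuousOn fun x hx => hmem x hx)
    -- Lower semicontinuity of `F` on the feasible set suffices: a value above `F xs` at `a` would
    -- keep `F (u k)` away from its limit infinitely often.
    have hFa : F a ≤ F xs := by
      by_contra hn
      push Not at hn
      obtain ⟨y, hy1, hy2⟩ := exists_between hn
      have hev := eventually_nhdsWithin_iff.1 (hFlsc a haX y hy2)
      obtain ⟨k, hk1, hk2, hk3⟩ := ((ha.frequently hev).and_eventually
        ((hFu.eventually_lt_const hy1).and (eventually_ge_atTop P.T))).exists
      exact lt_asymm hk2 (hk1 (hu k hk3).1)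
    refine ⟨haX, fun y hy => ?_⟩
    rw [firstObjective, firstObjective, (hq σ).1 _ (hmem a haX), (hq σ).1 _ (hmem y hy),
      ← EReal.coe_add, ← EReal.coe_add, EReal.coe_le_coe_iff]
    exact hFa.trans (hmin y hy)

/-! ### Dependence on the sampled scenarios -/

theorem past_congr {scen scen' : ℕ → P.Scenario} {k : ℕ}
    (h : ∀ l, 1 ≤ l → l ≤ k → scen l = scen' l) : past scen k = past scen' k := by
  refine List.map_congr_left fun i hi => h (i + 1) (by omega) ?_
  have := List.mem_range.1 hi
  omega

theorem runState_congr (Sv : P.Solver) {scen scen' : ℕ → P.Scenario} {k : ℕ}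
    (h : ∀ l, 1 ≤ l → l ≤ k → scen l = scen' l) : runState Sv scen k = runState Sv scen' k := by
  induction k with
  | zero => rfl
  | succ k ih =>
    have h' : ∀ l, 1 ≤ l → l ≤ k → scen l = scen' l := fun l h1 h2 => h l h1 (by omega)
    rw [runState, runState, ih h', past_congr h', h (k + 1) (by omega) le_rfl]

/-- The decisions of iteration `k + 1` at a given node are selected knowing only the scenarios
`1..k`. Hence the event that the gap is large is independent of the path sampled at iteration `k +
1`. -/
theorem gap_congr (Sv : P.Solver) {scen scen' : ℕ → P.Scenario} {k : ℕ}
    (h : ∀ l, 1 ≤ l → l ≤ k → scen l = scen' l) (σ : P.Scenario) (t : ℕ) :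
    gap Sv scen k σ t = gap Sv scen' k σ t := by
  rw [gap, gap, trial, trial, runState_congr Sv h, past_congr h]

theorem gap_congr_node (Sv : P.Solver) (scen : ℕ → P.Scenario) (k : ℕ) {σ σ' : P.Scenario} {t : ℕ}
    (h : ∀ s ≤ t, σ s = σ' s) : gap Sv scen k σ t = gap Sv scen k σ' t := by
  rw [gap, gap, trial, trial, decisionHist_congr _ _ _ h]

/-! ### Conditional Borel–Cantelli argument -/

/-- The event that iteration `k` passes through the node of stage `t` of a scenario. -/
def passes {Ω : Type*} (scen : ℕ → Ω → P.Scenario) (σ : P.Scenario) (t k : ℕ) : Set Ω :=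
  {ω | ∀ s ≤ t, scen k ω s = σ s}

theorem passes_succ {Ω : Type*} (scen : ℕ → Ω → P.Scenario) (σ : P.Scenario) (t k : ℕ) :
    passes scen σ (t + 1) k = passes scen σ t k ∩ {ω | scen k ω (t + 1) = σ (t + 1)} := by
  ext ω
  refine ⟨fun h => ⟨fun s hs => h s (by omega), h (t + 1) le_rfl⟩, fun h s hs => ?_⟩
  rcases hs.eq_or_lt with rfl | hs
  · exact h.2
  · exact h.1 s (by omega)

section Sampling

variable {Ω : Type*} [m0 : MeasurableSpace Ω] {μ : Measure Ω} {scen : ℕ → Ω → P.Scenario}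

/-- The events determined by the scenarios of the iterations `1..k`. -/
def samplingFiltration (hscen : IsSampling μ scen) : Filtration ℕ m0 where
  seq k := ⨆ (l : ℕ) (s : ℕ) (_ : 1 ≤ l ∧ 2 ≤ s ∧ s ≤ P.T ∧ l ≤ k),
    MeasurableSpace.comap (fun ω => scen l ω s) ⊤
  mono' k k' hk := by
    refine iSup_le fun l => iSup_le fun s => iSup_le fun h => ?_
    exact le_iSup_of_le l (le_iSup_of_le s (le_iSup_of_le
      ⟨h.1, h.2.1, h.2.2.1, h.2.2.2.trans hk⟩ le_rfl))
  le' k := by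
    refine iSup_le fun l => iSup_le fun s => iSup_le fun h => ?_
    exact (hscen.measurable l s h.1 h.2.1 h.2.2.1).comap_le

/-- The events determined by the scenarios of the iterations before `k` and the stages before `t`
of iteration `k`. -/
abbrev samplingBefore (scen : ℕ → Ω → P.Scenario) (k t : ℕ) : MeasurableSpace Ω :=
  ⨆ (l : ℕ) (s : ℕ) (_ : 1 ≤ l ∧ 2 ≤ s ∧ s ≤ P.T ∧ (l < k ∨ l = k ∧ s < t)),
    MeasurableSpace.comap (fun ω => scen l ω s) ⊤

theorem subsingleton_of_trivial_stage {s : ℕ} (hs : s < 2 ∨ P.T < s) :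
    Subsingleton (Fin (P.M s)) := by
  rw [P.M_eq_one s hs]
  infer_instance

theorem measurableSet_stage (hscen : IsSampling μ scen) {k l s : ℕ} (h1 : 1 ≤ l) (hl : l ≤ k)
    (j : Fin (P.M s)) : MeasurableSet[samplingFiltration hscen k] {ω | scen l ω s = j} := by
  by_cases hs : 2 ≤ s ∧ s ≤ P.T
  · have hle : MeasurableSpace.comap (fun ω => scen l ω s) ⊤ ≤ samplingFiltration hscen k :=
      le_iSup_of_le (f := fun l => ⨆ (s : ℕ) (_ : 1 ≤ l ∧ 2 ≤ s ∧ s ≤ P.T ∧ l ≤ k),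
        MeasurableSpace.comap (fun ω => scen l ω s) ⊤) l
        (le_iSup_of_le s (le_iSup_of_le ⟨h1, hs.1, hs.2, hl⟩ le_rfl))
    exact hle _ ⟨{j}, trivial, rfl⟩
  · have := subsingleton_of_trivial_stage (P := P) (s := s) (by omega)
    have he : {ω | scen l ω s = j} = Set.univ :=
      Set.eq_univ_of_forall fun ω => Subsingleton.elim _ _
    rw [he]
    exact MeasurableSet.univ

/-- The scenarios `1..k` take finitely many values, as only the stages up to `T` branch, so `B` is a
countable union of measurable fibres. This yields measurability without any regularity of the
selection rules of the solver. -/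
theorem measurableSet_of_congr (hscen : IsSampling μ scen) {k : ℕ} {B : Set Ω}
    (hB : ∀ ω ω', (∀ l, 1 ≤ l → l ≤ k → scen l ω = scen l ω') → ω ∈ B → ω' ∈ B) :
    MeasurableSet[samplingFiltration hscen k] B := by
  let R : Ω → (l : Fin k) → (s : Fin (P.T + 1)) → Fin (P.M s) := fun ω l s => scen (l + 1) ω s
  have hR : ∀ r, MeasurableSet[samplingFiltration hscen k] (R ⁻¹' {r}) := by
    intro r
    have he : R ⁻¹' {r} = ⋂ (l : Fin k) (s : Fin (P.T + 1)), {ω | scen (l + 1) ω s = r l s} := by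
      ext ω
      simp only [Set.mem_preimage, Set.mem_singleton_iff, Set.mem_iInter, Set.mem_ofPred_eq]
      exact ⟨fun h l s => by rw [← h], fun h => funext fun l => funext fun s => h l s⟩
    rw [he]
    exact MeasurableSet.iInter fun l => MeasurableSet.iInter fun s =>
      measurableSet_stage hscen (by omega) (by omega) _
  have he : B = ⋃ r ∈ R '' B, R ⁻¹' {r} := by
    ext ω
    simp only [Set.mem_iUnion, Set.mem_preimage, Set.mem_singleton_iff, exists_prop,
      exists_eq_right']
    refine ⟨fun h => ⟨ω, h, rfl⟩, ?_⟩
    rintro ⟨ω', hω', h⟩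
    refine hB ω' ω (fun l h1 hl => ?_) hω'
    funext s
    by_cases hs : s < P.T + 1
    · have h2 := congrFun (congrFun h ⟨l - 1, by omega⟩) ⟨s, hs⟩
      simp only [R, Nat.sub_add_cancel h1] at h2
      exact h2
    · have := subsingleton_of_trivial_stage (P := P) (s := s) (by omega)
      exact Subsingleton.elim _ _
  rw [he]
  exact MeasurableSet.biUnion (Set.to_countable _) fun r _ => hR r

theorem measurableSet_passes (hscen : IsSampling μ scen) (σ : P.Scenario) (t : ℕ) {k l : ℕ}
    (h1 : 1 ≤ l) (hl : l ≤ k) :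
    MeasurableSet[samplingFiltration hscen k] (passes scen σ t l) :=
  measurableSet_of_congr hscen fun ω ω' h hω s hs => by
    rw [← h l h1 hl]
    exact hω s hs

/-- The probability that an iteration passes through a node of stage `t`. -/
noncomputable def nodeProb (P : Problem) (σ : P.Scenario) (t : ℕ) : ℝ :=
  ∏ s ∈ Finset.Icc 2 t, P.Φ s (σ s)

theorem nodeProb_pos (σ : P.Scenario) {t : ℕ} (hT : t ≤ P.T) : 0 < P.nodeProb σ t :=
  Finset.prod_pos fun s hs => by
    rw [Finset.mem_Icc] at hs
    exact P.Φ_pos s hs.1 (hs.2.trans hT) _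

/-- Induction on the stage: the realization sampled last is independent of the past iterations
together with the earlier stages of the current one. Stages `0` and `1` are deterministic, so their
factor is `1`. -/
theorem measure_inter_passes (hscen : IsSampling μ scen) (σ : P.Scenario) {k : ℕ} {B : Set Ω}
    (hB : MeasurableSet[samplingFiltration hscen k] B) :
    ∀ {t : ℕ}, t ≤ P.T →
      μ (B ∩ passes scen σ t (k + 1)) = μ B * ENNReal.ofReal (P.nodeProb σ t) := by
  intro t
  induction t with
  | zero =>
    intro _
    have he : passes scen σ 0 (k + 1) = Set.univ := Set.eq_univ_of_forall fun ω s hs => by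
      have := subsingleton_of_trivial_stage (P := P) (s := s) (by omega)
      exact Subsingleton.elim _ _
    simp [he, nodeProb]
  | succ t ih =>
    intro hT
    rw [passes_succ, ← Set.inter_assoc]
    by_cases ht : 2 ≤ t + 1
    · have hle : samplingFiltration hscen k ≤ samplingBefore scen (k + 1) (t + 1) := by
        refine iSup_le fun l => iSup_le fun s => iSup_le fun h => ?_
        exact le_iSup_of_le l (le_iSup_of_le s (le_iSup_of_le
          ⟨h.1, h.2.1, h.2.2.1, Or.inl (by omega)⟩ le_rfl))
      have hpass : MeasurableSet[samplingBefore scen (k + 1) (t + 1)] (passes scen σ t (k + 1)) := by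
        have he : passes scen σ t (k + 1)
            = ⋂ (s : ℕ) (_ : s ≤ t), {ω | scen (k + 1) ω s = σ s} := by
          ext ω
          simp [passes]
        rw [he]
        refine MeasurableSet.iInter fun s => MeasurableSet.iInter fun hs => ?_
        by_cases hs2 : 2 ≤ s
        · have hle' : MeasurableSpace.comap (fun ω => scen (k + 1) ω s) ⊤ ≤ samplingBefore scen (k + 1) (t + 1) :=
            le_iSup_of_le (k + 1) (le_iSup_of_le s (le_iSup_of_le
              ⟨by omega, hs2, by omega, Or.inr ⟨rfl, by omega⟩⟩ le_rfl))
          exact hle' _ ⟨{σ s}, trivial, rfl⟩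
        · have := subsingleton_of_trivial_stage (P := P) (s := s) (by omega)
          have he : {ω | scen (k + 1) ω s = σ s} = Set.univ :=
            Set.eq_univ_of_forall fun ω => Subsingleton.elim _ _
          rw [he]
          exact MeasurableSet.univ
      have hind : Indep (MeasurableSpace.comap (fun ω => scen (k + 1) ω (t + 1)) ⊤)
          (samplingBefore scen (k + 1) (t + 1)) μ :=
        hscen.indep (k + 1) (t + 1) (by omega) ht hT
      have hmul := (Indep_iff _ _ μ).1 hind {ω | scen (k + 1) ω (t + 1) = σ (t + 1)}
        (B ∩ passes scen σ t (k + 1)) ⟨{σ (t + 1)}, trivial, rfl⟩ ((hle _ hB).inter hpass)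
      rw [Set.inter_comm, hmul, hscen.law (k + 1) (t + 1) (by omega) ht hT, ih (by omega),
        show P.nodeProb σ (t + 1) = _ from Finset.prod_Icc_succ_top ht _,
        ENNReal.ofReal_mul (Finset.prod_nonneg fun s hs => ?_), mul_comm, mul_assoc]
      · rfl
      · rw [Finset.mem_Icc] at hs
        exact (P.Φ_pos s hs.1 (by omega) _).le
    · have := subsingleton_of_trivial_stage (P := P) (s := t + 1) (by omega)
      have he : {ω | scen (k + 1) ω (t + 1) = σ (t + 1)} = Set.univ :=
        Set.eq_univ_of_forall fun ω => Subsingleton.elim _ _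
      rw [he, Set.inter_univ, ih (by omega), nodeProb, nodeProb, Finset.Icc_eq_empty (by omega),
        Finset.Icc_eq_empty (by omega)]

/-- If events that do not anticipate the sampling occur infinitely often, then almost surely a
given node is sampled infinitely often when they occur. -/
theorem ae_frequently_passes [IsProbabilityMeasure μ] (hscen : IsSampling μ scen)
    (σ : P.Scenario) {t : ℕ} (hT : t ≤ P.T) {B : ℕ → Set Ω}
    (hB : ∀ k, MeasurableSet[samplingFiltration hscen k] (B k)) :
    ∀ᵐ ω ∂μ, (∃ᶠ k in atTop, ω ∈ B k) →
      ∃ᶠ k in atTop, ω ∈ B k ∧ ω ∈ passes scen σ t (k + 1) := by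
  set ℱ := samplingFiltration hscen
  have hBm : ∀ k, MeasurableSet (B k) := fun k => ℱ.le k _ (hB k)
  have hpm : ∀ k, MeasurableSet (passes scen σ t (k + 1)) := fun k =>
    ℱ.le (k + 1) _ (measurableSet_passes hscen σ t (by omega) le_rfl)
  -- The index is shifted so that `A n` is known at time `n`, while `B k` is known one step before
  -- `A (k + 1)`.
  let A : ℕ → Set Ω := fun n => Nat.casesOn n ∅ fun k => B k ∩ passes scen σ t (k + 1)
  have hA : ∀ n, MeasurableSet[ℱ n] (A n) := by
    rintro (_ | k)
    · exact @MeasurableSet.empty _ (ℱ 0)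
    · exact (ℱ.mono (Nat.le_succ k) _ (hB k)).inter
        (measurableSet_passes hscen σ t (by omega) le_rfl)
  -- The conditional probability of `A (k + 1)` given iterations `1..k` is the constant `nodeProb`
  -- on `B k` and `0` elsewhere. The sum of these diverges exactly when the events `B k` occur
  -- infinitely often, and Lévy's criterion transfers this to `A`.
  have hcond : ∀ k, (B k).indicator (fun _ => P.nodeProb σ t)
      =ᵐ[μ] μ[(A (k + 1)).indicator (1 : Ω → ℝ) | ℱ k] := by
    intro k
    refine ae_eq_condExp_of_forall_setIntegral_eq (ℱ.le k) ?_ ?_ ?_ ?_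
    · exact (integrable_const (1 : ℝ)).indicator ((hBm k).inter (hpm k))
    · intro s _ _
      exact ((integrable_const _).indicator (hBm k)).integrableOn
    · intro s hs _
      have hsm := ℱ.le k _ hs
      rw [setIntegral_indicator (hBm k), setIntegral_const, smul_eq_mul]
      have h1 : ∫ ω in s, (A (k + 1)).indicator (1 : Ω → ℝ) ω ∂μ
          = μ.real (s ∩ (B k ∩ passes scen σ t (k + 1))) := by
        rw [setIntegral_indicator ((hBm k).inter (hpm k))]
        simp
      rw [h1, ← Set.inter_assoc, measureReal_def, measureReal_def,
        measure_inter_passes hscen σ (hs.inter (hB k)) hT, ENNReal.toReal_mul,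
        ENNReal.toReal_ofReal (nodeProb_pos σ hT).le]
    · exact (StronglyMeasurable.indicator stronglyMeasurable_const (hB k)).aestronglyMeasurable
  have hlim := Set.limsup_eq_tendsto_sum_indicator_atTop (nodeProb_pos σ hT) B
  filter_upwards [ae_mem_limsup_atTop_iff (ℱ := ℱ) μ hA, ae_all_iff.2 hcond] with ω hω hc hf
  have h1 : ω ∈ limsup B atTop := mem_limsup_iff_frequently_mem.2 hf
  rw [hlim] at h1
  have h2 : ω ∈ limsup A atTop := by
    rw [hω]
    refine Tendsto.congr (fun n => ?_) h1
    exact Finset.sum_congr rfl fun k _ => hc k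
  rw [mem_limsup_iff_frequently_mem, frequently_atTop] at h2
  rw [frequently_atTop]
  intro N
  obtain ⟨n, hn, hmem⟩ := h2 (N + 1)
  obtain ⟨k, rfl⟩ : ∃ k, n = k + 1 := ⟨n - 1, by omega⟩
  exact ⟨k, by omega, hmem⟩

end Sampling

end Problem

end MSLP

/-! ### Almost sure convergence -/

theorem theorem2 (P : MSLP.Problem) (hP : P.FeasibleSetsBoundedNonempty) (Sv : P.Solver)
    {Ω : Type*} [MeasurableSpace Ω] (μ : Measure Ω) [IsProbabilityMeasure μ]
    (scen : ℕ → Ω → P.Scenario) (hscen : MSLP.Problem.IsSampling μ scen) :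
    (∀ᵐ ω ∂μ, MSLP.Problem.ReportsInfeasible Sv (fun k => scen k ω)) ∨
    (∀ᵐ ω ∂μ, ∃ (S : ℕ → P.State) (x : ℕ → (t : ℕ) → P.Node t → Fin P.n → ℝ),
      MSLP.Problem.IsRun Sv (fun k => scen k ω) S x ∧
      (∀ t, 1 ≤ t → t + 1 ≤ P.T → ∀ m : P.Node t,
        {k | 1 ≤ k ∧ MSLP.Problem.Scenario.PassesParent (scen k ω) m}.Infinite ∧
        Tendsto
          (fun k => P.recourse (t + 1) (MSLP.Problem.history (x k) m)
            - MSLP.lowerApprox (t + 1) ((S k).opt (t + 1)) (MSLP.Problem.history (x k) m))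
          (atTop ⊓ 𝓟 {k | 1 ≤ k ∧ MSLP.Problem.Scenario.PassesParent (scen k ω) m})
          (𝓝 0)) ∧
      (P.optimalValue ≠ ⊥ ∧ P.optimalValue ≠ ⊤ ∧
        Tendsto (fun k => P.subValue 1 P.idx₁ P.start ((S k).opt 2) ((S (k + 1)).feas 2)) atTop
          (𝓝 P.optimalValue)) ∧
      (∀ a : Fin P.n → ℝ, MapClusterPt a atTop (fun k => x (k + 1) 1 P.node₁) →
        P.IsFirstStageSolution a)) := by
  open MSLP.Problem in
  right
  -- There may be uncountably many scenarios, but there are only countably many nodes; one scenario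
  -- through each node keeps the union of exceptional null sets countable.
  choose ext hext using fun (t : ℕ) (m : P.Node t) => exists_node_eq m
  have hinf : ∀ᵐ ω ∂μ, ∀ (t : ℕ) (m : P.Node t), t ≤ P.T →
      ∃ᶠ k in atTop, ω ∈ passes scen (ext t m) t (k + 1) := by
    rw [ae_all_iff]
    intro t
    rw [ae_all_iff]
    intro m
    by_cases hT : t ≤ P.T
    · filter_upwards [ae_frequently_passes hscen (ext t m) hT (B := fun _ => Set.univ)
        fun _ => MeasurableSet.univ] with ω hω _
      exact (hω (Eventually.of_forall fun _ => trivial).frequently).mono fun k hk => hk.2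
    · exact Eventually.of_forall fun ω h => absurd h hT
  have hgap : ∀ᵐ ω ∂μ, ∀ (t : ℕ) (m : P.Node t) (i : ℕ), t ≤ P.T →
      (∃ᶠ k in atTop, 1 / ((i : ℝ) + 1) ≤ gap Sv (fun k => scen k ω) k (ext t m) t) →
      ∃ᶠ k in atTop, 1 / ((i : ℝ) + 1) ≤ gap Sv (fun k => scen k ω) k (ext t m) t ∧
        ω ∈ passes scen (ext t m) t (k + 1) := by
    rw [ae_all_iff]
    intro t
    rw [ae_all_iff]
    intro m
    rw [ae_all_iff]
    intro i
    by_cases hT : t ≤ P.T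
    · filter_upwards [ae_frequently_passes hscen (ext t m) hT
        (B := fun k => {ω | 1 / ((i : ℝ) + 1) ≤ gap Sv (fun k => scen k ω) k (ext t m) t})
        fun k => measurableSet_of_congr hscen fun ω ω' h hω => by
          change _ ≤ gap Sv (fun k => scen k ω') _ (ext t m) t
          rw [← gap_congr Sv h]
          exact hω] with ω hω _
      exact hω
    · exact Eventually.of_forall fun ω h => absurd h hT
  filter_upwards [hinf, hgap] with ω hω1 hω2
  have hnode : ∀ (σ : P.Scenario) (t : ℕ), ∀ s ≤ t, ext t (σ.node t) s = σ s := by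
    intro σ t s hs
    exact congrFun (hext t (σ.node t)) ⟨s, by omega⟩
  have hconv : ∀ t, 1 ≤ t → t ≤ P.T → ∀ σ : P.Scenario,
      Tendsto (fun k => gap Sv (fun k => scen k ω) k σ t) atTop (𝓝 0) := fun t h1 hT σ =>
    tendsto_gap hP Sv _ (fun t hT σ i hf => by
      have hg : ∀ k, gap Sv (fun k => scen k ω) k (ext t (σ.node t)) t
          = gap Sv (fun k => scen k ω) k σ t := fun k =>
        gap_congr_node Sv _ k (hnode σ t)
      have h2 := hω2 t (σ.node t) i hT
      simp only [hg] at h2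
      exact (h2 hf).mono fun k hk => ⟨hk.1, fun s hs => (hk.2 s hs).trans (hnode σ t s hs)⟩)
      h1 hT σ
  obtain ⟨hval, hacc⟩ := first_stage_convergence hP Sv (fun k => scen k ω)
    fun σ => hconv 1 le_rfl P.one_le_T σ
  refine ⟨_, _, isRun_runState hP Sv _, fun t h1 hT m => ⟨?_, ?_⟩, ?_, ?_⟩
  · refine Nat.frequently_atTop_iff_infinite.1 ?_
    rw [frequently_atTop]
    intro N
    obtain ⟨k, hk, hpass⟩ := frequently_atTop.1 (hω1 t m (by omega)) N
    refine ⟨k + 1, by omega, by omega, fun s hs => ?_⟩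
    rw [hpass s (by omega)]
    exact congrFun (hext t m) s
  -- The chosen run defines decisions at every node, visited or not, and the errors tend to `0`
  -- along all iterations. The shift by one matches iteration `k + 1` with `trial` at index `k`.
  · refine Tendsto.mono_left ?_ inf_le_left
    rw [← tendsto_add_atTop_iff_nat 1]
    have := tendsto_error hP Sv (fun k => scen k ω) h1 (by omega) (ext t m)
      (hconv t h1 (by omega) _)
    refine this.congr fun k => ?_
    rw [trial, ← history_decision, hext]
    rfl
  · exact hval
  · exact hacc
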